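/- Let $N\ge 1$, $k\ge 0$, and let $\mathbb A\subset\mathbb R^3$ be the $z$-axis, with cylindrical coordinates $(\rho,\phi,z)$ on $\mathbb R^3$ and $\xi=\partial_\phi$. Complex hyperbolic space $\mathbb H=\mathbb H^{k+1}_{\mathbb C}$ is $\mathbb R\times\mathbb R\times\mathbb R^k\times\mathbb R^k\ni(u,v,\chi,\psi)$ with the metric $$du^2+e^{4u}(dv+\chi\cdot d\psi-\psi\cdot d\chi)^2+e^{2u}(d\chi\cdot d\chi+d\psi\cdot d\psi).$$ **Reduced Problem.** Let $I_1,\dots,I_N\subset\mathbb A$ be bounded open intervals with disjoint closures, $\Sigma=\mathbb A\setminus\bigcup_j I_j$, with connected components $\Sigma_1,\dots,\Sigma_{N+1}$, and let $v_j\in\mathbb R$, $\psi_j\in\mathbb R^k$ $(1\le j\le N+1)$ be constants. Let $u_0$ be the potential of the uniform charge distribution on $\Sigma$, normalized so that $u_0+\log\rho\to0$ at infinity, that is $$u_0(x)=\tfrac12\int_{\mathbb R}\Big(\frac{\mathbf 1_{\Sigma}(0,0,s)}{|x-(0,0,s)|}-\frac1{\sqrt{1+s^2}}\Big)ds .$$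 Let $\tilde\varphi=(u_0,\tilde v,\tilde\chi,\tilde\psi)\colon\mathbb R^3\setminus\Sigma\to\mathbb H$ be a smooth map which equals $(u_0,v_j,0,\psi_j)$ in a neighborhood of each $\Sigma_j$ and is such that $\tilde v,\tilde\chi,\tilde\psi$ depend only on the polar angle outside some ball. A solution of the Reduced Problem is a smooth harmonic map $\varphi=(u,v,\chi,\psi)\colon\mathbb R^3\setminus\Sigma\to\mathbb H$, invariant under rotations about $\mathbb A$, such that $\operatorname{dist}(\varphi,\tilde\varphi)$ is bounded in a neighborhood of each $\Sigma_j$ (off $\Sigma$), and $\operatorname{dist}(\varphi,\tilde\varphi)\to0$ as $x\to\infty$ in $\mathbb R^3\setminus\Sigma$. **Theorem.** Let $\varphi=(u,v,\chi,\psi)$ be a solution of the Reduced Problem, and put $\omega=2(dv+\chi\cdot d\psi-\psi\cdot d\chi)$. Let $*$ be the Hodge star operator of Euclidean $\mathbb R^3$. Then there are smooth functions $w$ and $\lambda$ on $\mathbb R^3\setminus\mathbb A$ and, for each such $w$, a smooth $\mathbb R^k$-valued function $\theta$ on $\mathbb R^3\setminus\mathbb A$, with $$dw=e^{4u}\,i_\xi{*\omega},\qquad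 d\theta=e^{2u}\,i_\xi{*d\psi}-w\,d\chi,$$ $$\begin{aligned}d\lambda=du&+\rho\big[u_\rho^2-u_z^2+\tfrac14e^{4u}(\omega_\rho^2-\omega_z^2)+e^{2u}(|\chi_\rho|^2-|\chi_z|^2+|\psi_\rho|^2-|\psi_z|^2)\big]d\rho\\&+2\rho\big[u_\rho u_z+\tfrac14e^{4u}\omega_\rho\omega_z+e^{2u}(\chi_\rho\cdot\chi_z+\psi_\rho\cdot\psi_z)\big]dz.\end{aligned}$$ For every choice of such $w,\lambda,\theta$, define on $M=\mathbb R\times(\mathbb R^3\setminus\mathbb A)$ $$g=-\rho^2e^{2u}\,dt^2+e^{-2u}(d\phi-w\,dt)^2+e^{2\lambda}(d\rho^2+dz^2),\qquad A=-(\chi\,d\phi+\theta\,dt).$$ Then $g$ is a smooth Lorentzian metric, and $(M,g,A)$ is a solution of the Einstein/Abelian-Yang-Mills equations with gauge group $\mathbb T^k$: $$\operatorname{Ric}_g-\tfrac12R_g\,g=2T_F,\quad F=dA,\quad d{*F}=0,\quad T_F(X,Y)=\tfrac12\operatorname{tr}_g\big(i_XF\cdot i_YF+i_X{*F}\cdot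 i_Y{*F}\big),$$ where the last two Hodge stars are those of $g$ and the dot is the Euclidean inner product of $\mathbb R^k$. -/

import Mathlib

open scoped ContDiff Topology Matrix InnerProductSpace

namespace EYM

noncomputable section

/-! ## Tensor calculus in coordinates -/

section Coordinates

variable {ι : Type*} [Fintype ι] [DecidableEq ι]

/-- The partial derivative `∂_i f`. -/
def pd (i : ι) (f : (ι → ℝ) → ℝ) (p : ι → ℝ) : ℝ :=
  fderiv ℝ f p (Pi.single i 1)

/-- The Christoffel symbol `Γ^a_{bc}` of the metric with component matrix `g`. -/
def christoffel (g : (ι → ℝ) → Matrix ι ι ℝ) (a b c : ι) (p : ι → ℝ) : ℝ :=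
  (1 / 2) * ∑ d, (g p)⁻¹ a d *
    (pd b (fun q => g q d c) p + pd c (fun q => g q d b) p - pd d (fun q => g q b c) p)

/-- The Ricci tensor
`Ric_{bc} = ∂_a Γ^a_{bc} - ∂_c Γ^a_{ba} + Γ^a_{ad} Γ^d_{bc} - Γ^a_{cd} Γ^d_{ba}`. -/
def ricci (g : (ι → ℝ) → Matrix ι ι ℝ) (b c : ι) (p : ι → ℝ) : ℝ :=
  ∑ a, (pd a (christoffel g a b c) p - pd c (christoffel g a b a) p
    + ∑ d, (christoffel g a a d p * christoffel g d b c p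
      - christoffel g a c d p * christoffel g d b a p))

/-- The scalar curvature `R = g^{bc} Ric_{bc}`. -/
def scalarCurvature (g : (ι → ℝ) → Matrix ι ι ℝ) (p : ι → ℝ) : ℝ :=
  ∑ b, ∑ c, (g p)⁻¹ b c * ricci g b c p

/-- The components `F_{ab} = ∂_a A_b - ∂_b A_a` of `F = dA`. -/
def fieldStrength (A : (ι → ℝ) → ι → ℝ) (a b : ι) (p : ι → ℝ) : ℝ :=
  pd a (fun q => A q b) p - pd b (fun q => A q a) p

end Coordinates

/-- Component vectors of points in a four-dimensional coordinate domain. -/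
abbrev R4 : Type := Fin 4 → ℝ

/-- The Levi-Civita symbol, as the determinant of the matrix with rows `e_a, e_b, e_c, e_d`. -/
def leviCivita (a b c d : Fin 4) : ℝ :=
  Matrix.det (Matrix.of ![Pi.single a 1, Pi.single b 1, Pi.single c 1, (Pi.single d 1 : Fin 4 → ℝ)])

/-- The components of the Hodge dual of a two-form:
`(*F)_{ab} = (1/2) |det g|^{1/2} ε_{cdab} F^{cd}`. -/
def hodge (g : R4 → Matrix (Fin 4) (Fin 4) ℝ) (F : Fin 4 → Fin 4 → R4 → ℝ)
    (a b : Fin 4) (p : R4) : ℝ :=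
  (1 / 2) * √|(g p).det| * ∑ c, ∑ d, leviCivita c d a b *
    ∑ e, ∑ f, (g p)⁻¹ c e * (g p)⁻¹ d f * F e f p

/-- The components of the exterior derivative of a two-form. -/
def extDerivTwo (G : Fin 4 → Fin 4 → R4 → ℝ) (a b c : Fin 4) (p : R4) : ℝ :=
  pd a (G b c) p + pd b (G c a) p + pd c (G a b) p

/-- The energy-momentum tensor of `F = dA`, where `A` has `k` real components:
`T(X,Y) = (1/2) tr_g (i_X F · i_Y F + i_X *F · i_Y *F)`, the dot being the Euclidean inner product
of `ℝ^k`. -/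
def stressEnergy {k : ℕ} (g : R4 → Matrix (Fin 4) (Fin 4) ℝ) (A : Fin k → R4 → R4)
    (a b : Fin 4) (p : R4) : ℝ :=
  (1 / 2) * ∑ c, ∑ d, (g p)⁻¹ c d * ∑ i,
    (fieldStrength (A i) a c p * fieldStrength (A i) b d p
      + hodge g (fieldStrength (A i)) a c p * hodge g (fieldStrength (A i)) b d p)

/-- `(g, A)` is a smooth Lorentzian metric (signature `- + + +`) and a smooth `ℝ^k`-valued one-form
on the coordinate domain `U`, which satisfy the Einstein/Abelian-Yang-Mills equations
`Ric - (1/2) R g = 2 T_F`, `F = dA`, `d * F = 0`. -/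
structure SolvesInCoordinates {k : ℕ} (U : Set R4) (g : R4 → Matrix (Fin 4) (Fin 4) ℝ)
    (A : Fin k → R4 → R4) : Prop where
  smooth_metric : ∀ a b, ContDiffOn ℝ ∞ (fun p => g p a b) U
  smooth_form : ∀ i a, ContDiffOn ℝ ∞ (fun p => A i p a) U
  symmetric : ∀ p ∈ U, (g p).IsSymm
  lorentzian : ∀ p ∈ U, ∃ P : Matrix (Fin 4) (Fin 4) ℝ, IsUnit P.det ∧
    Pᵀ * g p * P = Matrix.diagonal ![-1, 1, 1, 1]
  einstein : ∀ p ∈ U, ∀ a b,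
    ricci g a b p - (1 / 2) * scalarCurvature g p * g p a b = 2 * stressEnergy g A a b p
  yangMills : ∀ p ∈ U, ∀ i a b c,
    extDerivTwo (hodge g (fieldStrength (A i))) a b c p = 0

/-! ## Solutions on an open subset of `ℝ × ℝ³` -/

/-- Euclidean three-space. -/
abbrev E3 : Type := EuclideanSpace ℝ (Fin 3)

/-- `(M, g, A)` solves the Einstein/Abelian-Yang-Mills equations on the four-manifold `M`, an open
subset of `ℝ × ℝ³`: the set `M` is covered by local coordinate systems `Φ : U → M` (local
diffeomorphisms from open subsets of `ℝ⁴`) in which the components of the metric `g` and of the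
one-form `A` satisfy the equations. Since the equations are tensorial, the choice of the coordinate
systems is immaterial. -/
def IsEYMSolution {k : ℕ} (M : Set (ℝ × E3)) (g : ℝ × E3 → ℝ × E3 → ℝ × E3 → ℝ)
    (A : Fin k → ℝ × E3 → ℝ × E3 → ℝ) : Prop :=
  ∀ p ∈ M, ∃ (U : Set R4) (Φ : R4 → ℝ × E3),
    IsOpen U ∧ ContDiffOn ℝ ∞ Φ U ∧ Set.MapsTo Φ U M ∧ p ∈ Φ '' U ∧
    (∀ X ∈ U, Function.Bijective (fderiv ℝ Φ X)) ∧
    SolvesInCoordinates U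
      (fun X => Matrix.of fun a b =>
        g (Φ X) (fderiv ℝ Φ X (Pi.single a 1)) (fderiv ℝ Φ X (Pi.single b 1)))
      (fun i X a => A i (Φ X) (fderiv ℝ Φ X (Pi.single a 1)))

/-! ## Complex hyperbolic space and harmonic maps -/

/-- The index set of the coordinates `(u, v, χ, ψ)` of complex hyperbolic space of complex
dimension `k + 1`. -/
abbrev HIdx (k : ℕ) : Type := Fin 2 ⊕ (Fin k ⊕ Fin k)

/-- Points (and tangent vectors) of complex hyperbolic space in the global coordinates
`(u, v, χ, ψ) ∈ ℝ × ℝ × ℝ^k × ℝ^k`. -/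
abbrev HSpace (k : ℕ) : Type := HIdx k → ℝ

variable {k : ℕ}

/-- The coordinate `u`. -/
def uu (p : HSpace k) : ℝ := p (Sum.inl 0)
/-- The coordinate `v`. -/
def vv (p : HSpace k) : ℝ := p (Sum.inl 1)
/-- The coordinate `χ_i`. -/
def chi (i : Fin k) (p : HSpace k) : ℝ := p (Sum.inr (Sum.inl i))
/-- The coordinate `ψ_i`. -/
def psi (i : Fin k) (p : HSpace k) : ℝ := p (Sum.inr (Sum.inr i))

/-- The point with coordinates `(u, v, χ, ψ)`. -/
def mkH (u v : ℝ) (χ ψ : Fin k → ℝ) : HSpace k := Sum.elim ![u, v] (Sum.elim χ ψ)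

/-- The one-form `dv + χ · dψ - ψ · dχ` at `p`, evaluated on `X`. -/
def contactForm (p X : HSpace k) : ℝ :=
  vv X + ∑ i, (chi i p * psi i X - psi i p * chi i X)

/-- The metric of complex hyperbolic space,
`du² + e^{4u} (dv + χ · dψ - ψ · dχ)² + e^{2u} (dχ · dχ + dψ · dψ)`. -/
def hypForm (p X Y : HSpace k) : ℝ :=
  uu X * uu Y + Real.exp (4 * uu p) * (contactForm p X * contactForm p Y)
    + Real.exp (2 * uu p) * ∑ i, (chi i X * chi i Y + psi i X * psi i Y)

/-- The component matrix of the metric of complex hyperbolic space. -/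
def hypMetric (p : HSpace k) : Matrix (HIdx k) (HIdx k) ℝ :=
  Matrix.of fun a b => hypForm p (Pi.single a 1) (Pi.single b 1)

/-- The Riemannian distance of complex hyperbolic space. -/
def hypDist (p q : HSpace k) : ℝ :=
  sInf {L : ℝ | ∃ γ : ℝ → HSpace k, ContDiff ℝ 1 γ ∧ γ 0 = p ∧ γ 1 = q ∧
    L = ∫ t in (0 : ℝ)..1, √(hypForm (γ t) (deriv γ t) (deriv γ t))}

/-- The component `τ^a` of the tension of a map from a domain of `ℝ³` into a manifold with global
coordinates and component matrix `h` of the metric. -/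
def tension {ι : Type*} [Fintype ι] [DecidableEq ι] (h : (ι → ℝ) → Matrix ι ι ℝ)
    (φ : E3 → ι → ℝ) (a : ι) (x : E3) : ℝ :=
  Laplacian.laplacian (fun y => φ y a) x
    + ∑ b, ∑ c, ∑ j : Fin 3, christoffel h a b c (φ x)
      * fderiv ℝ (fun y => φ y b) x (EuclideanSpace.single j 1)
      * fderiv ℝ (fun y => φ y c) x (EuclideanSpace.single j 1)

/-- `φ` is a (smooth) harmonic map from `Ω` into complex hyperbolic space. -/
def IsHarmonicMap (Ω : Set E3) (φ : E3 → HSpace k) : Prop :=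
  ContDiffOn ℝ ∞ φ Ω ∧ ∀ x ∈ Ω, ∀ a, tension hypMetric φ a x = 0

/-! ## The Reduced Problem -/

/-- The `z`-axis. -/
def zAxis : Set E3 := {x | x 0 = 0 ∧ x 1 = 0}

/-- The unit vector in the direction of the `z`-axis. -/
def eZ : E3 := EuclideanSpace.single 2 1

/-- Rotation by the angle `α` around the `z`-axis. -/
def rotZ (α : ℝ) (x : E3) : E3 :=
  !₂[Real.cos α * x 0 - Real.sin α * x 1, Real.sin α * x 0 + Real.cos α * x 1, x 2]

/-- The data of the Reduced Problem: `N` bounded open intervals `I_j = (a_j, b_j)` on the `z`-axis,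
in increasing order and with disjoint closures, and the constants `v_j ∈ ℝ`, `ψ_j ∈ ℝ^k` for each of
the `N + 1` components of the complement. -/
structure RodData (N k : ℕ) where
  a : Fin N → ℝ
  b : Fin N → ℝ
  a_lt_b : ∀ j, a j < b j
  b_lt_a : ∀ i j, i < j → b i < a j
  v : Fin (N + 1) → ℝ
  ψ : Fin (N + 1) → Fin k → ℝ

variable {N : ℕ}

/-- The singular set `Σ`, which is the `z`-axis with the intervals `I_j` removed. -/
def RodData.sing (D : RodData N k) : Set E3 :=
  {x | x ∈ zAxis ∧ ∀ j, x 2 ∉ Set.Ioo (D.a j) (D.b j)}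

/-- The connected component `Σ_j` of `Σ`, which lies above the first `j` intervals and below the
remaining ones (`j = 0, …, N`). -/
def RodData.comp (D : RodData N k) (j : Fin (N + 1)) : Set E3 :=
  {x | x ∈ zAxis ∧ (∀ i : Fin N, i.castSucc < j → D.b i ≤ x 2) ∧
    (∀ i : Fin N, j ≤ i.castSucc → x 2 ≤ D.a i)}

open Classical in
/-- The potential of a uniform charge distribution on `Σ`, so normalized that `u₀ + log ρ → 0` at
infinity. Because `Σ` is unbounded, `1 / (1 + s²)^{1/2}` is subtracted to make the integral
convergent; for the whole axis in place of `Σ` the integral is `-log ρ`. -/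
def RodData.u0 (D : RodData N k) (x : E3) : ℝ :=
  (1 / 2) * ∫ s : ℝ, ((if s • eZ ∈ D.sing then 1 / ‖x - s • eZ‖ else 0) - 1 / √(1 + s ^ 2))

/-- A map `φ̃ = (u₀, ṽ, χ̃, ψ̃)` which coincides with `φ_j = (u₀, v_j, 0, ψ_j)` in a neighborhood
of each `Σ_j`, and for which `ṽ`, `χ̃`, `ψ̃` depend only on the polar angle outside some ball. -/
structure RodData.IsReferenceMap (D : RodData N k) (φt : E3 → HSpace k) : Prop where
  smooth : ContDiffOn ℝ ∞ φt D.singᶜ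
  u_eq : ∀ x ∉ D.sing, uu (φt x) = D.u0 x
  near : ∀ j, ∃ W : Set E3, IsOpen W ∧ D.comp j ⊆ W ∧
    ∀ x ∈ W \ D.sing, φt x = mkH (D.u0 x) (D.v j) 0 (D.ψ j)
  angular : ∃ R : ℝ, 0 < R ∧ ∀ x ∉ D.sing, ∀ y ∉ D.sing, R < ‖x‖ → R < ‖y‖ →
    InnerProductGeometry.angle eZ x = InnerProductGeometry.angle eZ y →
    vv (φt x) = vv (φt y) ∧ (∀ i, chi i (φt x) = chi i (φt y)) ∧
      ∀ i, psi i (φt x) = psi i (φt y)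

/-- `φ : ℝ³ ∖ Σ → H` solves the Reduced Problem: it is an axially symmetric harmonic map which is
asymptotic to a reference map `φ̃` near each `Σ_j` and at infinity. -/
structure RodData.SolvesReducedProblem (D : RodData N k) (φ : E3 → HSpace k) : Prop where
  harmonic : IsHarmonicMap D.singᶜ φ
  axisymmetric : ∀ (α : ℝ), ∀ x ∉ D.sing, φ (rotZ α x) = φ x
  asymptotic : ∃ φt : E3 → HSpace k, D.IsReferenceMap φt ∧
    (∀ j, ∃ W : Set E3, IsOpen W ∧ D.comp j ⊆ W ∧
      ∃ C : ℝ, ∀ x ∈ W \ D.sing, hypDist (φ x) (φt x) ≤ C) ∧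
    Filter.Tendsto (fun x => hypDist (φ x) (φt x))
      (Bornology.cobounded E3 ⊓ Filter.principal D.singᶜ) (𝓝 0)

/-! ## Cylindrical coordinates, the potentials, the metric and the one-form -/

/-- The cylindrical radius `ρ`. -/
def rho (x : E3) : ℝ := √(x 0 ^ 2 + x 1 ^ 2)

/-- The coordinate vector field `∂/∂ρ`. -/
def eRho (x : E3) : E3 := !₂[x 0 / rho x, x 1 / rho x, 0]

/-- The generator `ξ = ∂/∂ϕ` of the rotations around the `z`-axis. -/
def xi (x : E3) : E3 := !₂[-x 1, x 0, 0]

/-- The one-form `dρ`. -/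
def dRho (x Y : E3) : ℝ := (x 0 * Y 0 + x 1 * Y 1) / rho x

/-- The one-form `dϕ`, where `ϕ` is the azimuthal angle. -/
def dPhi (x Y : E3) : ℝ := (x 0 * Y 1 - x 1 * Y 0) / rho x ^ 2

/-- For a one-form `α` on `ℝ³`, the one-form `i_ξ * α`, where `*` is the Euclidean Hodge star:
`(*α)(X, Y) = vol(α^♯, X, Y)`. -/
def iXiStar (α : E3 →L[ℝ] ℝ) (x Y : E3) : ℝ :=
  Matrix.det (Matrix.of ![fun j => α (EuclideanSpace.single j 1), fun j => xi x j, fun j => Y j])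

/-- The differential of `f ∘ φ` at `x`. -/
def dd (f : HSpace k → ℝ) (φ : E3 → HSpace k) (x : E3) : E3 →L[ℝ] ℝ :=
  fderiv ℝ (fun y => f (φ y)) x

/-- The one-form `ω = 2 (dv + χ · dψ - ψ · dχ)`. -/
def omega (φ : E3 → HSpace k) (x : E3) : E3 →L[ℝ] ℝ :=
  (2 : ℝ) • (dd vv φ x + ∑ i, (chi i (φ x) • dd (psi i) φ x - psi i (φ x) • dd (chi i) φ x))

/-- `w` is a smooth function on `ℝ³ ∖ 𝔸` with `dw = e^{4u} i_ξ * ω`. -/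
def IsPotentialW (φ : E3 → HSpace k) (w : E3 → ℝ) : Prop :=
  ContDiffOn ℝ ∞ w zAxisᶜ ∧ ∀ x ∉ zAxis, ∀ Y,
    fderiv ℝ w x Y = Real.exp (4 * uu (φ x)) * iXiStar (omega φ x) x Y

/-- `lam` is a smooth function on `ℝ³ ∖ 𝔸` with
`dλ = du + ρ [u_ρ² - u_z² + ¼ e^{4u} (ω_ρ² - ω_z²) + e^{2u} (|χ_ρ|² - |χ_z|² + |ψ_ρ|² - |ψ_z|²)] dρ
+ 2 ρ [u_ρ u_z + ¼ e^{4u} ω_ρ ω_z + e^{2u} (χ_ρ · χ_z + ψ_ρ · ψ_z)] dz`. -/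
def IsPotentialLam (φ : E3 → HSpace k) (lam : E3 → ℝ) : Prop :=
  ContDiffOn ℝ ∞ lam zAxisᶜ ∧ ∀ x ∉ zAxis, ∀ Y,
    fderiv ℝ lam x Y = dd uu φ x Y
      + rho x * (dd uu φ x (eRho x) ^ 2 - dd uu φ x eZ ^ 2
          + (1 / 4) * Real.exp (4 * uu (φ x)) * (omega φ x (eRho x) ^ 2 - omega φ x eZ ^ 2)
          + Real.exp (2 * uu (φ x)) *
            ∑ i, (dd (chi i) φ x (eRho x) ^ 2 - dd (chi i) φ x eZ ^ 2
              + dd (psi i) φ x (eRho x) ^ 2 - dd (psi i) φ x eZ ^ 2)) * dRho x Y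
      + 2 * rho x * (dd uu φ x (eRho x) * dd uu φ x eZ
          + (1 / 4) * Real.exp (4 * uu (φ x)) * (omega φ x (eRho x) * omega φ x eZ)
          + Real.exp (2 * uu (φ x)) *
            ∑ i, (dd (chi i) φ x (eRho x) * dd (chi i) φ x eZ
              + dd (psi i) φ x (eRho x) * dd (psi i) φ x eZ)) * Y 2

/-- `θ` is a smooth `ℝ^k`-valued function on `ℝ³ ∖ 𝔸` with `dθ = e^{2u} i_ξ * dψ - w dχ`. -/
def IsPotentialTheta (φ : E3 → HSpace k) (w : E3 → ℝ) (θ : Fin k → E3 → ℝ) : Prop :=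
  ∀ i, ContDiffOn ℝ ∞ (θ i) zAxisᶜ ∧ ∀ x ∉ zAxis, ∀ Y,
    fderiv ℝ (θ i) x Y = Real.exp (2 * uu (φ x)) * iXiStar (dd (psi i) φ x) x Y
      - w x * dd (chi i) φ x Y

/-- The space-time manifold `ℝ × (ℝ³ ∖ 𝔸)`. -/
def spacetime : Set (ℝ × E3) := {p | p.2 ∉ zAxis}

/-- The metric `-ρ² e^{2u} dt² + e^{-2u} (dϕ - w dt)² + e^{2λ} (dρ² + dz²)` at `p`, evaluated on the
tangent vectors `X` and `Y`. -/
def stMetric (φ : E3 → HSpace k) (w lam : E3 → ℝ) (p X Y : ℝ × E3) : ℝ :=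
  -(rho p.2 ^ 2 * Real.exp (2 * uu (φ p.2)) * (X.1 * Y.1))
    + Real.exp (-2 * uu (φ p.2)) *
      ((dPhi p.2 X.2 - w p.2 * X.1) * (dPhi p.2 Y.2 - w p.2 * Y.1))
    + Real.exp (2 * lam p.2) * (dRho p.2 X.2 * dRho p.2 Y.2 + X.2 2 * Y.2 2)

/-- The one-form `A = -(χ dϕ + θ dt)` at `p`, evaluated on the tangent vector `X`. -/
def stForm (φ : E3 → HSpace k) (θ : Fin k → E3 → ℝ) (i : Fin k) (p X : ℝ × E3) : ℝ :=
  -(chi i (φ p.2) * dPhi p.2 X.2 + θ i p.2 * X.1)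

end

end EYM

/-! Rotational symmetry turns the theorem into a statement about functions on the half-plane ρ > 0.
There the harmonic map equation becomes `ReducedSystem`: second-order equations for u, χ, ψ, a
divergence equation for ω, and the identity dω = 4 ∑ dχᵢ ∧ dψᵢ, which follows from the definition of
ω alone. The system is read off from the tension with its index lowered (`sum_mul_tension`,
`euler_lagrange`), so the metric of the target is never inverted explicitly.

Each potential exists because its one-form is closed on the half-plane, which is convex. For w,
closedness is the equation for ω; for θ it is the equation for ψ; for λ it is the conservation law
obtained by multiplying the equations by the z-derivatives of the fields (`pd_one_lamRho`). Although
ℝ³ ∖ 𝔸 is not simply connected, no periods arise, since i_ξ * of an invariant one-form without dϕ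
part again has no dϕ part (`iXiStar_eq`). Conversely the ξ-derivative of any potential vanishes, so
every admissible w, λ, θ comes from the half-plane (`planar_of_fderiv`).

The field equations are verified in the coordinates (t, ϕ, ρ, z), where all components depend on ρ
and z only and the derivatives of w and θ are eliminated by their defining equations. The (t, ϕ)
block of the Ricci tensor simplifies by the equation for u, the (ρ, z) block by the formula for dλ
together with the flat Laplacian of λ - u (`pd_zero_lamRho_add`). The outcome is trace-free, so R =
0 (`ricci_coordMetric`, `scalarCurvature_coordMetric`).

On the field side, *F is obtained from F by replacing (χ, ψ) by (-ψ, χ) (`hodge_coordForm`); hence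
d*F = 0 is the equation for χ, just as closedness of dθ is the equation for ψ. Both Ric and 2T then
have the shape `ricciForm`, and their twist terms agree by the identity for dω
(`two_mul_stressEnergy`). -/

set_option linter.unusedSectionVars false

namespace EYM

/-! ## Calculus of partial derivatives -/

section PartialDerivatives

variable {ι : Type*} [Fintype ι] [DecidableEq ι] {f f' : (ι → ℝ) → ℝ} {p : ι → ℝ}
  {U : Set (ι → ℝ)}

theorem pd_congr_of_eventuallyEq (i : ι) (h : f =ᶠ[𝓝 p] f') : pd i f p = pd i f' p := by
  simp only [pd, h.fderiv_eq]

theorem pd_congr_of_eqOn (hU : IsOpen U) (h : Set.EqOn f f' U) (hp : p ∈ U) (i : ι) :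
    pd i f p = pd i f' p :=
  pd_congr_of_eventuallyEq i (h.eventuallyEq_of_mem (hU.mem_nhds hp))

theorem pd_const (i : ι) (c : ℝ) : pd i (fun _ => c) p = 0 := by simp [pd]

theorem pd_coord (i j : ι) : pd i (fun q : ι → ℝ => q j) p = if i = j then 1 else 0 := by
  have : HasFDerivAt (fun q : ι → ℝ => q j) (ContinuousLinearMap.proj (R := ℝ) j) p :=
    (ContinuousLinearMap.proj (R := ℝ) (φ := fun _ : ι => ℝ) j).hasFDerivAt
  rw [pd, this.fderiv]
  simp [Pi.single_apply, eq_comm]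

theorem pd_neg (i : ι) : pd i (fun q => -f q) p = -pd i f p := by
  simp [pd, fderiv_fun_neg]

theorem pd_add (i : ι) (hf : DifferentiableAt ℝ f p) (hf' : DifferentiableAt ℝ f' p) :
    pd i (fun q => f q + f' q) p = pd i f p + pd i f' p := by
  simp [pd, fderiv_fun_add hf hf']

theorem pd_sub (i : ι) (hf : DifferentiableAt ℝ f p) (hf' : DifferentiableAt ℝ f' p) :
    pd i (fun q => f q - f' q) p = pd i f p - pd i f' p := by
  simp [pd, fderiv_fun_sub hf hf']

theorem pd_mul (i : ι) (hf : DifferentiableAt ℝ f p) (hf' : DifferentiableAt ℝ f' p) :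
    pd i (fun q => f q * f' q) p = pd i f p * f' p + f p * pd i f' p := by
  simp [pd, fderiv_fun_mul hf hf']
  ring

theorem pd_inv (i : ι) (hf : DifferentiableAt ℝ f p) (h : f p ≠ 0) :
    pd i (fun q => (f q)⁻¹) p = -pd i f p / f p ^ 2 := by
  have := (hasDerivAt_inv h).comp_hasFDerivAt p hf.hasFDerivAt
  rw [pd, show (fun q => (f q)⁻¹) = Inv.inv ∘ f from rfl, this.fderiv]
  simp [pd]
  ring

theorem pd_pow_two (i : ι) (hf : DifferentiableAt ℝ f p) :
    pd i (fun q => f q ^ 2) p = 2 * f p * pd i f p := by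
  simp only [pow_two, pd_mul i hf hf]
  ring

theorem pd_exp (i : ι) (hf : DifferentiableAt ℝ f p) :
    pd i (fun q => Real.exp (f q)) p = Real.exp (f p) * pd i f p := by
  simp [pd, fderiv_exp hf]

theorem pd_sum {κ : Type*} {s : Finset κ} {F : κ → (ι → ℝ) → ℝ} (i : ι)
    (hF : ∀ j ∈ s, DifferentiableAt ℝ (F j) p) :
    pd i (fun q => ∑ j ∈ s, F j q) p = ∑ j ∈ s, pd i (F j) p := by
  simp only [pd]
  rw [fderiv_fun_sum hF]
  simp

theorem contDiffOn_pd (hU : IsOpen U) (hf : ContDiffOn ℝ ∞ f U) (i : ι) :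
    ContDiffOn ℝ ∞ (pd i f) U :=
  (hf.fderiv_of_isOpen hU (by simp)).clm_apply contDiffOn_const

theorem differentiableAt_of_contDiffOn {E : Type*} [NormedAddCommGroup E] [NormedSpace ℝ E]
    {F : Type*} [NormedAddCommGroup F] [NormedSpace ℝ F] {f : E → F} {U : Set E} {p : E}
    (hU : IsOpen U) (hf : ContDiffOn ℝ ∞ f U) (hp : p ∈ U) : DifferentiableAt ℝ f p :=
  (hf.contDiffAt (hU.mem_nhds hp)).differentiableAt (by simp)

theorem fderiv_apply_comm {E : Type*} [NormedAddCommGroup E] [NormedSpace ℝ E]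
    {f : E → ℝ} {U : Set E} {p : E} (hU : IsOpen U) (hf : ContDiffOn ℝ ∞ f U) (hp : p ∈ U)
    (X Y : E) : fderiv ℝ (fun q => fderiv ℝ f q X) p Y = fderiv ℝ (fun q => fderiv ℝ f q Y) p X := by
  have hd : DifferentiableAt ℝ (fderiv ℝ f) p :=
    differentiableAt_of_contDiffOn hU (hf.fderiv_of_isOpen hU (by simp)) hp
  have hs : IsSymmSndFDerivAt ℝ f p :=
    (hf.contDiffAt (hU.mem_nhds hp)).isSymmSndFDerivAt
      -- Over ℝ, symmetry of the second derivative needs only C².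
      (by rw [minSmoothness_of_isRCLikeNormedField]; exact WithTop.coe_le_coe.2 le_top)
  rw [fderiv_clm_apply hd (differentiableAt_const _), fderiv_clm_apply hd (differentiableAt_const _)]
  simpa using hs.eq Y X

theorem pd_comm (hU : IsOpen U) (hf : ContDiffOn ℝ ∞ f U) (hp : p ∈ U) (i j : ι) :
    pd i (pd j f) p = pd j (pd i f) p :=
  fderiv_apply_comm hU hf hp _ _

theorem fderiv_eq_sum_pd (Y : ι → ℝ) : fderiv ℝ f p Y = ∑ i, Y i * pd i f p := by
  conv_lhs => rw [pi_eq_sum_univ' Y]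
  simp only [map_sum, map_smul, smul_eq_mul, pd]

end PartialDerivatives

/-! ## The half-plane -/

/-- Pairs `(ρ, z)`. -/
abbrev R2 : Type := Fin 2 → ℝ

/-- The half-plane `ρ > 0`. -/
def halfPlane : Set R2 := {Y | 0 < Y 0}

theorem isOpen_halfPlane : IsOpen halfPlane := isOpen_lt continuous_const (continuous_apply 0)

theorem convex_halfPlane : Convex ℝ halfPlane :=
  (convex_Ioi (0 : ℝ)).linear_preimage (LinearMap.proj (R := ℝ) (φ := fun _ : Fin 2 => ℝ) 0)

/-- A closed one-form on the half-plane is exact. -/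
theorem exists_potential {f g : R2 → ℝ} (hf : ContDiffOn ℝ ∞ f halfPlane)
    (hg : ContDiffOn ℝ ∞ g halfPlane) (h : ∀ Y ∈ halfPlane, pd 1 f Y = pd 0 g Y) :
    ∃ W : R2 → ℝ, ContDiffOn ℝ ∞ W halfPlane ∧
      ∀ Y ∈ halfPlane, pd 0 W Y = f Y ∧ pd 1 W Y = g Y := by
  let η : R2 → R2 →L[ℝ] ℝ := fun Y =>
    f Y • ContinuousLinearMap.proj (R := ℝ) 0 + g Y • ContinuousLinearMap.proj (R := ℝ) 1
  have hη : ContDiffOn ℝ ∞ η halfPlane :=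
    (hf.smul contDiffOn_const).add (hg.smul contDiffOn_const)
  -- Poincaré lemma on a convex set; the symmetry of the derivative of η amounts to the hypothesis
  -- `h`.
  obtain ⟨W, hW⟩ := convex_halfPlane.exists_forall_hasFDerivAt_of_fderiv_symmetric
    isOpen_halfPlane (hη.differentiableOn (by simp)) (by
      intro Y hY X Z
      have hf' := differentiableAt_of_contDiffOn isOpen_halfPlane hf hY
      have hg' := differentiableAt_of_contDiffOn isOpen_halfPlane hg hY
      have : HasFDerivAt η _ Y := (hf'.hasFDerivAt.smul_const
        (ContinuousLinearMap.proj (R := ℝ) (φ := fun _ : Fin 2 => ℝ) 0)).add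
          (hg'.hasFDerivAt.smul_const
            (ContinuousLinearMap.proj (R := ℝ) (φ := fun _ : Fin 2 => ℝ) 1))
      rw [this.fderiv]
      simp only [add_apply, ContinuousLinearMap.smulRight_apply,
        fderiv_eq_sum_pd, Fin.sum_univ_two, smul_apply,
        ContinuousLinearMap.proj_apply, smul_eq_mul, h Y hY]
      ring)
  refine ⟨W, ?_, fun Y hY => ?_⟩
  -- W inherits its smoothness from its derivative η, which gains one order; ∞ + 1 is again ∞.
  · have : ContDiffOn ℝ (∞ + 1) W halfPlane := by
      rw [contDiffOn_succ_iff_fderiv_of_isOpen isOpen_halfPlane]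
      refine ⟨fun Y hY => (hW Y hY).differentiableAt.differentiableWithinAt, by simp, ?_⟩
      exact hη.congr fun Y hY => (hW Y hY).fderiv
    exact this.of_le (by simp)
  · simp [pd, (hW Y hY).fderiv, η]

/-! ## The Euler–Lagrange equations of harmonic maps into complex hyperbolic space -/

section Lowering

variable {ι : Type*} [Fintype ι] [DecidableEq ι]

/-- Lowering the index of the tension removes the inverse of the metric. -/
theorem sum_mul_tension (h : (ι → ℝ) → Matrix ι ι ℝ) (φ : E3 → ι → ℝ) (x : E3)
    (hdet : IsUnit (h (φ x)).det) (e : ι) :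
    ∑ a, h (φ x) e a * tension h φ a x =
      ∑ a, h (φ x) e a * Laplacian.laplacian (fun y => φ y a) x
      + ∑ j : Fin 3, ((∑ b, ∑ c, fderiv ℝ (fun y => φ y b) x (EuclideanSpace.single j 1)
            * fderiv ℝ (fun y => φ y c) x (EuclideanSpace.single j 1)
            * pd b (fun q => h q e c) (φ x))
        - 1 / 2 * ∑ b, ∑ c, fderiv ℝ (fun y => φ y b) x (EuclideanSpace.single j 1)
            * fderiv ℝ (fun y => φ y c) x (EuclideanSpace.single j 1)
            * pd e (fun q => h q b c) (φ x)) := by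
  -- Contracting with h cancels the inverse in Γ and leaves the Christoffel symbol of the first
  -- kind.
  have key : ∀ b c, ∑ a, h (φ x) e a * christoffel h a b c (φ x) = 1 / 2 *
      (pd b (fun q => h q e c) (φ x) + pd c (fun q => h q e b) (φ x)
        - pd e (fun q => h q b c) (φ x)) := by
    intro b c
    set K : ι → ℝ := fun d => pd b (fun q => h q d c) (φ x) + pd c (fun q => h q d b) (φ x)
        - pd d (fun q => h q b c) (φ x) with hK
    have : ∑ a, h (φ x) e a * christoffel h a b c (φ x) =
        1 / 2 * (h (φ x) *ᵥ ((h (φ x))⁻¹ *ᵥ K)) e := by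
      simp only [christoffel, Matrix.mulVec, dotProduct, Finset.mul_sum]
      refine Finset.sum_congr rfl fun a _ => Finset.sum_congr rfl fun d _ => ?_
      ring
    rw [this, Matrix.mulVec_mulVec, Matrix.mul_nonsing_inv _ hdet, Matrix.one_mulVec]
  simp only [tension, mul_add, Finset.sum_add_distrib]
  congr 1
  have h1 : ∑ a, h (φ x) e a * ∑ b, ∑ c, ∑ j : Fin 3, christoffel h a b c (φ x)
      * fderiv ℝ (fun y => φ y b) x (EuclideanSpace.single j 1)
      * fderiv ℝ (fun y => φ y c) x (EuclideanSpace.single j 1) =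
      ∑ j : Fin 3, ∑ b, ∑ c, (∑ a, h (φ x) e a * christoffel h a b c (φ x)) *
        (fderiv ℝ (fun y => φ y b) x (EuclideanSpace.single j 1)
      * fderiv ℝ (fun y => φ y c) x (EuclideanSpace.single j 1)) := by
    simp only [Finset.mul_sum, Finset.sum_mul]
    have swap : ∀ G : ι → ι → ι → Fin 3 → ℝ,
        ∑ a, ∑ b, ∑ c, ∑ j, G a b c j = ∑ j, ∑ b, ∑ c, ∑ a, G a b c j := fun G => calc
      _ = ∑ b, ∑ a, ∑ c, ∑ j, G a b c j := Finset.sum_comm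
      _ = ∑ b, ∑ c, ∑ a, ∑ j, G a b c j := Finset.sum_congr rfl fun b _ => Finset.sum_comm
      _ = ∑ b, ∑ c, ∑ j, ∑ a, G a b c j :=
        Finset.sum_congr rfl fun b _ => Finset.sum_congr rfl fun c _ => Finset.sum_comm
      _ = ∑ b, ∑ j, ∑ c, ∑ a, G a b c j := Finset.sum_congr rfl fun b _ => Finset.sum_comm
      _ = ∑ j, ∑ b, ∑ c, ∑ a, G a b c j := Finset.sum_comm
    rw [swap]
    refine Finset.sum_congr rfl fun j _ => Finset.sum_congr rfl fun b _ =>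
      Finset.sum_congr rfl fun c _ => Finset.sum_congr rfl fun a _ => ?_
    ring
  rw [h1]
  refine Finset.sum_congr rfl fun j _ => ?_
  simp only [key]
  -- The first two terms of the symbol contribute equally, because they are contracted with a
  -- product symmetric in b and c.
  have h2 : ∑ b, ∑ c, fderiv ℝ (fun y => φ y b) x (EuclideanSpace.single j 1)
      * fderiv ℝ (fun y => φ y c) x (EuclideanSpace.single j 1) * pd c (fun q => h q e b) (φ x) =
      ∑ b, ∑ c, fderiv ℝ (fun y => φ y b) x (EuclideanSpace.single j 1)
      * fderiv ℝ (fun y => φ y c) x (EuclideanSpace.single j 1) * pd b (fun q => h q e c) (φ x) := by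
    rw [Finset.sum_comm]
    refine Finset.sum_congr rfl fun b _ => Finset.sum_congr rfl fun c _ => ?_
    ring
  have h3 : ∀ b c, 1 / 2 * (pd b (fun q => h q e c) (φ x) + pd c (fun q => h q e b) (φ x)
        - pd e (fun q => h q b c) (φ x)) * (fderiv ℝ (fun y => φ y b) x (EuclideanSpace.single j 1)
      * fderiv ℝ (fun y => φ y c) x (EuclideanSpace.single j 1)) =
      1 / 2 * (fderiv ℝ (fun y => φ y b) x (EuclideanSpace.single j 1)
      * fderiv ℝ (fun y => φ y c) x (EuclideanSpace.single j 1) * pd b (fun q => h q e c) (φ x))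
      + 1 / 2 * (fderiv ℝ (fun y => φ y b) x (EuclideanSpace.single j 1)
      * fderiv ℝ (fun y => φ y c) x (EuclideanSpace.single j 1) * pd c (fun q => h q e b) (φ x))
      - 1 / 2 * (fderiv ℝ (fun y => φ y b) x (EuclideanSpace.single j 1)
      * fderiv ℝ (fun y => φ y c) x (EuclideanSpace.single j 1) * pd e (fun q => h q b c) (φ x)) := by
    intro b c; ring
  simp only [h3, Finset.sum_add_distrib, Finset.sum_sub_distrib, ← Finset.mul_sum]
  rw [h2]
  ring

end Lowering

/-! ### The metric of complex hyperbolic space as a bilinear form, and its variation -/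

section Hyperbolic

variable {k : ℕ}

/-- The derivative of the contact form at `X` in the direction `Z` of the base point. -/
def contactDeriv (Z X : HSpace k) : ℝ := ∑ i, (chi i Z * psi i X - psi i Z * chi i X)

/-- The coefficients χ, ψ of the contact form are linear in the base point, so no higher-order terms
in t appear. -/
theorem contactForm_add_smul (p Z X : HSpace k) (t : ℝ) :
    contactForm (p + t • Z) X = contactForm p X + t * contactDeriv Z X := by
  simp only [contactForm, contactDeriv, chi, psi, Pi.add_apply, Pi.smul_apply, smul_eq_mul,
    Finset.mul_sum, add_assoc, ← Finset.sum_add_distrib]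
  congr 1
  refine Finset.sum_congr rfl fun i _ => ?_
  ring

theorem contDiff_hypForm (X Y : HSpace k) : ContDiff ℝ ∞ fun q : HSpace k => hypForm q X Y := by
  unfold hypForm contactForm uu chi psi
  fun_prop

theorem fderiv_hypForm (p X Y Z : HSpace k) :
    fderiv ℝ (fun q => hypForm q X Y) p Z =
      Real.exp (4 * uu p) * (4 * uu Z * (contactForm p X * contactForm p Y)
        + contactDeriv Z X * contactForm p Y + contactForm p X * contactDeriv Z Y)
      + 2 * uu Z * Real.exp (2 * uu p) * ∑ i, (chi i X * chi i Y + psi i X * psi i Y) := by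
  have hd : DifferentiableAt ℝ (fun q => hypForm q X Y) p :=
    (contDiff_hypForm X Y).contDiffAt.differentiableAt (by simp)
  -- Along the line p + tZ both u and the contact form are affine in t, which leaves a derivative in
  -- one variable.
  rw [← hd.lineDeriv_eq_fderiv]
  refine HasLineDerivAt.lineDeriv ?_
  have hu : ∀ t : ℝ, uu (p + t • Z) = uu p + t * uu Z := fun t => by simp [uu]
  simp only [HasLineDerivAt, hypForm, contactForm_add_smul, hu]
  have hl : ∀ a b : ℝ, HasDerivAt (fun t : ℝ => a + t * b) b 0 := fun a b => by
    simpa using ((hasDerivAt_id (0 : ℝ)).mul_const b).const_add a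
  have h := (((((hl (uu p) (uu Z)).const_mul 4).exp).mul
    ((hl (contactForm p X) (contactDeriv Z X)).mul
      (hl (contactForm p Y) (contactDeriv Z Y)))).const_add (uu X * uu Y)).add
    ((((hl (uu p) (uu Z)).const_mul 2).exp).mul_const
      (∑ i, (chi i X * chi i Y + psi i X * psi i Y)))
  refine HasDerivAt.congr_deriv h ?_
  simp only [Pi.mul_apply, zero_mul, add_zero]
  ring

theorem hypForm_add_smul_right (p X Y Z : HSpace k) (s t : ℝ) :
    hypForm p X (s • Y + t • Z) = s * hypForm p X Y + t * hypForm p X Z := by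
  have hc : contactForm p (s • Y + t • Z) = s * contactForm p Y + t * contactForm p Z := by
    simp only [contactForm, vv, chi, psi, Pi.add_apply, Pi.smul_apply, smul_eq_mul, mul_add,
      Finset.mul_sum]
    rw [show ∀ a b c d : ℝ, a + b + (c + d) = (a + b) + (c + d) from fun _ _ _ _ => rfl,
      add_add_add_comm, ← Finset.sum_add_distrib]
    congr 1
    refine Finset.sum_congr rfl fun i _ => ?_
    ring
  have hs : ∑ i, (chi i X * chi i (s • Y + t • Z) + psi i X * psi i (s • Y + t • Z)) =
      s * ∑ i, (chi i X * chi i Y + psi i X * psi i Y)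
        + t * ∑ i, (chi i X * chi i Z + psi i X * psi i Z) := by
    simp only [chi, psi, Pi.add_apply, Pi.smul_apply, smul_eq_mul, Finset.mul_sum,
      ← Finset.sum_add_distrib]
    refine Finset.sum_congr rfl fun i _ => ?_
    ring
  simp only [hypForm, hc, hs]
  simp only [uu, Pi.add_apply, Pi.smul_apply, smul_eq_mul]
  ring

theorem hypForm_comm (p X Y : HSpace k) : hypForm p X Y = hypForm p Y X := by
  simp only [hypForm, mul_comm]

/-- Collects sums over coordinate indices into a single vector argument, so that component formulas
can be handled without splitting the index type. -/
theorem sum_mul_hypForm (p X W : HSpace k) :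
    ∑ a, W a * hypForm p X (Pi.single a 1) = hypForm p X W := by
  let ℓ : HSpace k →ₗ[ℝ] ℝ :=
    { toFun := hypForm p X
      map_add' := fun Y Z => by simpa using hypForm_add_smul_right p X Y Z 1 1
      map_smul' := fun s Y => by simpa using hypForm_add_smul_right p X Y 0 s 0 }
  have : ℓ W = ∑ a, W a * ℓ (Pi.single a 1) := by
    conv_lhs => rw [pi_eq_sum_univ' W]
    simp only [map_sum, map_smul, smul_eq_mul]
  exact this.symm

/-- The form is positive definite: for a kernel vector the three nonnegative terms of `hypForm p W
W` vanish separately. The last gives χ = ψ = 0, after which the contact form reduces to the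
v-component. -/
theorem isUnit_det_hypMetric (p : HSpace k) : IsUnit (hypMetric p).det := by
  rw [← Matrix.isUnit_iff_isUnit_det, ← Matrix.mulVec_injective_iff_isUnit]
  rw [← Matrix.coe_mulVecLin, ← LinearMap.ker_eq_bot, LinearMap.ker_eq_bot']
  intro W hW
  have h0 : hypForm p W W = 0 := by
    rw [← sum_mul_hypForm p W W]
    refine Finset.sum_eq_zero fun a _ => ?_
    have := congrFun hW a
    simp only [Matrix.coe_mulVecLin, Matrix.mulVec, dotProduct, hypMetric, Matrix.of_apply,
      Pi.zero_apply] at this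
    rw [hypForm_comm, ← sum_mul_hypForm p (Pi.single a 1) W]
    simp only [mul_comm (W _)] at this ⊢
    rw [this, zero_mul]
  have e1 : 0 ≤ uu W * uu W := mul_self_nonneg _
  have e2 : 0 ≤ Real.exp (4 * uu p) * (contactForm p W * contactForm p W) :=
    mul_nonneg (Real.exp_pos _).le (mul_self_nonneg _)
  have e4 : 0 ≤ ∑ i, (chi i W * chi i W + psi i W * psi i W) :=
    Finset.sum_nonneg fun i _ => add_nonneg (mul_self_nonneg _) (mul_self_nonneg _)
  have e3 : 0 ≤ Real.exp (2 * uu p) * ∑ i, (chi i W * chi i W + psi i W * psi i W) :=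
    mul_nonneg (Real.exp_pos _).le e4
  rw [hypForm] at h0
  have z1 : uu W = 0 := mul_self_eq_zero.1 (by linarith)
  have z2 : contactForm p W = 0 := by
    have : Real.exp (4 * uu p) * (contactForm p W * contactForm p W) = 0 := by linarith
    simpa using this
  have z3 : ∑ i, (chi i W * chi i W + psi i W * psi i W) = 0 := by
    have : Real.exp (2 * uu p) * ∑ i, (chi i W * chi i W + psi i W * psi i W) = 0 := by linarith
    simpa using this
  rw [Finset.sum_eq_zero_iff_of_nonneg
    fun i _ => add_nonneg (mul_self_nonneg _) (mul_self_nonneg _)] at z3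
  have z4 : ∀ i, chi i W = 0 ∧ psi i W = 0 := fun i => by
    have := z3 i (Finset.mem_univ i)
    constructor <;> nlinarith [mul_self_nonneg (chi i W), mul_self_nonneg (psi i W)]
  have z5 : vv W = 0 := by simpa [contactForm, z4] using z2
  ext a
  rcases a with a | a | a
  · fin_cases a
    · exact z1
    · exact z5
  · exact (z4 a).1
  · exact (z4 a).2

/-- The vector of the Laplacians of the components of `φ`. -/
noncomputable def lap (φ : E3 → HSpace k) (x : E3) : HSpace k :=
  fun a => Laplacian.laplacian (fun y => φ y a) x

/-- The vector of the derivatives of the components of `φ` in the `j`-th direction. -/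
noncomputable def grad (φ : E3 → HSpace k) (j : Fin 3) (x : E3) : HSpace k :=
  fun a => fderiv ℝ (fun y => φ y a) x (EuclideanSpace.single j 1)

/-- The lowered tension, tested against a coordinate direction e and written through derivatives of
`hypForm` instead of Christoffel symbols. The four component equations below are its
specializations. -/
theorem euler_lagrange {Ω : Set E3} {φ : E3 → HSpace k} (hφ : IsHarmonicMap Ω φ) {x : E3}
    (hx : x ∈ Ω) (e : HIdx k) :
    hypForm (φ x) (Pi.single e 1) (lap φ x) + ∑ j : Fin 3,
      (fderiv ℝ (fun q => hypForm q (Pi.single e 1) (grad φ j x)) (φ x) (grad φ j x)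
      - 1 / 2 * fderiv ℝ (fun q => hypForm q (grad φ j x) (grad φ j x)) (φ x)
          (Pi.single e 1)) = 0 := by
  have h0 := sum_mul_tension hypMetric φ x (isUnit_det_hypMetric _) e
  simp only [hφ.2 x hx, mul_zero, Finset.sum_const_zero] at h0
  rw [h0, ← sum_mul_hypForm]
  congr 1
  · refine Finset.sum_congr rfl fun a _ => ?_
    simp only [hypMetric, Matrix.of_apply, lap]
    ring
  refine Finset.sum_congr rfl fun j _ => ?_
  have hdiff : ∀ X Y : HSpace k, DifferentiableAt ℝ (fun q : HSpace k => hypForm q X Y) (φ x) :=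
    fun X Y => (contDiff_hypForm X Y).contDiffAt.differentiableAt (by simp)
  congr 2
  · rw [fderiv_eq_sum_pd]
    refine Finset.sum_congr rfl fun b _ => ?_
    simp only [← sum_mul_hypForm _ _ (grad φ j x)]
    rw [pd_sum b fun c _ => (hdiff _ _).const_mul _, Finset.mul_sum]
    refine Finset.sum_congr rfl fun c _ => ?_
    rw [pd_mul b (differentiableAt_const _) (hdiff _ _), pd_const]
    simp only [hypMetric, Matrix.of_apply, grad]
    ring
  · change pd e (fun q => hypForm q (grad φ j x) (grad φ j x)) (φ x) = _
    have : (fun q => hypForm q (grad φ j x) (grad φ j x)) = fun q => ∑ b, ∑ c,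
        grad φ j x b * grad φ j x c * hypForm q (Pi.single b 1) (Pi.single c 1) := by
      ext q
      rw [← sum_mul_hypForm]
      refine Finset.sum_congr rfl fun b _ => ?_
      rw [hypForm_comm, ← sum_mul_hypForm, Finset.mul_sum]
      refine Finset.sum_congr rfl fun c _ => ?_
      ring
    rw [this, pd_sum e fun b _ => DifferentiableAt.fun_sum fun c _ => (hdiff _ _).const_mul _]
    refine Finset.sum_congr rfl fun b _ => ?_
    rw [pd_sum e fun c _ => (hdiff _ _).const_mul _]
    refine Finset.sum_congr rfl fun c _ => ?_
    rw [pd_mul e (differentiableAt_const _) (hdiff _ _), pd_const]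
    simp only [hypMetric, Matrix.of_apply, grad]
    ring

/-! ### The Euler–Lagrange equations for u, v, χ and ψ -/

section Components

variable {Ω : Set E3} {φ : E3 → HSpace k} {x : E3}

/-- `contactDeriv` is alternating, being a multiple of the exterior derivative of the contact form;
this removes the terms in which a gradient is paired with itself. -/
theorem contactDeriv_self (Z : HSpace k) : contactDeriv Z Z = 0 := by
  simp [contactDeriv, mul_comm]

/-- The pairing of ∂_u with a vector does not depend on the base point, so the source comes entirely
from differentiating the exponentials in u. -/
theorem euler_lagrange_u (hφ : IsHarmonicMap Ω φ) (hx : x ∈ Ω) :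
    uu (lap φ x) = ∑ j : Fin 3,
      (2 * Real.exp (4 * uu (φ x)) * contactForm (φ x) (grad φ j x) ^ 2
        + Real.exp (2 * uu (φ x)) * ∑ i, (chi i (grad φ j x) ^ 2 + psi i (grad φ j x) ^ 2)) := by
  have h := euler_lagrange hφ hx (Sum.inl 0)
  have h1 : ∀ q X : HSpace k, hypForm q (Pi.single (Sum.inl 0) 1) X = uu X := by
    simp [hypForm, uu, contactForm, vv, chi, psi]
  have h2 : uu (Pi.single (Sum.inl 0) 1 : HSpace k) = 1 := by simp [uu]
  have h3 : ∀ X : HSpace k, contactDeriv (Pi.single (Sum.inl 0) 1) X = 0 := by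
    simp [contactDeriv, chi, psi]
  simp only [h1] at h
  simp only [fderiv_hypForm, h2, h3, fderiv_fun_const, Pi.zero_apply,
    zero_apply] at h
  rw [eq_comm, ← sub_eq_zero, ← neg_eq_zero, neg_sub, ← h, sub_eq_add_neg]
  congr 1
  rw [← Finset.sum_neg_distrib]
  refine Finset.sum_congr rfl fun j _ => ?_
  simp only [pow_two]
  ring

/-- Translations in v are isometries, so this component is a conservation law: the divergence of
e^{4u} times the pulled-back contact form vanishes. -/
theorem euler_lagrange_v (hφ : IsHarmonicMap Ω φ) (hx : x ∈ Ω) :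
    contactForm (φ x) (lap φ x)
      + 4 * ∑ j : Fin 3, uu (grad φ j x) * contactForm (φ x) (grad φ j x) = 0 := by
  have h := euler_lagrange hφ hx (Sum.inl 1)
  have h0 : ∀ q : HSpace k, contactForm q (Pi.single (Sum.inl 1) 1) = 1 := by
    simp [contactForm, vv, chi, psi]
  have h2 : uu (Pi.single (Sum.inl 1) 1 : HSpace k) = 0 := by simp [uu]
  have h3 : ∀ X : HSpace k, contactDeriv (Pi.single (Sum.inl 1) 1) X = 0 := by
    simp [contactDeriv, chi, psi]
  have h4 : ∀ X : HSpace k, contactDeriv X (Pi.single (Sum.inl 1) 1) = 0 := by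
    simp [contactDeriv, chi, psi]
  have h5 : ∀ i, chi i (Pi.single (Sum.inl 1) 1 : HSpace k) = 0 := by simp [chi]
  have h6 : ∀ i, psi i (Pi.single (Sum.inl 1) 1 : HSpace k) = 0 := by simp [psi]
  simp only [fderiv_hypForm] at h
  simp only [h0, h2, h3, h4, h5, h6, contactDeriv_self, hypForm, zero_mul,
    mul_zero, add_zero, zero_add, Finset.sum_const_zero, one_mul, sub_zero] at h
  have h7 : Real.exp (4 * uu (φ x)) * (contactForm (φ x) (lap φ x)
      + 4 * ∑ j : Fin 3, uu (grad φ j x) * contactForm (φ x) (grad φ j x)) = 0 := by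
    rw [← h, mul_add, Finset.mul_sum, Finset.mul_sum]
    congr 1
    refine Finset.sum_congr rfl fun j _ => ?_
    ring
  exact (mul_eq_zero.1 h7).resolve_left (Real.exp_ne_zero _)

theorem euler_lagrange_chi (hφ : IsHarmonicMap Ω φ) (hx : x ∈ Ω) (i : Fin k) :
    chi i (lap φ x) + 2 * ∑ j : Fin 3, uu (grad φ j x) * chi i (grad φ j x) =
      2 * Real.exp (2 * uu (φ x)) *
        ∑ j : Fin 3, contactForm (φ x) (grad φ j x) * psi i (grad φ j x) := by
  have h := euler_lagrange hφ hx (Sum.inr (Sum.inl i))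
  have hv := euler_lagrange_v hφ hx
  have h0 : ∀ q : HSpace k, contactForm q (Pi.single (Sum.inr (Sum.inl i)) 1) = -psi i q := by
    simp [contactForm, vv, chi, psi, Pi.single_apply]
  have h2 : uu (Pi.single (Sum.inr (Sum.inl i)) 1 : HSpace k) = 0 := by simp [uu]
  have h3 : ∀ X : HSpace k, contactDeriv (Pi.single (Sum.inr (Sum.inl i)) 1) X = psi i X := by
    simp [contactDeriv, chi, psi, Pi.single_apply]
  have h4 : ∀ X : HSpace k, contactDeriv X (Pi.single (Sum.inr (Sum.inl i)) 1) = -psi i X := by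
    simp [contactDeriv, chi, psi, Pi.single_apply]
  have h5 : ∀ X : HSpace k, ∑ l, (chi l (Pi.single (Sum.inr (Sum.inl i)) 1 : HSpace k) * chi l X
      + psi l (Pi.single (Sum.inr (Sum.inl i)) 1 : HSpace k) * psi l X) = chi i X := by
    simp [chi, psi, Pi.single_apply]
  have hE : Real.exp (4 * uu (φ x)) = Real.exp (2 * uu (φ x)) * Real.exp (2 * uu (φ x)) := by
    rw [← Real.exp_add]; ring_nf
  simp only [fderiv_hypForm] at h
  simp only [h0, h2, h3, h4, h5, contactDeriv_self, hypForm, zero_mul,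
    mul_zero, add_zero, zero_add, hE] at h
  refine mul_left_cancel₀ (Real.exp_ne_zero (2 * uu (φ x))) ?_
  simp only [Fin.sum_univ_three] at h hv ⊢
  -- The contact form takes the value -ψᵢ on ∂_{χᵢ}, so the raw equation contains -ψᵢ e^{4u} times
  -- the v-equation; that part is removed here.
  linear_combination h + Real.exp (2 * uu (φ x)) ^ 2 * psi i (φ x) * hv

theorem euler_lagrange_psi (hφ : IsHarmonicMap Ω φ) (hx : x ∈ Ω) (i : Fin k) :
    psi i (lap φ x) + 2 * ∑ j : Fin 3, uu (grad φ j x) * psi i (grad φ j x) =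
      -(2 * Real.exp (2 * uu (φ x)) *
        ∑ j : Fin 3, contactForm (φ x) (grad φ j x) * chi i (grad φ j x)) := by
  have h := euler_lagrange hφ hx (Sum.inr (Sum.inr i))
  have hv := euler_lagrange_v hφ hx
  have h0 : ∀ q : HSpace k, contactForm q (Pi.single (Sum.inr (Sum.inr i)) 1) = chi i q := by
    simp [contactForm, vv, chi, psi, Pi.single_apply]
  have h2 : uu (Pi.single (Sum.inr (Sum.inr i)) 1 : HSpace k) = 0 := by simp [uu]
  have h3 : ∀ X : HSpace k, contactDeriv (Pi.single (Sum.inr (Sum.inr i)) 1) X = -chi i X := by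
    simp [contactDeriv, chi, psi, Pi.single_apply]
  have h4 : ∀ X : HSpace k, contactDeriv X (Pi.single (Sum.inr (Sum.inr i)) 1) = chi i X := by
    simp [contactDeriv, chi, psi, Pi.single_apply]
  have h5 : ∀ X : HSpace k, ∑ l, (chi l (Pi.single (Sum.inr (Sum.inr i)) 1 : HSpace k) * chi l X
      + psi l (Pi.single (Sum.inr (Sum.inr i)) 1 : HSpace k) * psi l X) = psi i X := by
    simp [chi, psi, Pi.single_apply]
  have hE : Real.exp (4 * uu (φ x)) = Real.exp (2 * uu (φ x)) * Real.exp (2 * uu (φ x)) := by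
    rw [← Real.exp_add]; ring_nf
  simp only [fderiv_hypForm] at h
  simp only [h0, h2, h3, h4, h5, contactDeriv_self, hypForm, zero_mul,
    mul_zero, add_zero, zero_add, hE] at h
  refine mul_left_cancel₀ (Real.exp_ne_zero (2 * uu (φ x))) ?_
  simp only [Fin.sum_univ_three] at h hv ⊢
  -- The contact form takes the value χᵢ on ∂_{ψᵢ}, whence the opposite sign.
  linear_combination h - Real.exp (2 * uu (φ x)) ^ 2 * chi i (φ x) * hv

end Components

end Hyperbolic

/-! ## Axially symmetric functions -/

theorem isOpen_compl_zAxis : IsOpen (zAxisᶜ : Set E3) := by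
  have h0 : Continuous fun x : E3 => x 0 := by fun_prop
  have h1 : Continuous fun x : E3 => x 1 := by fun_prop
  exact ((isClosed_eq h0 continuous_const).inter (isClosed_eq h1 continuous_const)).isOpen_compl

theorem compl_zAxis_subset_compl_sing {N k : ℕ} (D : RodData N k) : zAxisᶜ ⊆ D.singᶜ :=
  Set.compl_subset_compl.2 fun _ hx => hx.1

theorem sum_sq_pos {x : E3} (hx : x ∉ zAxis) : 0 < x 0 ^ 2 + x 1 ^ 2 := by
  refine lt_of_le_of_ne (by positivity) fun h => hx ⟨?_, ?_⟩ <;>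
    nlinarith [sq_nonneg (x 0), sq_nonneg (x 1)]

theorem rho_pos {x : E3} (hx : x ∉ zAxis) : 0 < rho x := Real.sqrt_pos.2 (sum_sq_pos hx)

theorem rho_sq (x : E3) : rho x ^ 2 = x 0 ^ 2 + x 1 ^ 2 := Real.sq_sqrt (by positivity)

theorem contDiffOn_rho : ContDiffOn ℝ ∞ rho zAxisᶜ := by
  refine ContDiffOn.sqrt (ContDiff.contDiffOn ?_) fun x hx => (sum_sq_pos hx).ne'
  fun_prop

theorem fderiv_coord (j : Fin 3) (x Y : E3) : fderiv ℝ (fun y : E3 => y j) x Y = Y j :=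
  congrArg (fun L : E3 →L[ℝ] ℝ => L Y)
    (EuclideanSpace.proj j : E3 →L[ℝ] ℝ).hasFDerivAt.fderiv

theorem fderiv_rho {x : E3} (hx : x ∉ zAxis) (Y : E3) : fderiv ℝ rho x Y = dRho x Y := by
  have h0 : DifferentiableAt ℝ (fun y : E3 => y 0) x := by fun_prop
  have h1 : DifferentiableAt ℝ (fun y : E3 => y 1) x := by fun_prop
  have hr := differentiableAt_of_contDiffOn isOpen_compl_zAxis contDiffOn_rho hx
  -- Differentiating ρ² in two ways avoids differentiating the square root.
  have e1 : fderiv ℝ (fun y => rho y ^ 2) x Y = 2 * rho x * fderiv ℝ rho x Y := by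
    simp [fderiv_fun_pow 2 hr]
  have e2 : fderiv ℝ (fun y : E3 => y 0 ^ 2 + y 1 ^ 2) x Y = 2 * x 0 * Y 0 + 2 * x 1 * Y 1 := by
    rw [fderiv_fun_add (h0.fun_pow 2) (h1.fun_pow 2), fderiv_fun_pow 2 h0, fderiv_fun_pow 2 h1]
    simp [fderiv_coord]
  simp only [rho_sq] at e1
  rw [e2] at e1
  have := (rho_pos hx).ne'
  rw [dRho, eq_div_iff this]
  linarith

/-- The half-plane coordinates `(ρ, z)` of a point. -/
noncomputable def meridian (x : E3) : R2 := ![rho x, x 2]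

/-- The point with the half-plane coordinates `(ρ, z)` and the azimuthal angle `0`. -/
noncomputable def planePoint : R2 →L[ℝ] E3 :=
  (ContinuousLinearMap.proj (R := ℝ) (φ := fun _ : Fin 2 => ℝ) 0).smulRight
      (EuclideanSpace.single 0 1)
    + (ContinuousLinearMap.proj (R := ℝ) (φ := fun _ : Fin 2 => ℝ) 1).smulRight
      (EuclideanSpace.single 2 1)

@[simp] theorem planePoint_apply_zero (Y : R2) : planePoint Y 0 = Y 0 := by simp [planePoint]
@[simp] theorem planePoint_apply_one (Y : R2) : planePoint Y 1 = 0 := by simp [planePoint]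
@[simp] theorem planePoint_apply_two (Y : R2) : planePoint Y 2 = Y 1 := by simp [planePoint]

theorem planePoint_single_zero : planePoint (Pi.single 0 1) = EuclideanSpace.single 0 1 := by
  simp [planePoint]

theorem planePoint_single_one : planePoint (Pi.single 1 1) = EuclideanSpace.single 2 1 := by
  simp [planePoint]

theorem planePoint_notMem_zAxis {Y : R2} (hY : Y ∈ halfPlane) : planePoint Y ∉ zAxis := fun h =>
  (ne_of_gt hY) (by simpa using h.1)

theorem rho_planePoint {Y : R2} (hY : Y ∈ halfPlane) : rho (planePoint Y) = Y 0 := by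
  simp [rho, Real.sqrt_sq (le_of_lt hY)]

theorem meridian_planePoint {Y : R2} (hY : Y ∈ halfPlane) : meridian (planePoint Y) = Y := by
  ext j
  fin_cases j
  · exact rho_planePoint hY
  · simp [meridian]

theorem meridian_mem {x : E3} (hx : x ∉ zAxis) : meridian x ∈ halfPlane := rho_pos hx

theorem contDiffOn_meridian : ContDiffOn ℝ ∞ meridian zAxisᶜ := by
  rw [contDiffOn_pi]
  intro j
  fin_cases j
  · exact contDiffOn_rho
  · exact ContDiff.contDiffOn (f := fun x : E3 => x 2) (by fun_prop)

theorem fderiv_meridian {x : E3} (hx : x ∉ zAxis) (Y : E3) :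
    fderiv ℝ meridian x Y = ![dRho x Y, Y 2] := by
  have hm := differentiableAt_of_contDiffOn isOpen_compl_zAxis contDiffOn_meridian hx
  have h : ∀ j, fderiv ℝ meridian x Y j = fderiv ℝ (fun y => meridian y j) x Y := fun j => by
    rw [fderiv_apply hm]
    rfl
  ext j
  rw [h]
  fin_cases j
  · exact fderiv_rho hx Y
  · exact fderiv_coord 2 x Y

theorem fderiv_comp_meridian {F : R2 → ℝ} {x : E3} (hx : x ∉ zAxis)
    (hF : DifferentiableAt ℝ F (meridian x)) (Y : E3) :
    fderiv ℝ (fun y => F (meridian y)) x Y =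
      pd 0 F (meridian x) * dRho x Y + pd 1 F (meridian x) * Y 2 := by
  have hm := differentiableAt_of_contDiffOn isOpen_compl_zAxis contDiffOn_meridian hx
  rw [fderiv_fun_comp x hF hm]
  rw [ContinuousLinearMap.comp_apply, fderiv_eq_sum_pd, fderiv_meridian hx]
  simp
  ring

theorem exists_angle (x : E3) : ∃ α, x = rotZ α (planePoint (meridian x)) := by
  -- The azimuthal angle is the argument of x₀ + i x₁; on the axis any angle works, since the radius
  -- is 0.
  refine ⟨Complex.arg ⟨x 0, x 1⟩, ?_⟩
  have hn : ‖(⟨x 0, x 1⟩ : ℂ)‖ = rho x := by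
    rw [Complex.norm_def, Complex.normSq_mk, rho]
    ring_nf
  have h0 := Complex.norm_mul_cos_arg ⟨x 0, x 1⟩
  have h1 := Complex.norm_mul_sin_arg ⟨x 0, x 1⟩
  rw [hn] at h0 h1
  ext j
  fin_cases j
  · simp [rotZ, meridian]
    linarith
  · simp [rotZ, meridian]
    linarith
  · simp [rotZ, meridian]

theorem rho_rotZ (α : ℝ) (x : E3) : rho (rotZ α x) = rho x := by
  have : rotZ α x 0 ^ 2 + rotZ α x 1 ^ 2 = x 0 ^ 2 + x 1 ^ 2 := by
    simp [rotZ]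
    linear_combination (x 0 ^ 2 + x 1 ^ 2) * Real.sin_sq_add_cos_sq α
  rw [rho, this, rho]

theorem meridian_rotZ (α : ℝ) (x : E3) : meridian (rotZ α x) = meridian x := by
  ext j
  fin_cases j
  · exact rho_rotZ α x
  · simp [meridian, rotZ]

theorem rotZ_notMem_zAxis (α : ℝ) {x : E3} (hx : x ∉ zAxis) : rotZ α x ∉ zAxis := by
  intro h
  have h1 : rho (rotZ α x) = 0 := by simp [rho, h.1, h.2]
  rw [rho_rotZ] at h1
  exact (rho_pos hx).ne' h1

theorem eq_comp_meridian {β : Type*} {f : E3 → β} (hf : ∀ α, ∀ x ∉ zAxis, f (rotZ α x) = f x)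
    {x : E3} (hx : x ∉ zAxis) : f x = f (planePoint (meridian x)) := by
  obtain ⟨α, hα⟩ := exists_angle x
  conv_lhs => rw [hα]
  exact hf α _ (planePoint_notMem_zAxis (meridian_mem hx))

/-- A function whose derivative along `ξ` vanishes is axially symmetric. -/
theorem axisymmetric_of_fderiv_xi {f : E3 → ℝ} (hf : ContDiffOn ℝ ∞ f zAxisᶜ)
    (h : ∀ x ∉ zAxis, fderiv ℝ f x (xi x) = 0) (α : ℝ) {x : E3} (hx : x ∉ zAxis) :
    f (rotZ α x) = f x := by
  -- The rotations are the flow of ξ, so f is constant along the orbit of x.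
  have hrot : ∀ t, HasDerivAt (fun s => rotZ s x) (xi (rotZ t x)) t := by
    intro t
    suffices hp : HasDerivAt (fun s (j : Fin 3) => rotZ s x j) (fun j => xi (rotZ t x) j) t from
      (PiLp.continuousLinearEquiv 2 ℝ fun _ : Fin 3 => ℝ).symm.hasFDerivAt.comp_hasDerivAt t hp
    rw [hasDerivAt_pi]
    intro j
    fin_cases j
    · refine (((Real.hasDerivAt_cos t).mul_const (x 0)).fun_sub
        ((Real.hasDerivAt_sin t).mul_const (x 1))).congr_deriv ?_
      simp [rotZ, xi]
      ring
    · refine (((Real.hasDerivAt_sin t).mul_const (x 0)).fun_add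
        ((Real.hasDerivAt_cos t).mul_const (x 1))).congr_deriv ?_
      simp [rotZ, xi]
      ring
    · simpa [rotZ, xi] using hasDerivAt_const t (x 2)
  have hd : ∀ t, HasDerivAt (fun s => f (rotZ s x)) 0 t := by
    intro t
    have hx' := rotZ_notMem_zAxis t hx
    have := (differentiableAt_of_contDiffOn isOpen_compl_zAxis hf hx').hasFDerivAt.comp_hasDerivAt t
      (hrot t)
    rwa [h _ hx'] at this
  have := is_const_of_deriv_eq_zero (fun t => (hd t).differentiableAt) (fun t => (hd t).deriv) α 0
  have h0 : rotZ 0 x = x := by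
    ext j
    fin_cases j <;> simp [rotZ]
  simpa only [h0] using this

theorem contDiffOn_comp_planePoint {f : E3 → ℝ} (hf : ContDiffOn ℝ ∞ f zAxisᶜ) :
    ContDiffOn ℝ ∞ (fun Y => f (planePoint Y)) halfPlane :=
  hf.comp planePoint.contDiff.contDiffOn fun _ hY => planePoint_notMem_zAxis hY

theorem contDiffOn_comp_meridian {F : R2 → ℝ} (hF : ContDiffOn ℝ ∞ F halfPlane) :
    ContDiffOn ℝ ∞ (fun x => F (meridian x)) zAxisᶜ :=
  hF.comp contDiffOn_meridian fun _ hx => meridian_mem hx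

section Restriction

variable {f : E3 → ℝ} {Y : R2}

theorem pd_comp_planePoint (hf : ContDiffOn ℝ ∞ f zAxisᶜ) (hY : Y ∈ halfPlane) (j : Fin 2) :
    pd j (fun Z => f (planePoint Z)) Y = fderiv ℝ f (planePoint Y) (planePoint (Pi.single j 1)) := by
  rw [pd, fderiv_fun_comp Y (differentiableAt_of_contDiffOn isOpen_compl_zAxis hf
    (planePoint_notMem_zAxis hY)) planePoint.differentiableAt, planePoint.fderiv]
  rfl

variable (hf : ContDiffOn ℝ ∞ f zAxisᶜ) (hs : ∀ α, ∀ x ∉ zAxis, f (rotZ α x) = f x)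

include hf hs in
theorem fderiv_of_axisymmetric {x : E3} (hx : x ∉ zAxis) (X : E3) :
    fderiv ℝ f x X = pd 0 (fun Z => f (planePoint Z)) (meridian x) * dRho x X
      + pd 1 (fun Z => f (planePoint Z)) (meridian x) * X 2 := by
  have he : f =ᶠ[𝓝 x] fun y => f (planePoint (meridian y)) :=
    Filter.eventuallyEq_of_mem (isOpen_compl_zAxis.mem_nhds hx) fun y hy => eq_comp_meridian hs hy
  rw [he.fderiv_eq]
  exact fderiv_comp_meridian (F := fun Z => f (planePoint Z)) hx (differentiableAt_of_contDiffOn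
    isOpen_halfPlane (contDiffOn_comp_planePoint hf) (meridian_mem hx)) X

include hf hs in
theorem fderiv_planePoint_one (hY : Y ∈ halfPlane) :
    fderiv ℝ f (planePoint Y) (EuclideanSpace.single 1 1) = 0 := by
  rw [fderiv_of_axisymmetric hf hs (planePoint_notMem_zAxis hY)]
  simp [dRho]

include hf hs in
/-- The Laplacian of an axially symmetric function in cylindrical coordinates. -/
theorem laplacian_planePoint (hY : Y ∈ halfPlane) :
    Laplacian.laplacian f (planePoint Y) =
      pd 0 (pd 0 fun Z => f (planePoint Z)) Y + pd 0 (fun Z => f (planePoint Z)) Y / Y 0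
        + pd 1 (pd 1 fun Z => f (planePoint Z)) Y := by
  have hx := planePoint_notMem_zAxis hY
  have hd : ∀ X : E3, ContDiffOn ℝ ∞ (fun x => fderiv ℝ f x X) zAxisᶜ := fun X =>
    (hf.fderiv_of_isOpen isOpen_compl_zAxis (by simp)).clm_apply contDiffOn_const
  have hdd : DifferentiableAt ℝ (fderiv ℝ f) (planePoint Y) :=
    differentiableAt_of_contDiffOn isOpen_compl_zAxis
      (hf.fderiv_of_isOpen isOpen_compl_zAxis (by simp)) hx
  have hlap : Laplacian.laplacian f (planePoint Y) = ∑ j : Fin 3,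
      fderiv ℝ (fun x => fderiv ℝ f x (EuclideanSpace.single j 1)) (planePoint Y)
        (EuclideanSpace.single j 1) := by
    rw [InnerProductSpace.laplacian_eq_iteratedFDeriv_orthonormalBasis f
      (EuclideanSpace.basisFun (Fin 3) ℝ)]
    refine Finset.sum_congr rfl fun j _ => ?_
    rw [iteratedFDeriv_two_apply, fderiv_clm_apply hdd (differentiableAt_const _)]
    simp
  have hpd : ∀ j : Fin 2, pd j (pd j fun Z => f (planePoint Z)) Y =
      fderiv ℝ (fun x => fderiv ℝ f x (planePoint (Pi.single j 1))) (planePoint Y)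
        (planePoint (Pi.single j 1)) := fun j => by
    rw [pd_congr_of_eqOn isOpen_halfPlane (fun Z hZ => pd_comp_planePoint hf hZ j) hY,
      pd_comp_planePoint (hd _) hY]
  -- Source of the term f_ρ / ρ: axial symmetry gives x₀ ∂₁f = x₁ ∂₀f near the point, and
  -- differentiating this in the direction of x₁ at a point with x₁ = 0 gives x₀ ∂₁∂₁f = ∂₀f.
  have h1 : Y 0 * fderiv ℝ (fun x => fderiv ℝ f x (EuclideanSpace.single 1 1)) (planePoint Y)
        (EuclideanSpace.single 1 1) = pd 0 (fun Z => f (planePoint Z)) Y := by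
    have he : (fun x : E3 => x 0 * fderiv ℝ f x (EuclideanSpace.single 1 1)) =ᶠ[𝓝 (planePoint Y)]
        fun x => x 1 * fderiv ℝ f x (EuclideanSpace.single 0 1) := by
      refine Filter.eventuallyEq_of_mem (isOpen_compl_zAxis.mem_nhds hx) fun x hx => ?_
      simp only [fderiv_of_axisymmetric hf hs hx, dRho]
      simp
      ring
    have := congrArg (fun L : E3 →L[ℝ] ℝ => L (EuclideanSpace.single 1 1)) he.fderiv_eq
    have c : ∀ j : Fin 3, DifferentiableAt ℝ (fun x : E3 => x j) (planePoint Y) := fun j => by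
      fun_prop
    have d : ∀ X : E3, DifferentiableAt ℝ (fun x => fderiv ℝ f x X) (planePoint Y) := fun X =>
      differentiableAt_of_contDiffOn isOpen_compl_zAxis (hd X) hx
    simp only [fderiv_fun_mul (c _) (d _), add_apply, smul_apply, fderiv_coord, smul_eq_mul] at this
    rw [pd_comp_planePoint hf hY, planePoint_single_zero]
    simpa using this
  have hY0 : Y 0 ≠ 0 := ne_of_gt hY
  rw [hlap, Fin.sum_univ_three, hpd, hpd, planePoint_single_zero, planePoint_single_one, ← h1]
  field_simp

end Restriction

/-! ## The reduced equations on the half-plane -/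

/-- The equations of an axially symmetric harmonic map `(u, v, χ, ψ)` into complex hyperbolic space,
on the half-plane, in terms of `u`, `χ`, `ψ` and the components `o` of
`ω = 2 (dv + χ · dψ - ψ · dχ)`. -/
structure ReducedSystem {k : ℕ} (u : R2 → ℝ) (o : Fin 2 → R2 → ℝ) (χ ψ : Fin k → R2 → ℝ) :
    Prop where
  smooth_u : ContDiffOn ℝ ∞ u halfPlane
  smooth_o : ∀ j, ContDiffOn ℝ ∞ (o j) halfPlane
  smooth_chi : ∀ i, ContDiffOn ℝ ∞ (χ i) halfPlane
  smooth_psi : ∀ i, ContDiffOn ℝ ∞ (ψ i) halfPlane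
  eq_u : ∀ Y ∈ halfPlane, pd 0 (pd 0 u) Y + pd 0 u Y / Y 0 + pd 1 (pd 1 u) Y =
    1 / 2 * Real.exp (4 * u Y) * (o 0 Y ^ 2 + o 1 Y ^ 2)
      + Real.exp (2 * u Y) * ∑ i, (pd 0 (χ i) Y ^ 2 + pd 1 (χ i) Y ^ 2
        + pd 0 (ψ i) Y ^ 2 + pd 1 (ψ i) Y ^ 2)
  eq_o : ∀ Y ∈ halfPlane, pd 0 (o 0) Y + o 0 Y / Y 0 + pd 1 (o 1) Y
    + 4 * (pd 0 u Y * o 0 Y + pd 1 u Y * o 1 Y) = 0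
  eq_chi : ∀ Y ∈ halfPlane, ∀ i,
    pd 0 (pd 0 (χ i)) Y + pd 0 (χ i) Y / Y 0 + pd 1 (pd 1 (χ i)) Y
      + 2 * (pd 0 u Y * pd 0 (χ i) Y + pd 1 u Y * pd 1 (χ i) Y) =
    Real.exp (2 * u Y) * (o 0 Y * pd 0 (ψ i) Y + o 1 Y * pd 1 (ψ i) Y)
  eq_psi : ∀ Y ∈ halfPlane, ∀ i,
    pd 0 (pd 0 (ψ i)) Y + pd 0 (ψ i) Y / Y 0 + pd 1 (pd 1 (ψ i)) Y
      + 2 * (pd 0 u Y * pd 0 (ψ i) Y + pd 1 u Y * pd 1 (ψ i) Y) =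
    -(Real.exp (2 * u Y) * (o 0 Y * pd 0 (χ i) Y + o 1 Y * pd 1 (χ i) Y))
  curl : ∀ Y ∈ halfPlane, pd 1 (o 0) Y - pd 0 (o 1) Y =
    4 * ∑ i, (pd 1 (χ i) Y * pd 0 (ψ i) Y - pd 0 (χ i) Y * pd 1 (ψ i) Y)

/-! ### From the harmonic map equation to the reduced system -/

section Derivation

variable {k : ℕ}

/-- The components of the one-form `2 (dv + χ · dψ - ψ · dχ)` on the half-plane. -/
noncomputable def contactComp (v : R2 → ℝ) (χ ψ : Fin k → R2 → ℝ) (j : Fin 2) (Y : R2) : ℝ :=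
  2 * (pd j v Y + ∑ i, (χ i Y * pd j (ψ i) Y - ψ i Y * pd j (χ i) Y))

variable {v : R2 → ℝ} {χ ψ : Fin k → R2 → ℝ}

theorem contDiffOn_contactComp (hv : ContDiffOn ℝ ∞ v halfPlane)
    (hχ : ∀ i, ContDiffOn ℝ ∞ (χ i) halfPlane) (hψ : ∀ i, ContDiffOn ℝ ∞ (ψ i) halfPlane)
    (j : Fin 2) : ContDiffOn ℝ ∞ (contactComp v χ ψ j) halfPlane := by
  have H := isOpen_halfPlane
  exact contDiffOn_const.mul ((contDiffOn_pd H hv j).add (ContDiffOn.sum fun i _ =>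
    ((hχ i).mul (contDiffOn_pd H (hψ i) j)).sub ((hψ i).mul (contDiffOn_pd H (hχ i) j))))

theorem pd_contactComp (hv : ContDiffOn ℝ ∞ v halfPlane)
    (hχ : ∀ i, ContDiffOn ℝ ∞ (χ i) halfPlane) (hψ : ∀ i, ContDiffOn ℝ ∞ (ψ i) halfPlane)
    (l j : Fin 2) {Y : R2} (hY : Y ∈ halfPlane) :
    pd l (contactComp v χ ψ j) Y = 2 * (pd l (pd j v) Y + ∑ i,
      (pd l (χ i) Y * pd j (ψ i) Y + χ i Y * pd l (pd j (ψ i)) Y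
        - (pd l (ψ i) Y * pd j (χ i) Y + ψ i Y * pd l (pd j (χ i)) Y))) := by
  have H := isOpen_halfPlane
  have D : ∀ {f : R2 → ℝ}, ContDiffOn ℝ ∞ f halfPlane → DifferentiableAt ℝ f Y :=
    fun hf => differentiableAt_of_contDiffOn H hf hY
  have d1 : ∀ i, DifferentiableAt ℝ (fun Z => χ i Z * pd j (ψ i) Z) Y := fun i =>
    (D (hχ i)).mul (D (contDiffOn_pd H (hψ i) j))
  have d2 : ∀ i, DifferentiableAt ℝ (fun Z => ψ i Z * pd j (χ i) Z) Y := fun i =>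
    (D (hψ i)).mul (D (contDiffOn_pd H (hχ i) j))
  have d3 : DifferentiableAt ℝ (fun Z => ∑ i, (χ i Z * pd j (ψ i) Z - ψ i Z * pd j (χ i) Z)) Y :=
    DifferentiableAt.fun_sum fun i _ => (d1 i).sub (d2 i)
  have d4 := D (contDiffOn_pd H hv j)
  unfold contactComp
  rw [pd_mul l (differentiableAt_const _) (d4.fun_add d3), pd_const, pd_add l d4 d3,
    pd_sum l fun i _ => (d1 i).fun_sub (d2 i), zero_mul, zero_add]
  congr 2
  refine Finset.sum_congr rfl fun i _ => ?_
  rw [pd_sub l (d1 i) (d2 i), pd_mul l (D (hχ i)) (D (contDiffOn_pd H (hψ i) j)),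
    pd_mul l (D (hψ i)) (D (contDiffOn_pd H (hχ i) j))]

variable {φ : E3 → HSpace k}

/-- The component `a` of a map in half-plane coordinates. -/
noncomputable def planeComp (φ : E3 → HSpace k) (a : HIdx k) (Y : R2) : ℝ := φ (planePoint Y) a

/-- The component equations are evaluated at points of azimuthal angle 0, where the derivative
across the half-plane vanishes. The contact form of a gradient is half the corresponding component
of ω, which accounts for the constants. The field `curl` uses only symmetry of second derivatives.
-/
theorem reducedSystem_of_isHarmonicMap (hφ : IsHarmonicMap zAxisᶜ φ)
    (hs : ∀ α, ∀ x ∉ zAxis, φ (rotZ α x) = φ x) :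
    ReducedSystem (planeComp φ (Sum.inl 0))
      (contactComp (planeComp φ (Sum.inl 1)) (fun i => planeComp φ (Sum.inr (Sum.inl i)))
        (fun i => planeComp φ (Sum.inr (Sum.inr i))))
      (fun i => planeComp φ (Sum.inr (Sum.inl i))) (fun i => planeComp φ (Sum.inr (Sum.inr i))) := by
  have hc : ∀ a, ContDiffOn ℝ ∞ (fun x => φ x a) zAxisᶜ := fun a => contDiffOn_pi.1 hφ.1 a
  have hs' : ∀ a, ∀ α, ∀ x ∉ zAxis, φ (rotZ α x) a = φ x a := fun a α x hx =>
    congrFun (hs α x hx) a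
  have hsm : ∀ a, ContDiffOn ℝ ∞ (planeComp φ a) halfPlane := fun a =>
    contDiffOn_comp_planePoint (hc a)
  have g0 : ∀ Y ∈ halfPlane, ∀ a, grad φ 0 (planePoint Y) a = pd 0 (planeComp φ a) Y := by
    intro Y hY a
    rw [grad, ← planePoint_single_zero, ← pd_comp_planePoint (hc a) hY]
    rfl
  have g1 : ∀ Y ∈ halfPlane, ∀ a, grad φ 1 (planePoint Y) a = 0 := fun Y hY a =>
    fderiv_planePoint_one (hc a) (hs' a) hY
  have g2 : ∀ Y ∈ halfPlane, ∀ a, grad φ 2 (planePoint Y) a = pd 1 (planeComp φ a) Y := by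
    intro Y hY a
    rw [grad, ← planePoint_single_one, ← pd_comp_planePoint (hc a) hY]
    rfl
  have gl : ∀ Y ∈ halfPlane, ∀ a, lap φ (planePoint Y) a = pd 0 (pd 0 (planeComp φ a)) Y
      + pd 0 (planeComp φ a) Y / Y 0 + pd 1 (pd 1 (planeComp φ a)) Y := fun Y hY a =>
    laplacian_planePoint (hc a) (hs' a) hY
  have hp : ∀ Y a, φ (planePoint Y) a = planeComp φ a Y := fun _ _ => rfl
  have po := fun (l j : Fin 2) (Y : R2) (hY : Y ∈ halfPlane) => pd_contactComp (hsm (Sum.inl 1))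
    (fun i => hsm (Sum.inr (Sum.inl i))) (fun i => hsm (Sum.inr (Sum.inr i))) l j hY
  have k0 : ∀ Y ∈ halfPlane, contactForm (φ (planePoint Y)) (grad φ 0 (planePoint Y)) = 1 / 2 *
      contactComp (planeComp φ (Sum.inl 1)) (fun i => planeComp φ (Sum.inr (Sum.inl i)))
        (fun i => planeComp φ (Sum.inr (Sum.inr i))) 0 Y := by
    intro Y hY
    simp only [contactForm, contactComp, vv, chi, psi, g0 Y hY, hp]
    ring
  have k1 : ∀ Y ∈ halfPlane, contactForm (φ (planePoint Y)) (grad φ 1 (planePoint Y)) = 0 := by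
    intro Y hY
    simp [contactForm, vv, chi, psi, g1 Y hY]
  have k2 : ∀ Y ∈ halfPlane, contactForm (φ (planePoint Y)) (grad φ 2 (planePoint Y)) = 1 / 2 *
      contactComp (planeComp φ (Sum.inl 1)) (fun i => planeComp φ (Sum.inr (Sum.inl i)))
        (fun i => planeComp φ (Sum.inr (Sum.inr i))) 1 Y := by
    intro Y hY
    simp only [contactForm, contactComp, vv, chi, psi, g2 Y hY, hp]
    ring
  have hm : ∀ Y ∈ halfPlane, planePoint Y ∈ (zAxisᶜ : Set E3) := fun Y hY =>
    planePoint_notMem_zAxis hY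
  refine ⟨hsm _, contDiffOn_contactComp (hsm _) (fun i => hsm _) (fun i => hsm _),
    fun i => hsm _, fun i => hsm _, ?_, ?_, ?_, ?_, ?_⟩
  · intro Y hY
    have h := euler_lagrange_u hφ (hm Y hY)
    simp only [Fin.sum_univ_three, k0 Y hY, k1 Y hY, k2 Y hY] at h
    simp only [uu, chi, psi, g0 Y hY, g1 Y hY, g2 Y hY, gl Y hY, hp] at h
    rw [h]
    simp only [Finset.sum_add_distrib]
    simp
    ring
  · intro Y hY
    have h := euler_lagrange_v hφ (hm Y hY)
    simp only [Fin.sum_univ_three, k0 Y hY, k1 Y hY, k2 Y hY] at h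
    simp only [contactForm, uu, vv, chi, psi, g0 Y hY, g1 Y hY, g2 Y hY, gl Y hY, hp] at h
    -- In the divergence of ω the products of first derivatives of χ and ψ cancel, so it is twice
    -- the contact form of the vector of Laplacians.
    have e : pd 0 (contactComp (planeComp φ (Sum.inl 1))
        (fun i => planeComp φ (Sum.inr (Sum.inl i)))
        (fun i => planeComp φ (Sum.inr (Sum.inr i))) 0) Y + contactComp (planeComp φ (Sum.inl 1))
        (fun i => planeComp φ (Sum.inr (Sum.inl i)))
        (fun i => planeComp φ (Sum.inr (Sum.inr i))) 0 Y / Y 0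
        + pd 1 (contactComp (planeComp φ (Sum.inl 1))
        (fun i => planeComp φ (Sum.inr (Sum.inl i)))
        (fun i => planeComp φ (Sum.inr (Sum.inr i))) 1) Y = 2 *
        (pd 0 (pd 0 (planeComp φ (Sum.inl 1))) Y + pd 0 (planeComp φ (Sum.inl 1)) Y / Y 0
          + pd 1 (pd 1 (planeComp φ (Sum.inl 1))) Y + ∑ i,
          (planeComp φ (Sum.inr (Sum.inl i)) Y * (pd 0 (pd 0 (planeComp φ (Sum.inr (Sum.inr i)))) Y
            + pd 0 (planeComp φ (Sum.inr (Sum.inr i))) Y / Y 0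
            + pd 1 (pd 1 (planeComp φ (Sum.inr (Sum.inr i)))) Y)
          - planeComp φ (Sum.inr (Sum.inr i)) Y * (pd 0 (pd 0 (planeComp φ (Sum.inr (Sum.inl i)))) Y
            + pd 0 (planeComp φ (Sum.inr (Sum.inl i))) Y / Y 0
            + pd 1 (pd 1 (planeComp φ (Sum.inr (Sum.inl i)))) Y))) := by
      rw [po 0 0 Y hY, po 1 1 Y hY]
      have cm : ∀ (j : Fin 2) (i : Fin k), pd j (planeComp φ (Sum.inr (Sum.inr i))) Y
          * pd j (planeComp φ (Sum.inr (Sum.inl i))) Y =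
        pd j (planeComp φ (Sum.inr (Sum.inl i))) Y * pd j (planeComp φ (Sum.inr (Sum.inr i))) Y :=
        fun _ _ => mul_comm _ _
      simp only [cm, contactComp, mul_add, add_div, mul_sub, Finset.mul_sum, Finset.sum_div,
        Finset.sum_add_distrib, Finset.sum_sub_distrib, sub_div]
      ring_nf
    rw [e]
    linear_combination 2 * h
  · intro Y hY i
    have h := euler_lagrange_chi hφ (hm Y hY) i
    simp only [Fin.sum_univ_three, k0 Y hY, k1 Y hY, k2 Y hY] at h
    simp only [uu, chi, psi, g0 Y hY, g1 Y hY, g2 Y hY, gl Y hY, hp] at h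
    linear_combination h
  · intro Y hY i
    have h := euler_lagrange_psi hφ (hm Y hY) i
    simp only [Fin.sum_univ_three, k0 Y hY, k1 Y hY, k2 Y hY] at h
    simp only [uu, chi, psi, g0 Y hY, g1 Y hY, g2 Y hY, gl Y hY, hp] at h
    linear_combination h
  · intro Y hY
    rw [po 1 0 Y hY, po 0 1 Y hY]
    have c := fun a => pd_comm isOpen_halfPlane (hsm a) hY 1 0
    simp only [c, Finset.sum_add_distrib, Finset.sum_sub_distrib]
    have cm : ∀ (a b : HIdx k), pd 1 (planeComp φ a) Y * pd 0 (planeComp φ b) Y =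
      pd 0 (planeComp φ b) Y * pd 1 (planeComp φ a) Y := fun _ _ => mul_comm _ _
    simp only [cm]
    ring

end Derivation

/-! ## The potentials on the half-plane -/

section Planar

variable {k : ℕ}

/-- The sums `∂_a χ · ∂_b χ + ∂_a ψ · ∂_b ψ`. -/
noncomputable def gram (χ ψ : Fin k → R2 → ℝ) (a b : Fin 2) (Y : R2) : ℝ :=
  ∑ i, (pd a (χ i) Y * pd b (χ i) Y + pd a (ψ i) Y * pd b (ψ i) Y)

/-- The sums `∂_a χ · ∂_b ∂_c χ + ∂_a ψ · ∂_b ∂_c ψ`. -/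
noncomputable def gramDeriv (χ ψ : Fin k → R2 → ℝ) (a b c : Fin 2) (Y : R2) : ℝ :=
  ∑ i, (pd a (χ i) Y * pd b (pd c (χ i)) Y + pd a (ψ i) Y * pd b (pd c (ψ i)) Y)

/-- The coefficient of `dρ` in `d(λ - u)`. -/
noncomputable def lamRho (u : R2 → ℝ) (o : Fin 2 → R2 → ℝ) (χ ψ : Fin k → R2 → ℝ) (Y : R2) : ℝ :=
  Y 0 * (pd 0 u Y ^ 2 - pd 1 u Y ^ 2 + 1 / 4 * Real.exp (4 * u Y) * (o 0 Y ^ 2 - o 1 Y ^ 2)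
    + Real.exp (2 * u Y) * (gram χ ψ 0 0 Y - gram χ ψ 1 1 Y))

/-- The coefficient of `dz` in `d(λ - u)`. -/
noncomputable def lamZ (u : R2 → ℝ) (o : Fin 2 → R2 → ℝ) (χ ψ : Fin k → R2 → ℝ) (Y : R2) : ℝ :=
  2 * Y 0 * (pd 0 u Y * pd 1 u Y + 1 / 4 * Real.exp (4 * u Y) * (o 0 Y * o 1 Y)
    + Real.exp (2 * u Y) * gram χ ψ 0 1 Y)

/-- The potential `w` on the half-plane. -/
structure IsPlanarW (u : R2 → ℝ) (o : Fin 2 → R2 → ℝ) (W : R2 → ℝ) : Prop where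
  smooth : ContDiffOn ℝ ∞ W halfPlane
  pd_zero : ∀ Y ∈ halfPlane, pd 0 W Y = -(Y 0 * Real.exp (4 * u Y) * o 1 Y)
  pd_one : ∀ Y ∈ halfPlane, pd 1 W Y = Y 0 * Real.exp (4 * u Y) * o 0 Y

/-- The potential `λ` on the half-plane. -/
structure IsPlanarLam (u : R2 → ℝ) (o : Fin 2 → R2 → ℝ) (χ ψ : Fin k → R2 → ℝ) (Λ : R2 → ℝ) :
    Prop where
  smooth : ContDiffOn ℝ ∞ Λ halfPlane
  pd_zero : ∀ Y ∈ halfPlane, pd 0 Λ Y = pd 0 u Y + lamRho u o χ ψ Y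
  pd_one : ∀ Y ∈ halfPlane, pd 1 Λ Y = pd 1 u Y + lamZ u o χ ψ Y

/-- The potential `θ` on the half-plane. -/
structure IsPlanarTheta (u : R2 → ℝ) (χ ψ : Fin k → R2 → ℝ) (W : R2 → ℝ) (θ : Fin k → R2 → ℝ) :
    Prop where
  smooth : ∀ i, ContDiffOn ℝ ∞ (θ i) halfPlane
  pd_zero : ∀ Y ∈ halfPlane, ∀ i,
    pd 0 (θ i) Y = -(Y 0 * Real.exp (2 * u Y) * pd 1 (ψ i) Y) - W Y * pd 0 (χ i) Y
  pd_one : ∀ Y ∈ halfPlane, ∀ i,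
    pd 1 (θ i) Y = Y 0 * Real.exp (2 * u Y) * pd 0 (ψ i) Y - W Y * pd 1 (χ i) Y

theorem gram_comm (χ ψ : Fin k → R2 → ℝ) (a b : Fin 2) (Y : R2) :
    gram χ ψ a b Y = gram χ ψ b a Y := by
  simp only [gram, mul_comm]

/-- Keeps exp (2u) as the basic exponential, so that the later identities become rational in their
atoms. -/
theorem exp_four_mul (a : ℝ) : Real.exp (4 * a) = Real.exp (2 * a) ^ 2 := by
  rw [← Real.exp_nat_mul]
  ring_nf

theorem differentiableAt_of_halfPlane {f : R2 → ℝ} (hf : ContDiffOn ℝ ∞ f halfPlane) {Y : R2}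
    (hY : Y ∈ halfPlane) : DifferentiableAt ℝ f Y :=
  differentiableAt_of_contDiffOn isOpen_halfPlane hf hY

theorem differentiableAt_pd {f : R2 → ℝ} (hf : ContDiffOn ℝ ∞ f halfPlane) {Y : R2}
    (hY : Y ∈ halfPlane) (j : Fin 2) : DifferentiableAt ℝ (pd j f) Y :=
  differentiableAt_of_contDiffOn isOpen_halfPlane (contDiffOn_pd isOpen_halfPlane hf j) hY

theorem contDiffOn_exp_mul {u : R2 → ℝ} (hu : ContDiffOn ℝ ∞ u halfPlane) (c : ℝ) :
    ContDiffOn ℝ ∞ (fun Y => Real.exp (c * u Y)) halfPlane :=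
  (contDiffOn_const.mul hu).exp

theorem contDiffOn_coord (j : Fin 2) : ContDiffOn ℝ ∞ (fun Y : R2 => Y j) halfPlane :=
  (contDiff_apply ℝ ℝ j).contDiffOn

theorem pd_exp_mul {u : R2 → ℝ} {Y : R2} (hu : DifferentiableAt ℝ u Y) (c : ℝ) (j : Fin 2) :
    pd j (fun Z => Real.exp (c * u Z)) Y = c * Real.exp (c * u Y) * pd j u Y := by
  rw [pd_exp j (hu.const_mul c), pd_mul j (differentiableAt_const c) hu, pd_const]
  ring

/-! ### Closedness of the one-forms that define λ, w and θ -/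

namespace ReducedSystem

variable {u : R2 → ℝ} {o : Fin 2 → R2 → ℝ} {χ ψ : Fin k → R2 → ℝ} (S : ReducedSystem u o χ ψ)
  {Y : R2} (hY : Y ∈ halfPlane)

include S

theorem contDiffOn_gram (a b : Fin 2) : ContDiffOn ℝ ∞ (gram χ ψ a b) halfPlane := by
  have H := isOpen_halfPlane
  exact ContDiffOn.sum fun i _ =>
    ((contDiffOn_pd H (S.smooth_chi i) a).mul (contDiffOn_pd H (S.smooth_chi i) b)).add
      ((contDiffOn_pd H (S.smooth_psi i) a).mul (contDiffOn_pd H (S.smooth_psi i) b))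

include hY

theorem pd_gram (l a b : Fin 2) :
    pd l (gram χ ψ a b) Y = gramDeriv χ ψ a l b Y + gramDeriv χ ψ b l a Y := by
  have d1 := fun i j => differentiableAt_pd (S.smooth_chi i) hY j
  have d2 := fun i j => differentiableAt_pd (S.smooth_psi i) hY j
  unfold gram
  rw [pd_sum l fun i _ => ((d1 i a).fun_mul (d1 i b)).fun_add ((d2 i a).fun_mul (d2 i b))]
  simp only [gramDeriv]
  rw [← Finset.sum_add_distrib]
  refine Finset.sum_congr rfl fun i _ => ?_
  rw [pd_add l ((d1 i a).fun_mul (d1 i b)) ((d2 i a).fun_mul (d2 i b)), pd_mul l (d1 i a) (d1 i b),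
    pd_mul l (d2 i a) (d2 i b)]
  ring

theorem gramDeriv_comm (a b c : Fin 2) : gramDeriv χ ψ a b c Y = gramDeriv χ ψ a c b Y := by
  simp only [gramDeriv, pd_comm isOpen_halfPlane (S.smooth_chi _) hY b c,
    pd_comm isOpen_halfPlane (S.smooth_psi _) hY b c]

theorem eq_u' : pd 0 (pd 0 u) Y + pd 0 u Y / Y 0 + pd 1 (pd 1 u) Y =
    1 / 2 * Real.exp (2 * u Y) ^ 2 * (o 0 Y ^ 2 + o 1 Y ^ 2)
      + Real.exp (2 * u Y) * (gram χ ψ 0 0 Y + gram χ ψ 1 1 Y) := by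
  rw [S.eq_u Y hY, exp_four_mul]
  congr 2
  simp only [gram, ← Finset.sum_add_distrib]
  refine Finset.sum_congr rfl fun i _ => ?_
  ring

/-- The equations for `χ` and `ψ` contracted with the derivatives of `χ` and `ψ`. -/
theorem sum_eq_chi_psi (j : Fin 2) :
    gramDeriv χ ψ j 0 0 Y + gram χ ψ j 0 Y / Y 0 + gramDeriv χ ψ j 1 1 Y
      + 2 * (pd 0 u Y * gram χ ψ j 0 Y + pd 1 u Y * gram χ ψ j 1 Y) =
    Real.exp (2 * u Y) * ∑ i, ((o 0 Y * pd 0 (ψ i) Y + o 1 Y * pd 1 (ψ i) Y) * pd j (χ i) Y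
      - (o 0 Y * pd 0 (χ i) Y + o 1 Y * pd 1 (χ i) Y) * pd j (ψ i) Y) := by
  simp only [gramDeriv, gram, mul_add, Finset.mul_sum, Finset.sum_div, ← Finset.sum_add_distrib]
  refine Finset.sum_congr rfl fun i _ => ?_
  linear_combination pd j (χ i) Y * S.eq_chi Y hY i + pd j (ψ i) Y * S.eq_psi Y hY i

/-- For j = 0 the terms with o₀ cancel by antisymmetry, and the factor of o₁ is a multiple of the
curl of ω. For j = 1 the roles of o₀ and o₁ are exchanged. -/
theorem sum_eq_chi_psi_zero :
    gramDeriv χ ψ 0 0 0 Y + gram χ ψ 0 0 Y / Y 0 + gramDeriv χ ψ 0 1 1 Y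
      + 2 * (pd 0 u Y * gram χ ψ 0 0 Y + pd 1 u Y * gram χ ψ 0 1 Y) =
    -(1 / 4 * Real.exp (2 * u Y) * o 1 Y * (pd 1 (o 0) Y - pd 0 (o 1) Y)) := by
  rw [S.sum_eq_chi_psi hY, S.curl Y hY]
  simp only [Finset.mul_sum, ← Finset.sum_neg_distrib]
  refine Finset.sum_congr rfl fun i _ => ?_
  ring

theorem sum_eq_chi_psi_one :
    gramDeriv χ ψ 1 0 0 Y + gram χ ψ 0 1 Y / Y 0 + gramDeriv χ ψ 1 1 1 Y
      + 2 * (pd 0 u Y * gram χ ψ 0 1 Y + pd 1 u Y * gram χ ψ 1 1 Y) =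
    1 / 4 * Real.exp (2 * u Y) * o 0 Y * (pd 1 (o 0) Y - pd 0 (o 1) Y) := by
  rw [gram_comm χ ψ 0 1, S.sum_eq_chi_psi hY, S.curl Y hY]
  simp only [Finset.mul_sum]
  refine Finset.sum_congr rfl fun i _ => ?_
  ring

omit hY in
theorem contDiffOn_lamRho : ContDiffOn ℝ ∞ (lamRho u o χ ψ) halfPlane := by
  have H := isOpen_halfPlane
  have h0 := contDiffOn_pd H S.smooth_u 0
  have h1 := contDiffOn_pd H S.smooth_u 1
  have h2 := S.smooth_o 0
  have h3 := S.smooth_o 1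
  have h4 := contDiffOn_exp_mul S.smooth_u 2
  have h5 := contDiffOn_exp_mul S.smooth_u 4
  have h6 := S.contDiffOn_gram 0 0
  have h7 := S.contDiffOn_gram 1 1
  have h8 := contDiffOn_coord 0
  unfold lamRho
  fun_prop

omit hY in
theorem contDiffOn_lamZ : ContDiffOn ℝ ∞ (lamZ u o χ ψ) halfPlane := by
  have H := isOpen_halfPlane
  have h0 := contDiffOn_pd H S.smooth_u 0
  have h1 := contDiffOn_pd H S.smooth_u 1
  have h2 := S.smooth_o 0
  have h3 := S.smooth_o 1
  have h4 := contDiffOn_exp_mul S.smooth_u 2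
  have h5 := contDiffOn_exp_mul S.smooth_u 4
  have h6 := S.contDiffOn_gram 0 1
  have h8 := contDiffOn_coord 0
  unfold lamZ
  fun_prop

theorem pd_lamRho (l : Fin 2) : pd l (lamRho u o χ ψ) Y =
    (if l = 0 then 1 else 0) * (pd 0 u Y ^ 2 - pd 1 u Y ^ 2
      + 1 / 4 * Real.exp (2 * u Y) ^ 2 * (o 0 Y ^ 2 - o 1 Y ^ 2)
      + Real.exp (2 * u Y) * (gram χ ψ 0 0 Y - gram χ ψ 1 1 Y))
    + Y 0 * (2 * pd 0 u Y * pd l (pd 0 u) Y - 2 * pd 1 u Y * pd l (pd 1 u) Y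
      + Real.exp (2 * u Y) ^ 2 * pd l u Y * (o 0 Y ^ 2 - o 1 Y ^ 2)
      + 1 / 2 * Real.exp (2 * u Y) ^ 2 * (o 0 Y * pd l (o 0) Y - o 1 Y * pd l (o 1) Y)
      + 2 * Real.exp (2 * u Y) * pd l u Y * (gram χ ψ 0 0 Y - gram χ ψ 1 1 Y)
      + 2 * Real.exp (2 * u Y) * (gramDeriv χ ψ 0 l 0 Y - gramDeriv χ ψ 1 l 1 Y)) := by
  have d0 := differentiableAt_of_halfPlane S.smooth_u hY
  have d1 := differentiableAt_pd S.smooth_u hY 0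
  have d2 := differentiableAt_pd S.smooth_u hY 1
  have d3 := differentiableAt_of_halfPlane (S.smooth_o 0) hY
  have d4 := differentiableAt_of_halfPlane (S.smooth_o 1) hY
  have d5 := differentiableAt_of_halfPlane (S.contDiffOn_gram 0 0) hY
  have d6 := differentiableAt_of_halfPlane (S.contDiffOn_gram 1 1) hY
  unfold lamRho
  simp (disch := fun_prop) only [pd_mul, pd_add, pd_sub, pd_pow_two, pd_const, pd_exp_mul,
    pd_coord, S.pd_gram hY, exp_four_mul]
  ring

theorem pd_lamZ (l : Fin 2) : pd l (lamZ u o χ ψ) Y =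
    2 * (if l = 0 then 1 else 0) * (pd 0 u Y * pd 1 u Y
      + 1 / 4 * Real.exp (2 * u Y) ^ 2 * (o 0 Y * o 1 Y) + Real.exp (2 * u Y) * gram χ ψ 0 1 Y)
    + 2 * Y 0 * (pd l (pd 0 u) Y * pd 1 u Y + pd 0 u Y * pd l (pd 1 u) Y
      + Real.exp (2 * u Y) ^ 2 * pd l u Y * (o 0 Y * o 1 Y)
      + 1 / 4 * Real.exp (2 * u Y) ^ 2 * (pd l (o 0) Y * o 1 Y + o 0 Y * pd l (o 1) Y)
      + 2 * Real.exp (2 * u Y) * pd l u Y * gram χ ψ 0 1 Y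
      + Real.exp (2 * u Y) * (gramDeriv χ ψ 0 l 1 Y + gramDeriv χ ψ 1 l 0 Y)) := by
  have d0 := differentiableAt_of_halfPlane S.smooth_u hY
  have d1 := differentiableAt_pd S.smooth_u hY 0
  have d2 := differentiableAt_pd S.smooth_u hY 1
  have d3 := differentiableAt_of_halfPlane (S.smooth_o 0) hY
  have d4 := differentiableAt_of_halfPlane (S.smooth_o 1) hY
  have d5 := differentiableAt_of_halfPlane (S.contDiffOn_gram 0 1) hY
  unfold lamZ
  simp (disch := fun_prop) only [pd_mul, pd_add, pd_pow_two, pd_const, pd_exp_mul,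
    pd_coord, S.pd_gram hY, exp_four_mul]
  ring

/-- Closedness of d(λ - u). The multipliers are u_z for the equation of u and ¼ e^{4u} o₁ for that
of ω; the contraction of the χ and ψ equations with χ_z and ψ_z has weight e^{2u}. The curl of ω
arising from the second and third parts cancels. -/
theorem pd_one_lamRho : pd 1 (lamRho u o χ ψ) Y = pd 0 (lamZ u o χ ψ) Y := by
  have hY0 : Y 0 ≠ 0 := ne_of_gt hY
  have h1 := S.eq_u' hY
  have h2 := S.eq_o Y hY
  have h3 := S.sum_eq_chi_psi_one hY
  have h4 := pd_comm isOpen_halfPlane S.smooth_u hY 1 0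
  have h5 := S.gramDeriv_comm hY 0 1 0
  rw [S.pd_lamRho hY, S.pd_lamZ hY]
  simp only [one_ne_zero, if_false, if_true, h4, h5]
  field_simp at h1 h2 h3 ⊢
  linear_combination (-8 * pd 1 u Y) * h1
    - 4 * Real.exp (2 * u Y) ^ 2 * o 1 Y * h2
    - 4 * Real.exp (2 * u Y) * h3

/-- The flat Laplacian of λ - u, needed for the trace of the (ρ, z) block of the Ricci tensor. The
multipliers are as for closedness, with ρ-derivatives in place of z-derivatives. -/
theorem pd_zero_lamRho_add : pd 0 (lamRho u o χ ψ) Y + pd 1 (lamZ u o χ ψ) Y =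
    -(pd 0 u Y ^ 2 + pd 1 u Y ^ 2 + 1 / 4 * Real.exp (2 * u Y) ^ 2 * (o 0 Y ^ 2 + o 1 Y ^ 2)
      + Real.exp (2 * u Y) * (gram χ ψ 0 0 Y + gram χ ψ 1 1 Y)) := by
  have hY0 : Y 0 ≠ 0 := ne_of_gt hY
  have h1 := S.eq_u' hY
  have h2 := S.eq_o Y hY
  have h3 := S.sum_eq_chi_psi_zero hY
  have h4 := pd_comm isOpen_halfPlane S.smooth_u hY 1 0
  have h5 := S.gramDeriv_comm hY 1 1 0
  rw [S.pd_lamRho hY, S.pd_lamZ hY]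
  simp only [one_ne_zero, if_false, if_true, h4, h5]
  field_simp at h1 h2 h3 ⊢
  linear_combination (8 * pd 0 u Y) * h1
    + 4 * Real.exp (2 * u Y) ^ 2 * o 0 Y * h2
    + 4 * Real.exp (2 * u Y) * h3

omit hY

theorem exists_planarLam : ∃ Λ, IsPlanarLam u o χ ψ Λ := by
  obtain ⟨h, hs, hd⟩ := exists_potential S.contDiffOn_lamRho S.contDiffOn_lamZ
    fun Y hY => S.pd_one_lamRho hY
  have d : ∀ Y ∈ halfPlane, ∀ j, pd j (fun Z => u Z + h Z) Y = pd j u Y + pd j h Y :=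
    fun Y hY j => pd_add j (differentiableAt_of_halfPlane S.smooth_u hY)
      (differentiableAt_of_halfPlane hs hY)
  refine ⟨fun Z => u Z + h Z, S.smooth_u.add hs, fun Y hY => ?_, fun Y hY => ?_⟩
  · rw [d Y hY, (hd Y hY).1]
  · rw [d Y hY, (hd Y hY).2]

theorem exists_planarW : ∃ W, IsPlanarW u o W := by
  have e := contDiffOn_exp_mul S.smooth_u 4
  have r := contDiffOn_coord 0
  obtain ⟨W, hs, hd⟩ := exists_potential
    (f := fun Y => -(Y 0 * Real.exp (4 * u Y) * o 1 Y)) (g := fun Y => Y 0 * Real.exp (4 * u Y) * o 0 Y)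
    ((r.mul e).mul (S.smooth_o 1)).neg ((r.mul e).mul (S.smooth_o 0)) (by
      intro Y hY
      have d0 := differentiableAt_of_halfPlane S.smooth_u hY
      have d3 := differentiableAt_of_halfPlane (S.smooth_o 0) hY
      have d4 := differentiableAt_of_halfPlane (S.smooth_o 1) hY
      have hY0 : Y 0 ≠ 0 := ne_of_gt hY
      have h2 := S.eq_o Y hY
      simp (disch := fun_prop) only [pd_neg, pd_mul, pd_exp_mul, pd_coord]
      field_simp at h2 ⊢
      simp only [one_ne_zero, if_false, if_true]
      -- Closedness is the divergence equation for ω multiplied by ρ e^{4u}.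
      linear_combination -h2)
  exact ⟨W, hs, fun Y hY => (hd Y hY).1, fun Y hY => (hd Y hY).2⟩

theorem exists_planarTheta {W : R2 → ℝ} (hW : IsPlanarW u o W) :
    ∃ θ, IsPlanarTheta u χ ψ W θ := by
  have e := contDiffOn_exp_mul S.smooth_u 2
  have r := contDiffOn_coord 0
  have H := isOpen_halfPlane
  have key : ∀ i, ∃ θ : R2 → ℝ, ContDiffOn ℝ ∞ θ halfPlane ∧ ∀ Y ∈ halfPlane,
      pd 0 θ Y = -(Y 0 * Real.exp (2 * u Y) * pd 1 (ψ i) Y) - W Y * pd 0 (χ i) Y ∧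
      pd 1 θ Y = Y 0 * Real.exp (2 * u Y) * pd 0 (ψ i) Y - W Y * pd 1 (χ i) Y := by
    intro i
    have c := S.smooth_chi i
    have p := S.smooth_psi i
    refine exists_potential (((r.mul e).mul (contDiffOn_pd H p 1)).neg.sub
      (hW.smooth.mul (contDiffOn_pd H c 0))) (((r.mul e).mul (contDiffOn_pd H p 0)).sub
      (hW.smooth.mul (contDiffOn_pd H c 1))) fun Y hY => ?_
    have d0 := differentiableAt_of_halfPlane S.smooth_u hY
    have d1 := differentiableAt_of_halfPlane hW.smooth hY
    have d2 := differentiableAt_pd p hY 0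
    have d3 := differentiableAt_pd p hY 1
    have d4 := differentiableAt_pd c hY 0
    have d5 := differentiableAt_pd c hY 1
    have hY0 : Y 0 ≠ 0 := ne_of_gt hY
    have h2 := S.eq_psi Y hY i
    have h3 := pd_comm H c hY 1 0
    simp (disch := fun_prop) only [pd_neg, pd_sub, pd_mul, pd_exp_mul, pd_coord,
      hW.pd_zero Y hY, hW.pd_one Y hY, h3, exp_four_mul]
    field_simp at h2 ⊢
    simp only [one_ne_zero, if_false, if_true]
    -- The mixed derivatives of χ cancel, and dw ∧ dχ supplies exactly the source of the ψ-equation,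
    -- taken here with the factor ρ e^{2u}.
    linear_combination -Real.exp (2 * u Y) * h2
  choose θ hs hd using key
  exact ⟨θ, hs, fun Y hY i => (hd i Y hY).1, fun Y hY i => (hd i Y hY).2⟩

end ReducedSystem

end Planar

/-! ## Correspondence of the potentials on `ℝ³ ∖ 𝔸` and on the half-plane -/

section Correspondence

theorem dRho_eRho {x : E3} (hx : x ∉ zAxis) : dRho x (eRho x) = 1 := by
  have h := (rho_pos hx).ne'
  have h2 := rho_sq x
  simp [dRho, eRho]
  field_simp
  linarith

theorem dRho_eZ (x : E3) : dRho x eZ = 0 := by simp [dRho, eZ]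

theorem dRho_xi (x : E3) : dRho x (xi x) = 0 := by
  simp [dRho, xi]
  left
  ring

/-- For α = a dρ + b dz, contracting *α with ξ leaves ρ (a dz - b dρ). Having no dϕ part, this form
descends to the half-plane. -/
theorem iXiStar_eq {α : E3 →L[ℝ] ℝ} {x : E3} (hx : x ∉ zAxis) {a b : ℝ}
    (h : ∀ X, α X = a * dRho x X + b * X 2) (Y : E3) :
    iXiStar α x Y = rho x * (a * Y 2 - b * dRho x Y) := by
  have h1 := (rho_pos hx).ne'
  have h2 := rho_sq x
  have e0 : α (EuclideanSpace.single 0 1) = a * (x 0 / rho x) := by simp [h, dRho]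
  have e1 : α (EuclideanSpace.single 1 1) = a * (x 1 / rho x) := by simp [h, dRho]
  have e2 : α (EuclideanSpace.single 2 1) = b := by simp [h, dRho]
  have hd : rho x * dRho x Y = x 0 * Y 0 + x 1 * Y 1 := by
    rw [dRho]
    field_simp
  have : a * (x 0 / rho x) * x 0 + a * (x 1 / rho x) * x 1 = a * rho x := by
    field_simp
    rw [h2]
  rw [iXiStar, Matrix.det_fin_three]
  simp [e0, e1, e2, xi]
  linear_combination Y 2 * this + b * hd

/-- A function with differential `A(ρ, z) dρ + B(ρ, z) dz` is axially symmetric, and `A`, `B` are the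
partial derivatives of its restriction to the half-plane. -/
theorem planar_of_fderiv {f : E3 → ℝ} (hf : ContDiffOn ℝ ∞ f zAxisᶜ) {A B : R2 → ℝ}
    (h : ∀ x ∉ zAxis, ∀ X, fderiv ℝ f x X = A (meridian x) * dRho x X + B (meridian x) * X 2) :
    (∀ α, ∀ x ∉ zAxis, f (rotZ α x) = f x) ∧
    ∀ Y ∈ halfPlane, pd 0 (fun Z => f (planePoint Z)) Y = A Y ∧
      pd 1 (fun Z => f (planePoint Z)) Y = B Y := by
  refine ⟨fun α x hx => axisymmetric_of_fderiv_xi hf (fun x hx => ?_) α hx, fun Y hY => ?_⟩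
  · rw [h x hx, dRho_xi]
    simp [xi]
  · have hY0 : Y 0 ≠ 0 := ne_of_gt hY
    simp only [pd_comp_planePoint hf hY, h _ (planePoint_notMem_zAxis hY), meridian_planePoint hY,
      planePoint_single_zero, planePoint_single_one]
    simp [dRho, rho_planePoint hY, hY0]

theorem fderiv_of_planar {F : R2 → ℝ} (hF : ContDiffOn ℝ ∞ F halfPlane) {A B : R2 → ℝ}
    (h : ∀ Y ∈ halfPlane, pd 0 F Y = A Y ∧ pd 1 F Y = B Y) {x : E3} (hx : x ∉ zAxis) (X : E3) :
    fderiv ℝ (fun y => F (meridian y)) x X =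
      A (meridian x) * dRho x X + B (meridian x) * X 2 := by
  have hm := meridian_mem hx
  rw [fderiv_comp_meridian hx (differentiableAt_of_halfPlane hF hm), (h _ hm).1, (h _ hm).2]

variable {k : ℕ}

/-- The function `u` on the half-plane. -/
noncomputable def planeU (φ : E3 → HSpace k) : R2 → ℝ := planeComp φ (Sum.inl 0)

/-- The functions `χ` on the half-plane. -/
noncomputable def planeChi (φ : E3 → HSpace k) (i : Fin k) : R2 → ℝ :=
  planeComp φ (Sum.inr (Sum.inl i))

/-- The functions `ψ` on the half-plane. -/
noncomputable def planePsi (φ : E3 → HSpace k) (i : Fin k) : R2 → ℝ :=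
  planeComp φ (Sum.inr (Sum.inr i))

/-- The components of `ω` on the half-plane. -/
noncomputable def planeOmega (φ : E3 → HSpace k) : Fin 2 → R2 → ℝ :=
  contactComp (planeComp φ (Sum.inl 1)) (planeChi φ) (planePsi φ)

variable {φ : E3 → HSpace k} (hc : ContDiffOn ℝ ∞ φ zAxisᶜ)
  (hs : ∀ α, ∀ x ∉ zAxis, φ (rotZ α x) = φ x)

include hs in
theorem apply_eq_planeComp {x : E3} (hx : x ∉ zAxis) (a : HIdx k) :
    φ x a = planeComp φ a (meridian x) := by
  rw [eq_comp_meridian hs hx]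
  rfl

include hc hs

theorem dd_eq (a : HIdx k) {x : E3} (hx : x ∉ zAxis) (X : E3) :
    dd (fun p => p a) φ x X = pd 0 (planeComp φ a) (meridian x) * dRho x X
      + pd 1 (planeComp φ a) (meridian x) * X 2 :=
  fderiv_of_axisymmetric (contDiffOn_pi.1 hc a) (fun α x hx => congrFun (hs α x hx) a) hx X

theorem dd_uu {x : E3} (hx : x ∉ zAxis) (X : E3) :
    dd uu φ x X = pd 0 (planeU φ) (meridian x) * dRho x X
      + pd 1 (planeU φ) (meridian x) * X 2 := dd_eq hc hs (Sum.inl 0) hx X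

theorem dd_chi {x : E3} (hx : x ∉ zAxis) (i : Fin k) (X : E3) :
    dd (chi i) φ x X = pd 0 (planeChi φ i) (meridian x) * dRho x X
      + pd 1 (planeChi φ i) (meridian x) * X 2 := dd_eq hc hs (Sum.inr (Sum.inl i)) hx X

theorem dd_psi {x : E3} (hx : x ∉ zAxis) (i : Fin k) (X : E3) :
    dd (psi i) φ x X = pd 0 (planePsi φ i) (meridian x) * dRho x X
      + pd 1 (planePsi φ i) (meridian x) * X 2 := dd_eq hc hs (Sum.inr (Sum.inr i)) hx X

theorem omega_eq {x : E3} (hx : x ∉ zAxis) (X : E3) :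
    omega φ x X = planeOmega φ 0 (meridian x) * dRho x X
      + planeOmega φ 1 (meridian x) * X 2 := by
  have hv : dd vv φ x X = _ := dd_eq hc hs (Sum.inl 1) hx X
  have h1 : ∀ i, chi i (φ x) = planeChi φ i (meridian x) := fun i => apply_eq_planeComp hs hx _
  have h2 : ∀ i, psi i (φ x) = planePsi φ i (meridian x) := fun i => apply_eq_planeComp hs hx _
  simp only [omega, add_apply, smul_apply, sum_apply, sub_apply, smul_eq_mul, hv,
    dd_chi hc hs hx, dd_psi hc hs hx, h1, h2, planeOmega, contactComp]
  simp only [mul_add, add_mul, Finset.mul_sum, Finset.sum_mul]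
  rw [add_add_add_comm, ← Finset.sum_add_distrib]
  congr 1
  · ring
  · refine Finset.sum_congr rfl fun i _ => ?_
    ring

/-- The normal form A dρ + B dz of the prescribed differential serves both directions of the
correspondence; the same holds for θ and λ below. -/
theorem potentialW_rhs {x : E3} (hx : x ∉ zAxis) (X : E3) :
    Real.exp (4 * uu (φ x)) * iXiStar (omega φ x) x X =
      -(meridian x 0 * Real.exp (4 * planeU φ (meridian x)) * planeOmega φ 1 (meridian x))
        * dRho x X
      + meridian x 0 * Real.exp (4 * planeU φ (meridian x)) * planeOmega φ 0 (meridian x) * X 2 := by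
  have hu : uu (φ x) = planeU φ (meridian x) := apply_eq_planeComp hs hx _
  rw [iXiStar_eq hx (omega_eq hc hs hx), hu, show meridian x 0 = rho x from rfl]
  ring

theorem potentialTheta_rhs {x : E3} (hx : x ∉ zAxis) (i : Fin k) (c : ℝ) (X : E3) :
    Real.exp (2 * uu (φ x)) * iXiStar (dd (psi i) φ x) x X - c * dd (chi i) φ x X =
      (-(meridian x 0 * Real.exp (2 * planeU φ (meridian x)) * pd 1 (planePsi φ i) (meridian x))
        - c * pd 0 (planeChi φ i) (meridian x)) * dRho x X
      + (meridian x 0 * Real.exp (2 * planeU φ (meridian x)) * pd 0 (planePsi φ i) (meridian x)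
        - c * pd 1 (planeChi φ i) (meridian x)) * X 2 := by
  have hu : uu (φ x) = planeU φ (meridian x) := apply_eq_planeComp hs hx _
  rw [iXiStar_eq hx (dd_psi hc hs hx i), dd_chi hc hs hx, hu, show meridian x 0 = rho x from rfl]
  ring

theorem potentialLam_rhs {x : E3} (hx : x ∉ zAxis) (X : E3) :
    dd uu φ x X
      + rho x * (dd uu φ x (eRho x) ^ 2 - dd uu φ x eZ ^ 2
          + (1 / 4) * Real.exp (4 * uu (φ x)) * (omega φ x (eRho x) ^ 2 - omega φ x eZ ^ 2)
          + Real.exp (2 * uu (φ x)) *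
            ∑ i, (dd (chi i) φ x (eRho x) ^ 2 - dd (chi i) φ x eZ ^ 2
              + dd (psi i) φ x (eRho x) ^ 2 - dd (psi i) φ x eZ ^ 2)) * dRho x X
      + 2 * rho x * (dd uu φ x (eRho x) * dd uu φ x eZ
          + (1 / 4) * Real.exp (4 * uu (φ x)) * (omega φ x (eRho x) * omega φ x eZ)
          + Real.exp (2 * uu (φ x)) *
            ∑ i, (dd (chi i) φ x (eRho x) * dd (chi i) φ x eZ
              + dd (psi i) φ x (eRho x) * dd (psi i) φ x eZ)) * X 2 =
    (pd 0 (planeU φ) (meridian x)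
        + lamRho (planeU φ) (planeOmega φ) (planeChi φ) (planePsi φ) (meridian x)) * dRho x X
      + (pd 1 (planeU φ) (meridian x)
        + lamZ (planeU φ) (planeOmega φ) (planeChi φ) (planePsi φ) (meridian x)) * X 2 := by
  have hu : uu (φ x) = planeU φ (meridian x) := apply_eq_planeComp hs hx _
  have z1 : eRho x 2 = 0 := by simp [eRho]
  have z2 : eZ 2 = 1 := by simp [eZ]
  have g : ∑ i, (pd 0 (planeChi φ i) (meridian x) ^ 2 - pd 1 (planeChi φ i) (meridian x) ^ 2
      + pd 0 (planePsi φ i) (meridian x) ^ 2 - pd 1 (planePsi φ i) (meridian x) ^ 2) =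
      gram (planeChi φ) (planePsi φ) 0 0 (meridian x)
        - gram (planeChi φ) (planePsi φ) 1 1 (meridian x) := by
    rw [gram, gram, ← Finset.sum_sub_distrib]
    refine Finset.sum_congr rfl fun i _ => ?_
    ring
  simp only [dd_uu hc hs hx, dd_chi hc hs hx, dd_psi hc hs hx, omega_eq hc hs hx, dRho_eRho hx,
    dRho_eZ, z1, z2, mul_one, mul_zero, add_zero, zero_add, hu, g, lamRho, lamZ,
    show meridian x 0 = rho x from rfl, gram]
  ring

theorem isPotentialW_of_planar {W : R2 → ℝ} (hW : IsPlanarW (planeU φ) (planeOmega φ) W) :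
    IsPotentialW φ fun x => W (meridian x) :=
  ⟨contDiffOn_comp_meridian hW.smooth, fun x hx X => by
    rw [potentialW_rhs hc hs hx]
    exact fderiv_of_planar hW.smooth (fun Y hY => ⟨hW.pd_zero Y hY, hW.pd_one Y hY⟩) hx X⟩

theorem isPotentialLam_of_planar {Λ : R2 → ℝ}
    (hΛ : IsPlanarLam (planeU φ) (planeOmega φ) (planeChi φ) (planePsi φ) Λ) :
    IsPotentialLam φ fun x => Λ (meridian x) :=
  ⟨contDiffOn_comp_meridian hΛ.smooth, fun x hx X => by
    rw [potentialLam_rhs hc hs hx]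
    exact fderiv_of_planar hΛ.smooth (fun Y hY => ⟨hΛ.pd_zero Y hY, hΛ.pd_one Y hY⟩) hx X⟩

/-- This direction, and its analogues for λ and θ, is what allows the theorem to speak of every
choice of potentials and not only of those lifted from the half-plane. -/
theorem planarW_of_isPotentialW {w : E3 → ℝ} (hw : IsPotentialW φ w) :
    (∀ α, ∀ x ∉ zAxis, w (rotZ α x) = w x) ∧
      IsPlanarW (planeU φ) (planeOmega φ) fun Y => w (planePoint Y) := by
  obtain ⟨h1, h2⟩ := planar_of_fderiv hw.1 (A := fun Y =>
    -(Y 0 * Real.exp (4 * planeU φ Y) * planeOmega φ 1 Y)) (B := fun Y =>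
    Y 0 * Real.exp (4 * planeU φ Y) * planeOmega φ 0 Y) fun x hx X => by
      rw [hw.2 x hx, potentialW_rhs hc hs hx]
  exact ⟨h1, contDiffOn_comp_planePoint hw.1, fun Y hY => (h2 Y hY).1, fun Y hY => (h2 Y hY).2⟩

theorem planarLam_of_isPotentialLam {lam : E3 → ℝ} (hl : IsPotentialLam φ lam) :
    (∀ α, ∀ x ∉ zAxis, lam (rotZ α x) = lam x) ∧
      IsPlanarLam (planeU φ) (planeOmega φ) (planeChi φ) (planePsi φ)
        fun Y => lam (planePoint Y) := by
  obtain ⟨h1, h2⟩ := planar_of_fderiv hl.1 (A := fun Y => pd 0 (planeU φ) Y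
    + lamRho (planeU φ) (planeOmega φ) (planeChi φ) (planePsi φ) Y) (B := fun Y =>
    pd 1 (planeU φ) Y + lamZ (planeU φ) (planeOmega φ) (planeChi φ) (planePsi φ) Y)
    fun x hx X => by
      rw [hl.2 x hx, potentialLam_rhs hc hs hx]
  exact ⟨h1, contDiffOn_comp_planePoint hl.1, fun Y hY => (h2 Y hY).1, fun Y hY => (h2 Y hY).2⟩

theorem isPotentialTheta_of_planar {w : E3 → ℝ} (hw : IsPotentialW φ w) {θ : Fin k → R2 → ℝ}
    (hθ : IsPlanarTheta (planeU φ) (planeChi φ) (planePsi φ) (fun Y => w (planePoint Y)) θ) :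
    IsPotentialTheta φ w fun i x => θ i (meridian x) := fun i =>
  ⟨contDiffOn_comp_meridian (hθ.smooth i), fun x hx X => by
    rw [potentialTheta_rhs hc hs hx, eq_comp_meridian (planarW_of_isPotentialW hc hs hw).1 hx]
    exact fderiv_of_planar (hθ.smooth i)
      (fun Y hY => ⟨hθ.pd_zero Y hY i, hθ.pd_one Y hY i⟩) hx X⟩

theorem planarTheta_of_isPotentialTheta {w : E3 → ℝ} (hw : IsPotentialW φ w) {θ : Fin k → E3 → ℝ}
    (hθ : IsPotentialTheta φ w θ) :
    (∀ i, ∀ α, ∀ x ∉ zAxis, θ i (rotZ α x) = θ i x) ∧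
      IsPlanarTheta (planeU φ) (planeChi φ) (planePsi φ) (fun Y => w (planePoint Y))
        fun i Y => θ i (planePoint Y) := by
  have h := fun i => planar_of_fderiv (hθ i).1 (A := fun Y =>
    -(Y 0 * Real.exp (2 * planeU φ Y) * pd 1 (planePsi φ i) Y)
      - w (planePoint Y) * pd 0 (planeChi φ i) Y) (B := fun Y =>
    Y 0 * Real.exp (2 * planeU φ Y) * pd 0 (planePsi φ i) Y
      - w (planePoint Y) * pd 1 (planeChi φ i) Y) fun x hx X => by
      rw [(hθ i).2 x hx, potentialTheta_rhs hc hs hx,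
        eq_comp_meridian (planarW_of_isPotentialW hc hs hw).1 hx]
  exact ⟨fun i => (h i).1, fun i => contDiffOn_comp_planePoint (hθ i).1,
    fun Y hY i => ((h i).2 Y hY).1, fun Y hY i => ((h i).2 Y hY).2⟩

end Correspondence

/-! ## The metric in the coordinates `(t, ϕ, ρ, z)` -/

/-- The projection `(t, ϕ, ρ, z) ↦ (ρ, z)`. -/
def rzProj : R4 →L[ℝ] R2 :=
  ContinuousLinearMap.pi fun j : Fin 2 => ContinuousLinearMap.proj (R := ℝ) (![2, 3] j)

/-- The domain `ρ > 0` of the coordinates `(t, ϕ, ρ, z)`. -/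
def coordDomain : Set R4 := {X | 0 < X 2}

theorem isOpen_coordDomain : IsOpen coordDomain := isOpen_lt continuous_const (continuous_apply 2)

theorem rzProj_apply (X : R4) : rzProj X = ![X 2, X 3] := by
  ext j
  fin_cases j <;> rfl

@[simp] theorem rzProj_apply_zero (X : R4) : rzProj X 0 = X 2 := rfl

@[simp] theorem rzProj_apply_one (X : R4) : rzProj X 1 = X 3 := rfl

theorem rzProj_mem {X : R4} (hX : X ∈ coordDomain) : rzProj X ∈ halfPlane := hX

theorem contDiffOn_comp_rzProj {f : R2 → ℝ} (hf : ContDiffOn ℝ ∞ f halfPlane) :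
    ContDiffOn ℝ ∞ (fun X => f (rzProj X)) coordDomain :=
  hf.comp rzProj.contDiff.contDiffOn fun _ hX => rzProj_mem hX

/-- The partial derivatives of a function of `(ρ, z)` with respect to `t`, `ϕ`, `ρ`, `z`. -/
noncomputable def pdRZ (i : Fin 4) (f : R2 → ℝ) (Y : R2) : ℝ := ![0, 0, pd 0 f Y, pd 1 f Y] i

theorem pd_comp_rzProj {f : R2 → ℝ} {X : R4} (hf : DifferentiableAt ℝ f (rzProj X)) (i : Fin 4) :
    pd i (fun Z => f (rzProj Z)) X = pdRZ i f (rzProj X) := by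
  rw [pd, fderiv_fun_comp X hf rzProj.differentiableAt, rzProj.fderiv,
    ContinuousLinearMap.comp_apply, rzProj_apply, fderiv_eq_sum_pd]
  fin_cases i <;> simp [pdRZ]

theorem pd_of_eqOn_rzProj {F : R4 → ℝ} {f : R2 → ℝ} (h : ∀ X ∈ coordDomain, F X = f (rzProj X))
    {X : R4} (hX : X ∈ coordDomain) (hf : DifferentiableAt ℝ f (rzProj X)) (i : Fin 4) :
    pd i F X = pdRZ i f (rzProj X) := by
  rw [pd_congr_of_eqOn isOpen_coordDomain (f' := fun Z => f (rzProj Z)) h hX, pd_comp_rzProj hf]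

section Metric

/-- The component `g_tt`. -/
noncomputable def gtt (u W : R2 → ℝ) (Y : R2) : ℝ :=
  -(Y 0 ^ 2 * Real.exp (2 * u Y)) + Real.exp (-2 * u Y) * (W Y ^ 2)

/-- The component `g_tϕ`. -/
noncomputable def gtp (u W : R2 → ℝ) (Y : R2) : ℝ := -(Real.exp (-2 * u Y) * W Y)

/-- The components of the metric in the coordinates `(t, ϕ, ρ, z)`. -/
noncomputable def coordMetric (u W Λ : R2 → ℝ) (X : R4) : Matrix (Fin 4) (Fin 4) ℝ :=
  !![gtt u W (rzProj X), gtp u W (rzProj X), 0, 0;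
    gtp u W (rzProj X), Real.exp (-2 * u (rzProj X)), 0, 0;
    0, 0, Real.exp (2 * Λ (rzProj X)), 0;
    0, 0, 0, Real.exp (2 * Λ (rzProj X))]

/-- The components of the inverse metric. -/
noncomputable def coordInv (u W Λ : R2 → ℝ) (Y : R2) : Matrix (Fin 4) (Fin 4) ℝ :=
  !![-(Real.exp (-2 * u Y) / Y 0 ^ 2), -(W Y * Real.exp (-2 * u Y) / Y 0 ^ 2), 0, 0;
    -(W Y * Real.exp (-2 * u Y) / Y 0 ^ 2),
      Real.exp (2 * u Y) - W Y ^ 2 * Real.exp (-2 * u Y) / Y 0 ^ 2, 0, 0;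
    0, 0, Real.exp (-2 * Λ Y), 0;
    0, 0, 0, Real.exp (-2 * Λ Y)]

/-- The derivatives of the components of the metric with respect to `ρ`. -/
noncomputable def coordMetricRho (u : R2 → ℝ) (o : Fin 2 → R2 → ℝ) (W Λ : R2 → ℝ) (Y : R2) :
    Matrix (Fin 4) (Fin 4) ℝ :=
  let P := -(2 * Y 0 * Real.exp (2 * u Y)) - 2 * Y 0 ^ 2 * pd 0 u Y * Real.exp (2 * u Y)
    - 2 * W Y * Y 0 * Real.exp (2 * u Y) * o 1 Y - 2 * pd 0 u Y * W Y ^ 2 * Real.exp (-2 * u Y)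
  let Q := Y 0 * Real.exp (2 * u Y) * o 1 Y + 2 * pd 0 u Y * W Y * Real.exp (-2 * u Y)
  !![P, Q, 0, 0;
    Q, -(2 * pd 0 u Y * Real.exp (-2 * u Y)), 0, 0;
    0, 0, 2 * pd 0 Λ Y * Real.exp (2 * Λ Y), 0;
    0, 0, 0, 2 * pd 0 Λ Y * Real.exp (2 * Λ Y)]

/-- The derivatives of the components of the metric with respect to `z`. -/
noncomputable def coordMetricZ (u : R2 → ℝ) (o : Fin 2 → R2 → ℝ) (W Λ : R2 → ℝ) (Y : R2) :
    Matrix (Fin 4) (Fin 4) ℝ :=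
  let P := -(2 * Y 0 ^ 2 * pd 1 u Y * Real.exp (2 * u Y))
    + 2 * W Y * Y 0 * Real.exp (2 * u Y) * o 0 Y - 2 * pd 1 u Y * W Y ^ 2 * Real.exp (-2 * u Y)
  let Q := -(Y 0 * Real.exp (2 * u Y) * o 0 Y) + 2 * pd 1 u Y * W Y * Real.exp (-2 * u Y)
  !![P, Q, 0, 0;
    Q, -(2 * pd 1 u Y * Real.exp (-2 * u Y)), 0, 0;
    0, 0, 2 * pd 1 Λ Y * Real.exp (2 * Λ Y), 0;
    0, 0, 0, 2 * pd 1 Λ Y * Real.exp (2 * Λ Y)]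

/-- The Christoffel symbols in the coordinates `(t, ϕ, ρ, z)`. -/
noncomputable def coordGamma (u : R2 → ℝ) (o : Fin 2 → R2 → ℝ) (W Λ : R2 → ℝ)
    (a b c : Fin 4) (Y : R2) : ℝ :=
  let β₀ := -(1 / 2 * o 1 Y * (Y 0)⁻¹)
  let β₁ := 1 / 2 * o 0 Y * (Y 0)⁻¹
  let α₀ := (Y 0)⁻¹ + pd 0 u Y - W Y * β₀
  let α₁ := pd 1 u Y - W Y * β₁
  let γ₀ := W Y * α₀ + 1 / 2 * (Y 0 * Real.exp (4 * u Y) * o 1 Y + 2 * pd 0 u Y * W Y)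
  let γ₁ := W Y * α₁ + 1 / 2 * (-(Y 0 * Real.exp (4 * u Y) * o 0 Y) + 2 * pd 1 u Y * W Y)
  let δ₀ := W Y * β₀ - pd 0 u Y
  let δ₁ := W Y * β₁ - pd 1 u Y
  let G₀ := fun i j : Fin 4 => -(1 / 2 * Real.exp (-2 * Λ Y) * coordMetricRho u o W Λ Y i j)
  let G₁ := fun i j : Fin 4 => -(1 / 2 * Real.exp (-2 * Λ Y) * coordMetricZ u o W Λ Y i j)
  (![!![0, 0, α₀, α₁; 0, 0, β₀, β₁; α₀, β₀, 0, 0; α₁, β₁, 0, 0],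
    !![0, 0, γ₀, γ₁; 0, 0, δ₀, δ₁; γ₀, δ₀, 0, 0; γ₁, δ₁, 0, 0],
    !![G₀ 0 0, G₀ 0 1, 0, 0; G₀ 1 0, G₀ 1 1, 0, 0; 0, 0, pd 0 Λ Y, pd 1 Λ Y;
      0, 0, pd 1 Λ Y, -pd 0 Λ Y],
    !![G₁ 0 0, G₁ 0 1, 0, 0; G₁ 1 0, G₁ 1 1, 0, 0; 0, 0, -pd 1 Λ Y, pd 0 Λ Y;
      0, 0, pd 0 Λ Y, pd 1 Λ Y]] : Fin 4 → Matrix (Fin 4) (Fin 4) ℝ) a b c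

theorem exp_neg_two_mul (a : ℝ) : Real.exp (-2 * a) = (Real.exp (2 * a))⁻¹ := by
  rw [← Real.exp_neg]
  ring_nf

variable {u W Λ : R2 → ℝ} {o : Fin 2 → R2 → ℝ} (hu : ContDiffOn ℝ ∞ u halfPlane)
  (hW : IsPlanarW u o W) (hΛ : ContDiffOn ℝ ∞ Λ halfPlane) {X : R4} (hX : X ∈ coordDomain)

include hX in
theorem coordMetric_mul_coordInv : coordMetric u W Λ X * coordInv u W Λ (rzProj X) = 1 := by
  have hY0 : X 2 ≠ 0 := ne_of_gt hX
  ext i j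
  fin_cases i <;> fin_cases j <;>
    simp [coordMetric, coordInv, Matrix.mul_apply, Fin.sum_univ_four, gtt, gtp, -neg_mul,
      exp_neg_two_mul] <;> field_simp <;> ring

include hX in
theorem coordMetric_inv : (coordMetric u W Λ X)⁻¹ = coordInv u W Λ (rzProj X) :=
  Matrix.inv_eq_right_inv (coordMetric_mul_coordInv hX)

include hu hW hΛ hX in
-- The derivatives of W are replaced by components of ω, so that afterwards W occurs
-- undifferentiated. The derivatives of Λ stay symbolic until the Ricci tensor is computed.
theorem pd_coordMetric (i a b : Fin 4) : pd i (fun Z => coordMetric u W Λ Z a b) X =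
    ![0, 0, coordMetricRho u o W Λ (rzProj X) a b, coordMetricZ u o W Λ (rzProj X) a b] i := by
  have hY := rzProj_mem hX
  set Y := rzProj X with hYdef
  have du := differentiableAt_of_halfPlane hu hY
  have dW := differentiableAt_of_halfPlane hW.smooth hY
  have dΛ := differentiableAt_of_halfPlane hΛ hY
  have key : ∀ f : R2 → ℝ, DifferentiableAt ℝ f Y → ∀ r s : ℝ, pd 0 f Y = r → pd 1 f Y = s →
      pd i (fun Z => f (rzProj Z)) X = ![0, 0, r, s] i := by
    intro f hf r s hr hs
    rw [pd_comp_rzProj hf, ← hr, ← hs]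
    rfl
  have w0 := hW.pd_zero Y hY
  have w1 := hW.pd_one Y hY
  have hz := key (fun _ => 0) (differentiableAt_const _) 0 0 (pd_const _ _) (pd_const _ _)
  have hE : ∀ l, pd l (fun Z => Real.exp (2 * Λ Z)) Y = 2 * pd l Λ Y * Real.exp (2 * Λ Y) :=
    fun l => by
      rw [pd_exp_mul dΛ]
      ring
  have hS : ∀ l, pd l (fun Z => Real.exp (-2 * u Z)) Y = -(2 * pd l u Y * Real.exp (-2 * u Y)) :=
    fun l => by
      rw [pd_exp_mul du]
      ring
  have hΛ' := key (fun Z => Real.exp (2 * Λ Z)) (by fun_prop) _ _ (hE 0) (hE 1)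
  have hS' := key (fun Z => Real.exp (-2 * u Z)) (by fun_prop) _ _ (hS 0) (hS 1)
  have hQ' := key (gtp u W) (by unfold gtp; fun_prop) (coordMetricRho u o W Λ Y 0 1)
    (coordMetricZ u o W Λ Y 0 1)
    (by
      unfold gtp
      simp (disch := fun_prop) only [pd_neg, pd_mul, pd_exp_mul, w0]
      simp [exp_four_mul, coordMetricRho, exp_neg_two_mul, -neg_mul]
      field_simp)
    (by
      unfold gtp
      simp (disch := fun_prop) only [pd_neg, pd_mul, pd_exp_mul, w1]
      simp [exp_four_mul, coordMetricZ, exp_neg_two_mul, -neg_mul]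
      field_simp)
  have hP' := key (gtt u W) (by unfold gtt; fun_prop) (coordMetricRho u o W Λ Y 0 0)
    (coordMetricZ u o W Λ Y 0 0)
    (by
      unfold gtt
      simp (disch := fun_prop) only [pd_neg, pd_add, pd_mul, pd_exp_mul, pd_pow_two, pd_coord, w0]
      simp [exp_four_mul, coordMetricRho, exp_neg_two_mul, -neg_mul]
      field_simp
      ring)
    (by
      unfold gtt
      simp (disch := fun_prop) only [pd_neg, pd_add, pd_mul, pd_exp_mul, pd_pow_two, pd_coord, w1]
      simp [exp_four_mul, coordMetricZ, exp_neg_two_mul, -neg_mul]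
      field_simp
      ring)
  fin_cases a <;> fin_cases b <;> first
    | exact hz | exact hΛ' | exact hS' | exact hQ' | exact hP'

set_option maxHeartbeats 4000000 in
include hu hW hΛ hX in
theorem christoffel_coordMetric (a b c : Fin 4) :
    christoffel (coordMetric u W Λ) a b c X = coordGamma u o W Λ a b c (rzProj X) := by
  have hY0 : X 2 ≠ 0 := ne_of_gt hX
  simp only [christoffel, coordMetric_inv hX, pd_coordMetric hu hW hΛ hX, Fin.sum_univ_four]
  have hY0' : rzProj X 0 ≠ 0 := hY0
  generalize rzProj X = Y at *
  have hE := (Real.exp_pos (2 * u Y)).ne'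
  have hL := (Real.exp_pos (2 * Λ Y)).ne'
  fin_cases a <;> fin_cases b <;> fin_cases c <;>
    simp [coordInv, coordMetricRho, coordMetricZ, coordGamma, exp_four_mul, exp_neg_two_mul,
      -neg_mul] <;> field_simp <;> ring

end Metric

/-! ## The Ricci tensor -/

section Ricci

variable {k : ℕ} {u W Λ : R2 → ℝ} {o : Fin 2 → R2 → ℝ} {χ ψ : Fin k → R2 → ℝ}
  (S : ReducedSystem u o χ ψ) (hW : IsPlanarW u o W) (hΛ : IsPlanarLam u o χ ψ Λ)

set_option maxHeartbeats 4000000 in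
include S hW hΛ in
theorem differentiableAt_coordGamma {Y : R2} (hY : Y ∈ halfPlane) (a b c : Fin 4) :
    DifferentiableAt ℝ (coordGamma u o W Λ a b c) Y := by
  have hY0 : Y 0 ≠ 0 := ne_of_gt hY
  have d0 := differentiableAt_of_halfPlane S.smooth_u hY
  have d1 := differentiableAt_pd S.smooth_u hY 0
  have d2 := differentiableAt_pd S.smooth_u hY 1
  have d3 := differentiableAt_of_halfPlane (S.smooth_o 0) hY
  have d4 := differentiableAt_of_halfPlane (S.smooth_o 1) hY
  have d5 := differentiableAt_of_halfPlane hW.smooth hY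
  have d6 := differentiableAt_of_halfPlane hΛ.smooth hY
  have d7 := differentiableAt_pd hΛ.smooth hY 0
  have d8 := differentiableAt_pd hΛ.smooth hY 1
  unfold coordGamma coordMetricRho coordMetricZ
  fin_cases a <;> fin_cases b <;> fin_cases c <;>
    simp [-neg_mul] <;> fun_prop (disch := assumption)

/-- The contraction `Γ^a_{ba}` of the Christoffel symbols. -/
noncomputable def traceGamma (Λ : R2 → ℝ) (b : Fin 4) (Y : R2) : ℝ :=
  ![0, 0, (Y 0)⁻¹ + 2 * pd 0 Λ Y, 2 * pd 1 Λ Y] b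

/-- The trace is the logarithmic derivative of |det g|^{1/2} = ρ e^{2Λ}. -/
theorem sum_coordGamma (b : Fin 4) (Y : R2) :
    ∑ a, coordGamma u o W Λ a b a Y = traceGamma Λ b Y := by
  fin_cases b <;> simp [coordGamma, traceGamma, Fin.sum_univ_four] <;> ring

include S hW hΛ in
-- Derivatives in t and ϕ vanish, so only a = 2, 3 survive in ∂_a Γ^a_{bc}. The trace Γ^a_{ba} is
-- summed before it is differentiated, which keeps the expressions small.
theorem ricci_eq {X : R4} (hX : X ∈ coordDomain) (b c : Fin 4) :
    ricci (coordMetric u W Λ) b c X =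
      pd 0 (coordGamma u o W Λ 2 b c) (rzProj X) + pd 1 (coordGamma u o W Λ 3 b c) (rzProj X)
      - pdRZ c (traceGamma Λ b) (rzProj X)
      + ∑ a, ∑ d, (coordGamma u o W Λ a a d (rzProj X) * coordGamma u o W Λ d b c (rzProj X)
        - coordGamma u o W Λ a c d (rzProj X) * coordGamma u o W Λ d b a (rzProj X)) := by
  have hY := rzProj_mem hX
  have hchr := fun (Z : R4) (hZ : Z ∈ coordDomain) (a b c : Fin 4) =>
    christoffel_coordMetric S.smooth_u hW hΛ.smooth hZ a b c
  have hd := differentiableAt_coordGamma S hW hΛ hY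
  have hpd : ∀ i a b c, pd i (christoffel (coordMetric u W Λ) a b c) X =
      pdRZ i (coordGamma u o W Λ a b c) (rzProj X) := fun i a b c =>
    pd_of_eqOn_rzProj (fun Z hZ => hchr Z hZ a b c) hX (hd a b c) i
  have htr : ∑ a, pdRZ c (coordGamma u o W Λ a b a) (rzProj X) =
      pdRZ c (traceGamma Λ b) (rzProj X) := by
    have hs : ∀ l, ∑ a, pd l (coordGamma u o W Λ a b a) (rzProj X) =
        pd l (traceGamma Λ b) (rzProj X) := fun l => by
      rw [← pd_sum l fun a _ => hd a b a]
      congr 1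
      exact funext fun Z => sum_coordGamma b Z
    fin_cases c
    · simp [pdRZ]
    · simp [pdRZ]
    · exact hs 0
    · exact hs 1
  simp only [ricci, hchr X hX, hpd]
  rw [Finset.sum_add_distrib, Finset.sum_sub_distrib, htr]
  congr 2
  simp [Fin.sum_univ_four, pdRZ]

/-- The form of the Ricci tensor of a metric that solves the field equations. -/
noncomputable def ricciForm (N E r w s₀₀ s₀₁ s₁₁ κ : ℝ) : Matrix (Fin 4) (Fin 4) ℝ :=
  !![N * (r ^ 2 * E ^ 2 * (s₀₀ + s₁₁) - w * r * E * κ + w ^ 2 * (s₀₀ + s₁₁)),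
      N * (1 / 2 * r * E * κ - w * (s₀₀ + s₁₁)), 0, 0;
    N * (1 / 2 * r * E * κ - w * (s₀₀ + s₁₁)), N * (s₀₀ + s₁₁), 0, 0;
    0, 0, E * (s₀₀ - s₁₁), 2 * E * s₀₁;
    0, 0, 2 * E * s₀₁, -(E * (s₀₀ - s₁₁))]

/-- The Ricci tensor of a metric that solves the field equations. -/
noncomputable def coordRicci (u : R2 → ℝ) (o : Fin 2 → R2 → ℝ) (χ ψ : Fin k → R2 → ℝ)
    (W Λ : R2 → ℝ) (Y : R2) : Matrix (Fin 4) (Fin 4) ℝ :=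
  ricciForm (Real.exp (-2 * Λ Y)) (Real.exp (2 * u Y)) (Y 0) (W Y) (gram χ ψ 0 0 Y)
    (gram χ ψ 0 1 Y) (gram χ ψ 1 1 Y) (pd 1 (o 0) Y - pd 0 (o 1) Y)

end Ricci

section Ricci

variable {k : ℕ} {u W Λ : R2 → ℝ} {o : Fin 2 → R2 → ℝ} {χ ψ : Fin k → R2 → ℝ}
  (S : ReducedSystem u o χ ψ) (hW : IsPlanarW u o W) (hΛ : IsPlanarLam u o χ ψ Λ)

set_option maxHeartbeats 4000000 in
include S hW hΛ in
theorem ricci_coordMetric {X : R4} (hX : X ∈ coordDomain) (b c : Fin 4) :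
    ricci (coordMetric u W Λ) b c X = coordRicci u o χ ψ W Λ (rzProj X) b c := by
  have hY := rzProj_mem hX
  rw [ricci_eq S hW hΛ hX]
  generalize rzProj X = Y at *
  have hY0 : Y 0 ≠ 0 := ne_of_gt hY
  have d0 := differentiableAt_of_halfPlane S.smooth_u hY
  have d1 := differentiableAt_pd S.smooth_u hY 0
  have d2 := differentiableAt_pd S.smooth_u hY 1
  have d3 := differentiableAt_of_halfPlane (S.smooth_o 0) hY
  have d4 := differentiableAt_of_halfPlane (S.smooth_o 1) hY
  have d5 := differentiableAt_of_halfPlane hW.smooth hY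
  have d6 := differentiableAt_of_halfPlane hΛ.smooth hY
  have d7 := differentiableAt_pd hΛ.smooth hY 0
  have d8 := differentiableAt_pd hΛ.smooth hY 1
  have w0 := hW.pd_zero Y hY
  have w1 := hW.pd_one Y hY
  have l0 := hΛ.pd_zero Y hY
  have l1 := hΛ.pd_one Y hY
  have l01 := pd_comm isOpen_halfPlane hΛ.smooth hY 1 0
  have l2 := S.pd_zero_lamRho_add hY
  have l00 : pd 0 (pd 0 Λ) Y = pd 0 (pd 0 u) Y + pd 0 (lamRho u o χ ψ) Y := by
    rw [pd_congr_of_eqOn isOpen_halfPlane hΛ.pd_zero hY,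
      pd_add 0 d1 (differentiableAt_of_halfPlane S.contDiffOn_lamRho hY)]
  have l11 : pd 1 (pd 1 Λ) Y = pd 1 (pd 1 u) Y + pd 1 (lamZ u o χ ψ) Y := by
    rw [pd_congr_of_eqOn isOpen_halfPlane hΛ.pd_one hY,
      pd_add 1 d2 (differentiableAt_of_halfPlane S.contDiffOn_lamZ hY)]
  have hu := S.eq_u' hY
  have hE := (Real.exp_pos (2 * u Y)).ne'
  simp only [lamRho, lamZ, exp_four_mul] at l0 l1
  field_simp at hu
  fin_cases b <;> fin_cases c <;> unfold coordGamma coordMetricRho coordMetricZ traceGamma <;>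
    simp [coordRicci, ricciForm, Fin.sum_univ_four, pdRZ, -neg_mul] <;>
    (try simp (disch := first | assumption | fun_prop) only [pd_neg, pd_add, pd_sub, pd_mul, pd_inv,
      pd_exp_mul, pd_pow_two, pd_coord, w0, w1, pd_const]) <;>
    (try simp [exp_neg_two_mul, exp_four_mul, -neg_mul]) <;> field_simp
  -- The four entries of the (t, ϕ) block require only the equation for u.
  · linear_combination (2 * (Y 0 ^ 2 * Real.exp (2 * u Y) ^ 2 + W Y ^ 2)) * hu
  · linear_combination (-2 * W Y) * hu
  · linear_combination (-2 * W Y) * hu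
  · linear_combination 2 * hu
  -- In the (ρ, z) block the sum `l00 + l11 + l2` is the flat Laplacian of Λ. The formula for Λ_ρ
  -- enters the two diagonal entries with opposite signs; the off-diagonal entries use Λ_z.
  · linear_combination (4 * Y 0) * l0 - (4 * Y 0 ^ 2) * (l00 + l11 + l2) - (2 * Y 0) * hu
  · linear_combination (4 * Y 0) * l1 - (4 * Y 0 ^ 2) * l01
  · linear_combination (4 * Y 0) * l1 + (4 * Y 0 ^ 2) * l01
  · linear_combination (-4 * Y 0) * l0 - (4 * Y 0 ^ 2) * (l00 + l11 + l2) - (2 * Y 0) * hu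

include S hW hΛ in
-- The (t, ϕ) and (ρ, z) blocks of `ricciForm` are each trace-free with respect to the metric, as
-- befits the energy-momentum tensor of a two-form in dimension four.
theorem scalarCurvature_coordMetric {X : R4} (hX : X ∈ coordDomain) :
    scalarCurvature (coordMetric u W Λ) X = 0 := by
  have hY0 : rzProj X 0 ≠ 0 := ne_of_gt hX
  simp only [scalarCurvature, ricci_coordMetric S hW hΛ hX, coordMetric_inv hX, Fin.sum_univ_four]
  generalize rzProj X = Y at *
  simp [coordInv, coordRicci, ricciForm, exp_neg_two_mul, -neg_mul]
  field_simp
  ring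

end Ricci

/-! ## The Yang-Mills field -/

theorem det_vandermonde_four (v : Fin 4 → ℝ) : (Matrix.vandermonde v).det =
    (v 1 - v 0) * (v 2 - v 0) * (v 3 - v 0) * (v 2 - v 1) * (v 3 - v 1) * (v 3 - v 2) := by
  have e0 : Finset.Ioi (0 : Fin 4) = {1, 2, 3} := by decide
  have e1 : Finset.Ioi (1 : Fin 4) = {2, 3} := by decide
  have e2 : Finset.Ioi (2 : Fin 4) = {3} := by decide
  have e3 : Finset.Ioi (3 : Fin 4) = ∅ := by decide
  rw [Matrix.det_vandermonde, Fin.prod_univ_four, e0, e1, e2, e3, Finset.prod_insert (by decide),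
    Finset.prod_pair (by decide), Finset.prod_pair (by decide), Finset.prod_singleton,
    Finset.prod_empty]
  ring

/-- Multiplying the matrix of rows e_a, e_b, e_c, e_d by the Vandermonde matrix with nodes 0, 1, 2,
3, whose determinant is 12, gives the Vandermonde matrix with nodes a, b, c, d. The symbol becomes a
polynomial that evaluates by arithmetic. -/
theorem leviCivita_eq (a b c d : Fin 4) :
    leviCivita a b c d = ((b : ℝ) - a) * (c - a) * (d - a) * (c - b) * (d - b) * (d - c) / 12 := by
  let v : Fin 4 → ℝ := fun i => (i : ℝ)
  have h1 : (Matrix.of ![Pi.single a 1, Pi.single b 1, Pi.single c 1,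
      (Pi.single d 1 : Fin 4 → ℝ)]) * Matrix.vandermonde v =
      Matrix.vandermonde (v ∘ ![a, b, c, d]) := by
    ext i j
    fin_cases i <;> simp [Matrix.mul_apply, Matrix.vandermonde, Pi.single_apply]
  have h2 := congrArg Matrix.det h1
  rw [Matrix.det_mul, det_vandermonde_four, det_vandermonde_four] at h2
  rw [leviCivita, eq_div_iff (by norm_num)]
  refine Eq.trans ?_ h2
  congr 1
  norm_num [v]

section Field

variable {k : ℕ} {u W Λ : R2 → ℝ} {o : Fin 2 → R2 → ℝ} {χ ψ θ : Fin k → R2 → ℝ}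

/-- The one-form `-(χ dϕ + θ dt)` in the coordinates `(t, ϕ, ρ, z)`. -/
noncomputable def coordForm (χ θ : Fin k → R2 → ℝ) (i : Fin k) (X : R4) : R4 :=
  ![-θ i (rzProj X), -χ i (rzProj X), 0, 0]

/-- A two-form in the coordinates `(t, ϕ, ρ, z)`. -/
noncomputable def coordTwoForm (u W : R2 → ℝ) (c p : R2 → ℝ) (Y : R2) :
    Matrix (Fin 4) (Fin 4) ℝ :=
  let p₀ := -(Y 0 * Real.exp (2 * u Y) * pd 1 p Y) - W Y * pd 0 c Y
  let p₁ := Y 0 * Real.exp (2 * u Y) * pd 0 p Y - W Y * pd 1 c Y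
  !![0, 0, p₀, p₁; 0, 0, pd 0 c Y, pd 1 c Y; -p₀, -pd 0 c Y, 0, 0; -p₁, -pd 1 c Y, 0, 0]

/-- θ enters only through dθ, which is eliminated by its definition, so F is expressed by χ, ψ and
W. In this form the duality (χ, ψ) ↦ (-ψ, χ) becomes visible. -/
theorem fieldStrength_coordForm (hχ : ∀ i, ContDiffOn ℝ ∞ (χ i) halfPlane)
    (hθ : IsPlanarTheta u χ ψ W θ) {X : R4} (hX : X ∈ coordDomain) (i : Fin k) (a b : Fin 4) :
    fieldStrength (coordForm χ θ i) a b X = coordTwoForm u W (χ i) (ψ i) (rzProj X) a b := by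
  have hY := rzProj_mem hX
  have dc := differentiableAt_of_halfPlane (hχ i) hY
  have dt := differentiableAt_of_halfPlane (hθ.smooth i) hY
  have t0 := hθ.pd_zero _ hY i
  have t1 := hθ.pd_one _ hY i
  have h0 : ∀ l, pd l (fun Z => coordForm χ θ i Z 0) X = -pdRZ l (θ i) (rzProj X) := fun l => by
    rw [← pd_comp_rzProj dt, ← pd_neg]
    rfl
  have h1 : ∀ l, pd l (fun Z => coordForm χ θ i Z 1) X = -pdRZ l (χ i) (rzProj X) := fun l => by
    rw [← pd_comp_rzProj dc, ← pd_neg]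
    rfl
  have h2 : ∀ l, pd l (fun Z => coordForm χ θ i Z 2) X = 0 := fun l => pd_const l 0
  have h3 : ∀ l, pd l (fun Z => coordForm χ θ i Z 3) X = 0 := fun l => pd_const l 0
  fin_cases a <;> fin_cases b <;>
    simp [fieldStrength, h0, h1, h2, h3, pdRZ, coordTwoForm, t0, t1] <;> ring_nf

/-- The (t, ϕ) block has determinant -ρ², free of u and W. -/
theorem det_coordMetric {X : R4} (hX : X ∈ coordDomain) :
    √|(coordMetric u W Λ X).det| = X 2 * Real.exp (2 * Λ (rzProj X)) := by
  have hX2 : 0 < X 2 := hX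
  have : (coordMetric u W Λ X).det = -(X 2 * Real.exp (2 * Λ (rzProj X))) ^ 2 := by
    simp [coordMetric, Matrix.det_succ_row_zero, Fin.sum_univ_succ, Fin.succAbove, gtt, gtp,
      exp_neg_two_mul, -neg_mul]
    field_simp
    ring
  rw [this, abs_neg, abs_of_nonneg (sq_nonneg _), Real.sqrt_sq (by positivity)]

/-- The components of `F` with raised indices. -/
noncomputable def coordTwoFormUp (u W Λ : R2 → ℝ) (c p : R2 → ℝ) (Y : R2) :
    Matrix (Fin 4) (Fin 4) ℝ :=
  let N := Real.exp (-2 * Λ Y)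
  let E := Real.exp (2 * u Y)
  let p₀ := N * (pd 1 p Y / Y 0)
  let p₁ := -(N * (pd 0 p Y / Y 0))
  let c₀ := N * (W Y * pd 1 p Y / Y 0 + E * pd 0 c Y)
  let c₁ := N * (-(W Y * pd 0 p Y / Y 0) + E * pd 1 c Y)
  !![0, 0, p₀, p₁; 0, 0, c₀, c₁; -p₀, -c₀, 0, 0; -p₁, -c₁, 0, 0]

theorem raise_coordTwoForm {Y : R2} (hY : Y ∈ halfPlane) (c p : R2 → ℝ) (a b : Fin 4) :
    ∑ e, ∑ f, coordInv u W Λ Y a e * coordInv u W Λ Y b f * coordTwoForm u W c p Y e f =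
      coordTwoFormUp u W Λ c p Y a b := by
  have hY0 : Y 0 ≠ 0 := ne_of_gt hY
  fin_cases a <;> fin_cases b <;>
    simp [Fin.sum_univ_four, coordInv, coordTwoForm, coordTwoFormUp, exp_neg_two_mul, -neg_mul] <;>
    field_simp <;> ring

/-- The Hodge dual of `F`. -/
theorem hodge_coordForm (hχ : ∀ i, ContDiffOn ℝ ∞ (χ i) halfPlane)
    (hθ : IsPlanarTheta u χ ψ W θ) {X : R4} (hX : X ∈ coordDomain) (i : Fin k) (a b : Fin 4) :
    hodge (coordMetric u W Λ) (fieldStrength (coordForm χ θ i)) a b X =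
      coordTwoForm u W (fun Z => -ψ i Z) (χ i) (rzProj X) a b := by
  have hY := rzProj_mem hX
  have hY0 : rzProj X 0 ≠ 0 := ne_of_gt hY
  simp only [hodge, det_coordMetric hX, coordMetric_inv hX, fieldStrength_coordForm hχ hθ hX,
    raise_coordTwoForm hY, leviCivita_eq]
  rw [← rzProj_apply_zero X]
  generalize rzProj X = Y at *
  fin_cases a <;> fin_cases b <;>
    simp [Fin.sum_univ_four, coordTwoFormUp, coordTwoForm, exp_neg_two_mul, -neg_mul, pd_neg] <;>
    field_simp <;> ring

end Field

/-! ## The field equations in the coordinates `(t, ϕ, ρ, z)` -/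

section Equations

variable {k : ℕ} {u W Λ : R2 → ℝ} {o : Fin 2 → R2 → ℝ} {χ ψ θ : Fin k → R2 → ℝ}

/-- `ricciForm` is linear in its last four arguments, so the energy-momentum tensor can be compared
with it one gauge component at a time. -/
theorem ricciForm_sum (N E r w : ℝ) (f g h κ : Fin k → ℝ) (a b : Fin 4) :
    ricciForm N E r w (∑ i, f i) (∑ i, g i) (∑ i, h i) (∑ i, κ i) a b =
      ∑ i, ricciForm N E r w (f i) (g i) (h i) (κ i) a b := by
  fin_cases a <;> fin_cases b <;>
    simp [ricciForm, Finset.mul_sum, ← Finset.sum_add_distrib, ← Finset.sum_sub_distrib,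
      ← Finset.sum_neg_distrib]

/-- Contribution of a single gauge component. The last argument is the corresponding summand of the
curl of ω in `ReducedSystem`. -/
theorem sum_coordTwoForm_mul {Y : R2} (hY : Y ∈ halfPlane) (c p : R2 → ℝ) (a b : Fin 4) :
    ∑ e, ∑ f, coordInv u W Λ Y e f * (coordTwoForm u W c p Y a e * coordTwoForm u W c p Y b f
      + coordTwoForm u W (fun Z => -p Z) c Y a e * coordTwoForm u W (fun Z => -p Z) c Y b f) =
    ricciForm (Real.exp (-2 * Λ Y)) (Real.exp (2 * u Y)) (Y 0) (W Y)
      (pd 0 c Y * pd 0 c Y + pd 0 p Y * pd 0 p Y) (pd 0 c Y * pd 1 c Y + pd 0 p Y * pd 1 p Y)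
      (pd 1 c Y * pd 1 c Y + pd 1 p Y * pd 1 p Y)
      (4 * (pd 1 c Y * pd 0 p Y - pd 0 c Y * pd 1 p Y)) a b := by
  have hY0 : Y 0 ≠ 0 := ne_of_gt hY
  fin_cases a <;> fin_cases b <;>
    simp [Fin.sum_univ_four, coordInv, coordTwoForm, ricciForm, exp_neg_two_mul, -neg_mul,
      pd_neg] <;>
    field_simp <;> ring

theorem contDiffOn_coordTwoForm {c p : R2 → ℝ} (hu : ContDiffOn ℝ ∞ u halfPlane)
    (hW : ContDiffOn ℝ ∞ W halfPlane) (hc : ContDiffOn ℝ ∞ c halfPlane)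
    (hp : ContDiffOn ℝ ∞ p halfPlane) (a b : Fin 4) :
    ContDiffOn ℝ ∞ (fun Y => coordTwoForm u W c p Y a b) halfPlane := by
  have H := isOpen_halfPlane
  have c0 := contDiffOn_pd H hc 0
  have c1 := contDiffOn_pd H hc 1
  have rE := (contDiffOn_coord 0).mul (contDiffOn_exp_mul hu 2)
  have q0 := (rE.mul (contDiffOn_pd H hp 1)).neg.sub (hW.mul c0)
  have q1 := (rE.mul (contDiffOn_pd H hp 0)).sub (hW.mul c1)
  have z : ContDiffOn ℝ ∞ (fun _ : R2 => (0 : ℝ)) halfPlane := contDiffOn_const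
  fin_cases a <;> fin_cases b
  exacts [z, z, q0, q1, z, z, c0, c1, q0.neg, c0.neg, z, z, q1.neg, c1.neg, z, z]

section Closed

variable (S : ReducedSystem u o χ ψ) (hW : IsPlanarW u o W)

include S hW

/-- The counterpart of closedness of dθ under (χ, ψ) ↦ (-ψ, χ): it is the χ-equation multiplied by ρ
e^{2u}. -/
theorem pd_coordTwoForm_dual {Y : R2} (hY : Y ∈ halfPlane) (i : Fin k) :
    pd 1 (fun Z => coordTwoForm u W (fun Z => -ψ i Z) (χ i) Z 0 2) Y =
      pd 0 (fun Z => coordTwoForm u W (fun Z => -ψ i Z) (χ i) Z 0 3) Y := by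
  have H := isOpen_halfPlane
  have c := S.smooth_chi i
  have p := S.smooth_psi i
  have d0 := differentiableAt_of_halfPlane S.smooth_u hY
  have d1 := differentiableAt_of_halfPlane hW.smooth hY
  have d2 := differentiableAt_pd p hY 0
  have d3 := differentiableAt_pd p hY 1
  have d4 := differentiableAt_pd c hY 0
  have d5 := differentiableAt_pd c hY 1
  have hY0 : Y 0 ≠ 0 := ne_of_gt hY
  have h2 := S.eq_chi Y hY i
  have h3 := pd_comm H p hY 1 0
  have e2 : (fun Z => coordTwoForm u W (fun Z => -ψ i Z) (χ i) Z 0 2) =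
      fun Z => W Z * pd 0 (ψ i) Z - Z 0 * Real.exp (2 * u Z) * pd 1 (χ i) Z := by
    ext Z
    simp [coordTwoForm, pd_neg]
    ring
  have e3 : (fun Z => coordTwoForm u W (fun Z => -ψ i Z) (χ i) Z 0 3) =
      fun Z => W Z * pd 1 (ψ i) Z + Z 0 * Real.exp (2 * u Z) * pd 0 (χ i) Z := by
    ext Z
    simp [coordTwoForm, pd_neg]
    ring
  rw [e2, e3]
  simp (disch := fun_prop) only [pd_add, pd_sub, pd_mul, pd_exp_mul, pd_coord,
    hW.pd_zero Y hY, hW.pd_one Y hY, h3, exp_four_mul]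
  field_simp at h2 ⊢
  simp only [one_ne_zero, if_false, if_true]
  linear_combination -Real.exp (2 * u Y) * h2

/-- Up to the order of indices only two components are nontrivial: (t, ρ, z), settled by
`pd_coordTwoForm_dual`, and (ϕ, ρ, z), which is equality of the mixed derivatives of ψ. -/
theorem extDerivTwo_hodge (hθ : IsPlanarTheta u χ ψ W θ) {X : R4} (hX : X ∈ coordDomain)
    (i : Fin k) (a b c : Fin 4) :
    extDerivTwo (hodge (coordMetric u W Λ) (fieldStrength (coordForm χ θ i))) a b c X = 0 := by
  have hY := rzProj_mem hX
  have key : ∀ l a b, pd l (hodge (coordMetric u W Λ) (fieldStrength (coordForm χ θ i)) a b) X =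
      pdRZ l (fun Y => coordTwoForm u W (fun Z => -ψ i Z) (χ i) Y a b) (rzProj X) := fun l a b =>
    pd_of_eqOn_rzProj (f := fun Y => coordTwoForm u W (fun Z => -ψ i Z) (χ i) Y a b)
      (fun Z hZ => hodge_coordForm S.smooth_chi hθ hZ i a b) hX
      (differentiableAt_of_halfPlane (contDiffOn_coordTwoForm S.smooth_u hW.smooth
        (S.smooth_psi i).neg (S.smooth_chi i) a b) hY) l
  have h1 := pd_coordTwoForm_dual S hW hY i
  have h2 := pd_comm isOpen_halfPlane (S.smooth_psi i).neg hY 1 0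
  simp only [extDerivTwo, key]
  generalize rzProj X = Y at *
  have anti : ∀ l a b, pd l (fun Y => coordTwoForm u W (fun Z => -ψ i Z) (χ i) Y b a) Y =
      -pd l (fun Y => coordTwoForm u W (fun Z => -ψ i Z) (χ i) Y a b) Y := fun l a b => by
    rw [← pd_neg]
    congr 1
    ext Z
    fin_cases a <;> fin_cases b <;> simp [coordTwoForm, sub_eq_add_neg]
  have v0 : ∀ l a, pd l (fun Y => coordTwoForm u W (fun Z => -ψ i Z) (χ i) Y a a) Y = 0 :=
    fun l a => by linarith [anti l a a]
  have v1 : ∀ l, pd l (fun Y => coordTwoForm u W (fun Z => -ψ i Z) (χ i) Y 0 1) Y = 0 :=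
    fun l => pd_const l 0
  have v2 : ∀ l, pd l (fun Y => coordTwoForm u W (fun Z => -ψ i Z) (χ i) Y 2 3) Y = 0 :=
    fun l => pd_const l 0
  have h3 : pd 1 (fun Y => coordTwoForm u W (fun Z => -ψ i Z) (χ i) Y 1 2) Y =
      pd 0 (fun Y => coordTwoForm u W (fun Z => -ψ i Z) (χ i) Y 1 3) Y := h2
  have a1 := fun l => anti l 0 1
  have a2 := fun l => anti l 0 2
  have a3 := fun l => anti l 0 3
  have a4 := fun l => anti l 1 2
  have a5 := fun l => anti l 1 3
  have a6 := fun l => anti l 2 3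
  clear anti key h2
  fin_cases a <;> fin_cases b <;> fin_cases c <;>
    simp [pdRZ, v0, v1, v2, h1, h3, a1, a2, a3, a4, a5, a6]

end Closed

theorem two_mul_stressEnergy (S : ReducedSystem u o χ ψ) (hθ : IsPlanarTheta u χ ψ W θ) {X : R4}
    (hX : X ∈ coordDomain) (a b : Fin 4) :
    2 * stressEnergy (coordMetric u W Λ) (coordForm χ θ) a b X =
      coordRicci u o χ ψ W Λ (rzProj X) a b := by
  have hY := rzProj_mem hX
  simp only [stressEnergy, coordMetric_inv hX, fieldStrength_coordForm S.smooth_chi hθ hX,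
    hodge_coordForm S.smooth_chi hθ hX]
  generalize rzProj X = Y at *
  -- Here the identity dω = 4 ∑ dχᵢ ∧ dψᵢ turns the twist term of the Ricci tensor into a sum over
  -- the gauge components.
  rw [coordRicci, S.curl Y hY, ← mul_assoc, mul_one_div_cancel two_ne_zero, one_mul]
  simp only [gram, Finset.mul_sum]
  rw [ricciForm_sum]
  simp only [← sum_coordTwoForm_mul (u := u) (W := W) (Λ := Λ) hY]
  symm
  rw [Finset.sum_comm]
  exact Finset.sum_congr rfl fun e _ => Finset.sum_comm

theorem lorentzian_coordMetric {X : R4} (hX : X ∈ coordDomain) :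
    ∃ P : Matrix (Fin 4) (Fin 4) ℝ, IsUnit P.det ∧
      Pᵀ * coordMetric u W Λ X * P = Matrix.diagonal ![-1, 1, 1, 1] := by
  have hX2 : X 2 ≠ 0 := ne_of_gt hX
  have e : ∀ a : ℝ, Real.exp (2 * a) = Real.exp a ^ 2 := fun a => by
    rw [← Real.exp_nat_mul]
    norm_num
  let a := (X 2 * Real.exp (u (rzProj X)))⁻¹
  let b := Real.exp (u (rzProj X))
  let c := (Real.exp (Λ (rzProj X)))⁻¹
  -- The columns form the orthonormal frame ρ⁻¹ e^{-u} (∂_t + w ∂_ϕ), e^u ∂_ϕ, e^{-λ} ∂_ρ, e^{-λ}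
  -- ∂_z.
  refine ⟨!![a, 0, 0, 0; W (rzProj X) * a, b, 0, 0; 0, 0, c, 0; 0, 0, 0, c], ?_, ?_⟩
  · rw [isUnit_iff_ne_zero]
    simp [Matrix.det_succ_row_zero, Fin.sum_univ_succ, Fin.succAbove, a, b, c, hX2]
  · ext i j
    fin_cases i <;> fin_cases j <;>
      simp [Matrix.mul_apply, Fin.sum_univ_four, coordMetric, gtt, gtp, a, b, c, e,
        exp_neg_two_mul, -neg_mul] <;>
      (try field_simp) <;> (try ring)

theorem solvesInCoordinates_coordMetric (S : ReducedSystem u o χ ψ) (hW : IsPlanarW u o W)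
    (hΛ : IsPlanarLam u o χ ψ Λ) (hθ : IsPlanarTheta u χ ψ W θ) :
    SolvesInCoordinates coordDomain (coordMetric u W Λ) (coordForm χ θ) where
  smooth_metric a b := by
    have e2 := contDiffOn_exp_mul S.smooth_u 2
    have e3 := contDiffOn_exp_mul S.smooth_u (-2)
    have m00 := contDiffOn_comp_rzProj ((((contDiffOn_coord 0).pow 2).mul e2).neg.add
      (e3.mul (hW.smooth.pow 2)))
    have m01 := contDiffOn_comp_rzProj (e3.mul hW.smooth).neg
    have m11 := contDiffOn_comp_rzProj e3
    have m22 := contDiffOn_comp_rzProj (contDiffOn_exp_mul hΛ.smooth 2)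
    have z : ContDiffOn ℝ ∞ (fun _ : R4 => (0 : ℝ)) coordDomain := contDiffOn_const
    fin_cases a <;> fin_cases b
    exacts [m00, m01, z, z, m01, m11, z, z, z, z, m22, z, z, z, z, m22]
  smooth_form i a := by
    have z : ContDiffOn ℝ ∞ (fun _ : R4 => (0 : ℝ)) coordDomain := contDiffOn_const
    fin_cases a
    exacts [contDiffOn_comp_rzProj (hθ.smooth i).neg, contDiffOn_comp_rzProj (S.smooth_chi i).neg,
      z, z]
  symmetric X _ := by
    ext a b
    fin_cases a <;> fin_cases b <;> rfl
  lorentzian X hX := lorentzian_coordMetric hX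
  einstein X hX a b := by
    rw [ricci_coordMetric S hW hΛ hX, scalarCurvature_coordMetric S hW hΛ hX,
      two_mul_stressEnergy S hθ hX]
    ring
  yangMills X hX i a b c := extDerivTwo_hodge S hW hθ hX i a b c

end Equations

/-! ## Locality of the field equations -/

section Locality

section

variable {ι : Type*} [Fintype ι] [DecidableEq ι] {U : Set (ι → ℝ)} (hU : IsOpen U)
  {g g' : (ι → ℝ) → Matrix ι ι ℝ} (hg : Set.EqOn g g' U)

include hU hg

theorem christoffel_congr (a b c : ι) : Set.EqOn (christoffel g a b c) (christoffel g' a b c) U := by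
  intro p hp
  have h : ∀ l a b, pd l (fun q => g q a b) p = pd l (fun q => g' q a b) p := fun l a b =>
    pd_congr_of_eqOn hU (fun q hq => congrFun (congrFun (hg hq) a) b) hp l
  simp only [christoffel, hg hp, h]

theorem ricci_congr (b c : ι) : Set.EqOn (ricci g b c) (ricci g' b c) U := by
  intro p hp
  have h : ∀ l a b c, pd l (christoffel g a b c) p = pd l (christoffel g' a b c) p :=
    fun l a b c => pd_congr_of_eqOn hU (christoffel_congr hU hg a b c) hp l
  simp only [ricci, h, christoffel_congr hU hg _ _ _ hp]

theorem scalarCurvature_congr : Set.EqOn (scalarCurvature g) (scalarCurvature g') U := by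
  intro p hp
  simp only [scalarCurvature, hg hp, ricci_congr hU hg _ _ hp]

end

theorem fieldStrength_congr {U : Set R4} (hU : IsOpen U) {A A' : R4 → R4} (hA : Set.EqOn A A' U)
    (a b : Fin 4) : Set.EqOn (fieldStrength A a b) (fieldStrength A' a b) U := by
  intro p hp
  have h : ∀ l a, pd l (fun q => A q a) p = pd l (fun q => A' q a) p := fun l a =>
    pd_congr_of_eqOn hU (fun q hq => congrFun (hA hq) a) hp l
  simp only [fieldStrength, h]

theorem hodge_congr {U : Set R4} {g g' : R4 → Matrix (Fin 4) (Fin 4) ℝ} (hg : Set.EqOn g g' U)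
    {F F' : Fin 4 → Fin 4 → R4 → ℝ} (hF : ∀ a b, Set.EqOn (F a b) (F' a b) U) (a b : Fin 4) :
    Set.EqOn (hodge g F a b) (hodge g' F' a b) U := by
  intro p hp
  simp only [hodge, hg hp, hF _ _ hp]

/-- Needed because the pulled-back metric and form are identified with the coordinate expressions
only where ρ > 0; on an open set this determines all derivatives. -/
theorem SolvesInCoordinates.congr {k : ℕ} {U : Set R4} (hU : IsOpen U)
    {g g' : R4 → Matrix (Fin 4) (Fin 4) ℝ} (hg : Set.EqOn g g' U) {A A' : Fin k → R4 → R4}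
    (hA : ∀ i, Set.EqOn (A i) (A' i) U) (h : SolvesInCoordinates U g' A') :
    SolvesInCoordinates U g A := by
  have hF : ∀ i a b, Set.EqOn (fieldStrength (A i) a b) (fieldStrength (A' i) a b) U :=
    fun i => fieldStrength_congr hU (hA i)
  have hH : ∀ i a b, Set.EqOn (hodge g (fieldStrength (A i)) a b)
      (hodge g' (fieldStrength (A' i)) a b) U := fun i => hodge_congr hg (hF i)
  refine ⟨fun a b => (h.smooth_metric a b).congr fun p hp => by rw [hg hp],
    fun i a => (h.smooth_form i a).congr fun p hp => by rw [hA i hp],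
    fun p hp => by rw [hg hp]; exact h.symmetric p hp,
    fun p hp => by rw [hg hp]; exact h.lorentzian p hp, fun p hp a b => ?_, fun p hp i a b c => ?_⟩
  · rw [ricci_congr hU hg a b hp, scalarCurvature_congr hU hg hp, hg hp, h.einstein p hp]
    simp only [stressEnergy, hg hp, hF _ _ _ hp, hH _ _ _ hp]
  · rw [← h.yangMills p hp i a b c]
    simp only [extDerivTwo, pd_congr_of_eqOn hU (hH i _ _) hp]

end Locality

/-! ## Cylindrical coordinates -/

/-- The coordinates `(t, ϕ, ρ, z)` of space-time. -/
noncomputable def cylChart (X : R4) : ℝ × E3 :=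
  (X 0, !₂[X 2 * Real.cos (X 1), X 2 * Real.sin (X 1), X 3])

theorem cylChart_snd (X : R4) : (cylChart X).2 = rotZ (X 1) (planePoint (rzProj X)) := by
  ext j
  fin_cases j <;> simp [cylChart, rotZ, mul_comm]

theorem cylChart_snd_notMem {X : R4} (hX : X ∈ coordDomain) : (cylChart X).2 ∉ zAxis := by
  rw [cylChart_snd]
  exact rotZ_notMem_zAxis _ (planePoint_notMem_zAxis (rzProj_mem hX))

theorem meridian_cylChart {X : R4} (hX : X ∈ coordDomain) :
    meridian (cylChart X).2 = rzProj X := by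
  rw [cylChart_snd, meridian_rotZ, meridian_planePoint (rzProj_mem hX)]

theorem rho_cylChart {X : R4} (hX : X ∈ coordDomain) : rho (cylChart X).2 = X 2 :=
  congrFun (meridian_cylChart hX) 0

theorem contDiff_cylChart : ContDiff ℝ ∞ cylChart := by
  have h := fun j => contDiff_apply (n := ∞) ℝ ℝ (j : Fin 4)
  refine (h 0).prodMk (contDiff_euclidean.2 fun j => ?_)
  fin_cases j
  exacts [(h 2).mul (h 1).cos, (h 2).mul (h 1).sin, h 3]

/-- The angle ranges over all of ℝ, so one chart, not injective but a local diffeomorphism, covers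
the whole space-time. -/
theorem exists_cylChart {p : ℝ × E3} (hp : p ∈ spacetime) : ∃ X ∈ coordDomain, cylChart X = p := by
  obtain ⟨α, hα⟩ := exists_angle p.2
  refine ⟨![p.1, α, rho p.2, p.2 2], rho_pos hp, Prod.ext rfl ?_⟩
  rw [cylChart_snd, rzProj_apply]
  exact hα.symm

theorem fderiv_cylChart (X V : R4) : fderiv ℝ cylChart X V =
    (V 0, !₂[Real.cos (X 1) * V 2 - X 2 * Real.sin (X 1) * V 1,
      Real.sin (X 1) * V 2 + X 2 * Real.cos (X 1) * V 1, V 3]) := by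
  have h := fun j : Fin 4 => hasFDerivAt_apply (𝕜 := ℝ) j X
  have hd : DifferentiableAt ℝ cylChart X := contDiff_cylChart.differentiable (by simp) X
  -- Each component of the derivative is isolated by a continuous linear functional L and compared
  -- with the derivative of L ∘ `cylChart`.
  have hL : ∀ {f : R4 → ℝ} {f' : R4 →L[ℝ] ℝ} (L : ℝ × E3 →L[ℝ] ℝ), HasFDerivAt f f' X →
      (∀ Z, f Z = L (cylChart Z)) → L (fderiv ℝ cylChart X V) = f' V := fun L hf e =>
    DFunLike.congr_fun ((L.hasFDerivAt.comp X hd.hasFDerivAt).unique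
      (hf.congr_of_eventuallyEq (Filter.Eventually.of_forall fun Z => (e Z).symm))) V
  let P := fun j : Fin 3 => (EuclideanSpace.proj j : E3 →L[ℝ] ℝ).comp
    (ContinuousLinearMap.snd ℝ ℝ E3)
  refine Prod.ext (hL (ContinuousLinearMap.fst ℝ ℝ E3) (h 0) fun Z => rfl) ?_
  ext j
  fin_cases j
  · refine (hL (P 0) ((h 2).mul (h 1).cos) fun Z => rfl).trans ?_
    simp
    ring
  · refine (hL (P 1) ((h 2).mul (h 1).sin) fun Z => rfl).trans ?_
    simp
    ring
  · exact hL (P 2) (h 3) fun Z => rfl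

theorem dRho_fderiv_cylChart {X : R4} (hX : X ∈ coordDomain) (V : R4) :
    dRho (cylChart X).2 (fderiv ℝ cylChart X V).2 = V 2 := by
  have hX2 : X 2 ≠ 0 := ne_of_gt hX
  rw [dRho, rho_cylChart hX, fderiv_cylChart]
  simp [cylChart]
  field_simp
  linear_combination V 2 * Real.cos_sq_add_sin_sq (X 1)

theorem dPhi_fderiv_cylChart {X : R4} (hX : X ∈ coordDomain) (V : R4) :
    dPhi (cylChart X).2 (fderiv ℝ cylChart X V).2 = V 1 := by
  have hX2 : X 2 ≠ 0 := ne_of_gt hX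
  rw [dPhi, rho_cylChart hX, fderiv_cylChart]
  simp [cylChart]
  field_simp
  linear_combination X 2 * V 1 * Real.cos_sq_add_sin_sq (X 1)

/-- The forms dt, dϕ, dρ, dz recover the components of V from its image, which gives injectivity;
both spaces have dimension four. -/
theorem bijective_fderiv_cylChart {X : R4} (hX : X ∈ coordDomain) :
    Function.Bijective (fderiv ℝ cylChart X) := by
  have hi : Function.Injective (fderiv ℝ cylChart X) := fun V V' h => by
    have h1 := dPhi_fderiv_cylChart hX V
    have h2 := dRho_fderiv_cylChart hX V
    rw [h, dPhi_fderiv_cylChart hX] at h1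
    rw [h, dRho_fderiv_cylChart hX] at h2
    rw [fderiv_cylChart, fderiv_cylChart] at h
    have h0 := congrArg Prod.fst h
    have h3 := congrArg (fun q => q.2 2) h
    ext j
    fin_cases j
    exacts [h0, h1.symm, h2.symm, h3]
  exact ⟨hi, (LinearMap.injective_iff_surjective_of_finrank_eq_finrank
    (f := (fderiv ℝ cylChart X).toLinearMap) (by simp)).1 hi⟩

/-! ### The space-time metric and the one-form in the cylindrical chart -/

section Pullback

variable {k : ℕ} {φ : E3 → HSpace k} {w lam : E3 → ℝ} {θ : Fin k → E3 → ℝ}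
  (hs : ∀ α, ∀ x ∉ zAxis, φ (rotZ α x) = φ x)

include hs

theorem stMetric_cylChart (hw : ∀ α, ∀ x ∉ zAxis, w (rotZ α x) = w x)
    (hl : ∀ α, ∀ x ∉ zAxis, lam (rotZ α x) = lam x) {X : R4} (hX : X ∈ coordDomain) :
    (Matrix.of fun a b => stMetric φ w lam (cylChart X) (fderiv ℝ cylChart X (Pi.single a 1))
      (fderiv ℝ cylChart X (Pi.single b 1))) =
    coordMetric (planeU φ) (fun Y => w (planePoint Y)) (fun Y => lam (planePoint Y)) X := by
  have hx := cylChart_snd_notMem hX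
  have e1 : uu (φ (cylChart X).2) = planeU φ (rzProj X) := by
    rw [← meridian_cylChart hX]
    exact apply_eq_planeComp hs hx _
  have e2 := eq_comp_meridian hw hx
  have e3 := eq_comp_meridian hl hx
  rw [meridian_cylChart hX] at e2 e3
  have e4 : ∀ V, (fderiv ℝ cylChart X V).1 = V 0 := fun V => by rw [fderiv_cylChart]
  have e5 : ∀ V, (fderiv ℝ cylChart X V).2 2 = V 3 := fun V => by rw [fderiv_cylChart]; rfl
  ext a b
  simp only [Matrix.of_apply, stMetric, dRho_fderiv_cylChart hX, dPhi_fderiv_cylChart hX, e1, e2,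
    e3, e4, e5, rho_cylChart hX]
  fin_cases a <;> fin_cases b <;> simp [coordMetric, gtt, gtp] <;> ring

theorem stForm_cylChart (hθ : ∀ i, ∀ α, ∀ x ∉ zAxis, θ i (rotZ α x) = θ i x) {X : R4}
    (hX : X ∈ coordDomain) (i : Fin k) :
    (fun a => stForm φ θ i (cylChart X) (fderiv ℝ cylChart X (Pi.single a 1))) =
      coordForm (planeChi φ) (fun i Y => θ i (planePoint Y)) i X := by
  have hx := cylChart_snd_notMem hX
  have e1 : chi i (φ (cylChart X).2) = planeChi φ i (rzProj X) := by
    rw [← meridian_cylChart hX]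
    exact apply_eq_planeComp hs hx _
  have e2 := eq_comp_meridian (hθ i) hx
  rw [meridian_cylChart hX] at e2
  have e4 : ∀ V, (fderiv ℝ cylChart X V).1 = V 0 := fun V => by rw [fderiv_cylChart]
  ext a
  simp only [stForm, dPhi_fderiv_cylChart hX, e1, e2, e4]
  fin_cases a <;> simp [coordForm]

end Pullback

theorem isEYMSolution_spacetime {k : ℕ} {φ : E3 → HSpace k} {w lam : E3 → ℝ} {θ : Fin k → E3 → ℝ}
    (hφ : IsHarmonicMap zAxisᶜ φ) (hs : ∀ α, ∀ x ∉ zAxis, φ (rotZ α x) = φ x)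
    (hw : IsPotentialW φ w) (hl : IsPotentialLam φ lam) (hθ : IsPotentialTheta φ w θ) :
    IsEYMSolution spacetime (stMetric φ w lam) (stForm φ θ) := by
  intro p hp
  have S : ReducedSystem (planeU φ) (planeOmega φ) (planeChi φ) (planePsi φ) :=
    reducedSystem_of_isHarmonicMap hφ hs
  obtain ⟨aw, pw⟩ := planarW_of_isPotentialW hφ.1 hs hw
  obtain ⟨al, pl⟩ := planarLam_of_isPotentialLam hφ.1 hs hl
  obtain ⟨aθ, pθ⟩ := planarTheta_of_isPotentialTheta hφ.1 hs hw hθ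
  exact ⟨coordDomain, cylChart, isOpen_coordDomain, contDiff_cylChart.contDiffOn,
    fun X hX => cylChart_snd_notMem hX, exists_cylChart hp, fun X hX => bijective_fderiv_cylChart hX,
    (solvesInCoordinates_coordMetric S pw pl pθ).congr isOpen_coordDomain
      (fun X hX => stMetric_cylChart hs aw al hX) fun i X hX => stForm_cylChart hs aθ hX i⟩

end EYM

/-! ### Assembly of the theorem -/

theorem mainTheorem3 {N k : ℕ} (hN : 1 ≤ N) (D : EYM.RodData N k) (φ : EYM.E3 → EYM.HSpace k)
    (hφ : D.SolvesReducedProblem φ) :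
    (∃ w : EYM.E3 → ℝ, EYM.IsPotentialW φ w) ∧
    (∃ lam : EYM.E3 → ℝ, EYM.IsPotentialLam φ lam) ∧
    (∀ w : EYM.E3 → ℝ, EYM.IsPotentialW φ w →
      ∃ θ : Fin k → EYM.E3 → ℝ, EYM.IsPotentialTheta φ w θ) ∧
    ∀ (w lam : EYM.E3 → ℝ) (θ : Fin k → EYM.E3 → ℝ),
      EYM.IsPotentialW φ w → EYM.IsPotentialLam φ lam → EYM.IsPotentialTheta φ w θ →
      EYM.IsEYMSolution EYM.spacetime (EYM.stMetric φ w lam) (EYM.stForm φ θ) := by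
  have hsub := EYM.compl_zAxis_subset_compl_sing D
  have hh : EYM.IsHarmonicMap EYM.zAxisᶜ φ :=
    ⟨hφ.harmonic.1.mono hsub, fun x hx => hφ.harmonic.2 x (hsub hx)⟩
  have hs : ∀ α, ∀ x ∉ EYM.zAxis, φ (EYM.rotZ α x) = φ x := fun α x hx =>
    hφ.axisymmetric α x (hsub hx)
  have S : EYM.ReducedSystem (EYM.planeU φ) (EYM.planeOmega φ) (EYM.planeChi φ) (EYM.planePsi φ) :=
    EYM.reducedSystem_of_isHarmonicMap hh hs
  obtain ⟨W, hW⟩ := S.exists_planarW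
  obtain ⟨Λ, hΛ⟩ := S.exists_planarLam
  refine ⟨⟨_, EYM.isPotentialW_of_planar hh.1 hs hW⟩, ⟨_, EYM.isPotentialLam_of_planar hh.1 hs hΛ⟩,
    fun w hw => ?_, fun w lam θ hw hl hθ => EYM.isEYMSolution_spacetime hh hs hw hl hθ⟩
  -- θ is built from the restriction of the given w to the half-plane, since its equation depends on
  -- the additive constant in w.
  obtain ⟨θ, hθ⟩ := S.exists_planarTheta (EYM.planarW_of_isPotentialW hh.1 hs hw).2
  exact ⟨_, EYM.isPotentialTheta_of_planar hh.1 hs hw hθ⟩
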